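/- Let $M$ be a (Hausdorff, finite-dimensional, boundaryless) smooth real manifold with tangent bundle $T$ and let $\mathcal J$ be a generalized almost complex structure on $M$, i.e. a smooth bundle endomorphism of $T\oplus T^*$ with $\mathcal J^2=-1$ that is orthogonal for the inner product $\langle X+\xi,Y+\eta\rangle=\tfrac12(\xi(Y)+\eta(X))$; then $\dim M=2n$ is even if $M\neq\emptyset$. Let $L\subset(T\oplus T^*)\otimes\mathbb C$ be the $+i$-eigenbundle of $\mathcal J$ and $\overline L$ its complex conjugate. Let $T\oplus T^*$ act on $\wedge^\bullet T^*\otimes\mathbb C$ by $(X+\xi)\cdot\varphi=i_X\varphi+\xi\wedge\varphi$, extended complex linearly to $(T\oplus T^*)\otimes\mathbb C$. Let $U_0=\{\varphi : L\cdot\varphi=0\}$ be the canonical line bundle, put $U_k=\wedge^k\overline L\cdot U_0$ for $0\le k\le 2n$ (the span of all $a_1\cdots a_k\cdot\varphi$ with $a_i\in\overline L$, $\varphi\in U_0$), and $U_k=\{0\}$ for $k<0$ and $k>2n$. Call $\mathcal J$ integrable if $C^\infty(L)$ is closed under the complex bilinear extension of the Courant bracket $$[X+\xi,Y+\eta]=[X,Y]+\mathcal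 L_X\eta-\mathcal L_Y\xi-\tfrac12 d(i_X\eta-i_Y\xi).$$ Then $\wedge^\bullet T^*\otimes\mathbb C=\bigoplus_k U_k$ at every point of $M$. With $\pi_k$ the projection onto $U_k$ in this decomposition, the formulas $$\overline\partial=\pi_{k+1}\circ d:C^\infty(U_k)\to C^\infty(U_{k+1}),\qquad \partial=\pi_{k-1}\circ d:C^\infty(U_k)\to C^\infty(U_{k-1})$$ define operators between the stated spaces of smooth sections, for every $k\in\mathbb Z$. Moreover, $\mathcal J$ is integrable if and only if $d=\partial+\overline\partial$ on $C^\infty(U_k)$ for every $k$. -/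

import Mathlib

open scoped Manifold ContDiff Bundle
open Module

namespace GenCx

noncomputable section

/-! ### Linear algebra of `V ⊕ V*` and its spinors -/

section Linear

/-- `V ⊕ V*` for a real (finite-dimensional) topological vector space `V`. -/
abbrev Gen (V : Type*) [AddCommGroup V] [Module ℝ V] [TopologicalSpace V] : Type _ :=
  V × (V →L[ℝ] ℝ)

/-- The complexification `W ⊗ ℂ = W ⊕ iW` of a real vector space `W`: the pair `⟨a, b⟩` is the
vector `a + i b`. -/
@[ext] structure Cx (W : Type*) where
  /-- real part -/
  re : W
  /-- imaginary part -/
  im : W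

namespace Cx

variable {W W' : Type*}

/-- Complex conjugation `a + i b ↦ a - i b`. -/
def conj [Neg W] (v : Cx W) : Cx W := ⟨v.re, -v.im⟩

/-- Multiplication by `i`. -/
def iMul [Neg W] (v : Cx W) : Cx W := ⟨-v.im, v.re⟩

/-- The complex linear extension of a real linear map. -/
def map (f : W → W') (v : Cx W) : Cx W' := ⟨f v.re, f v.im⟩

end Cx

variable {V : Type*} [AddCommGroup V] [Module ℝ V] [TopologicalSpace V]

/-- The inner product `⟨X + ξ, Y + η⟩ = (ξ(Y) + η(X)) / 2` on `V ⊕ V*`. -/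
def pairing (a b : Gen V) : ℝ := (1 / 2) * (a.2 b.1 + b.2 a.1)

section Forms

variable {F : Type*} [AddCommGroup F] [Module ℝ F] [TopologicalSpace F] {k : ℕ}

/-- Interior product `i_X φ = φ(X, ·, …, ·)`. -/
def interior (X : V) (φ : V [⋀^Fin (k + 1)]→L[ℝ] F) : V [⋀^Fin k]→L[ℝ] F :=
  { φ.toAlternatingMap.curryLeft X with
    cont := by
      have h : Continuous fun v : Fin k → V => (Matrix.vecCons X v : Fin (k + 1) → V) := by
        refine continuous_pi fun i => ?_
        refine Fin.cases ?_ (fun j => ?_) i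
        · exact continuous_const
        · exact continuous_apply j
      exact φ.cont.comp h }

/-- `ξ ∧ φ` for a one-form `ξ`:
`(ξ ∧ φ)(v₀, …, v_k) = ∑ i, (-1)^i ξ(v_i) φ(v₀, …, v̂_i, …, v_k)`. -/
def wedgeOne [IsTopologicalAddGroup F] [ContinuousSMul ℝ F]
    (ξ : V →L[ℝ] ℝ) (φ : V [⋀^Fin k]→L[ℝ] F) : V [⋀^Fin (k + 1)]→L[ℝ] F :=
  { AlternatingMap.alternatizeUncurryFin
      ((ξ : V →ₗ[ℝ] ℝ).smulRight φ.toAlternatingMap) with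
    cont := by
      have h : Continuous fun v : Fin (k + 1) → V =>
          ∑ i : Fin (k + 1), (-1 : ℤ) ^ (i : ℕ) • (ξ (v i) • φ (i.removeNth v)) := by
        refine continuous_finsetSum _ fun i _ => ?_
        refine Continuous.zsmul ?_ _
        refine (ξ.continuous.comp (continuous_apply i)).smul (φ.cont.comp ?_)
        exact continuous_pi fun j => continuous_apply _
      convert h using 2 with v
      exact AlternatingMap.alternatizeUncurryFin_apply _ _ }

@[simp] theorem interior_apply (X : V) (φ : V [⋀^Fin (k + 1)]→L[ℝ] F) (v : Fin k → V) :
    interior X φ v = φ (Matrix.vecCons X v) := rfl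

@[simp] theorem wedgeOne_apply [IsTopologicalAddGroup F] [ContinuousSMul ℝ F]
    (ξ : V →L[ℝ] ℝ) (φ : V [⋀^Fin k]→L[ℝ] F) (v : Fin (k + 1) → V) :
    wedgeOne ξ φ v = ∑ i : Fin (k + 1), (-1 : ℤ) ^ (i : ℕ) • (ξ (v i) • φ (i.removeNth v)) :=
  AlternatingMap.alternatizeUncurryFin_apply _ _

end Forms

variable (V) in
/-- The spinors `∧^• V* ⊗ ℂ`: inhomogeneous complex-valued forms, one component in each degree
(the components above `dim V` vanish automatically). -/
abbrev Spinor : Type _ := ∀ k : ℕ, V [⋀^Fin k]→L[ℝ] ℂ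

/-- Clifford action `(X + ξ) · φ = i_X φ + ξ ∧ φ` of `V ⊕ V*`. -/
def clifford (a : Gen V) (φ : Spinor V) : Spinor V
  | 0 => interior a.1 (φ 1)
  | k + 1 => interior a.1 (φ (k + 2)) + wedgeOne a.2 (φ k)

/-- Complex linear extension of the Clifford action to `(V ⊕ V*) ⊗ ℂ`. -/
def cliffordC (a : Cx (Gen V)) (φ : Spinor V) : Spinor V :=
  clifford a.re φ + Complex.I • clifford a.im φ

/-- The `+i`-eigenspace `L` of an endomorphism `J` of `V ⊕ V*`. -/
def eigenL (J : Gen V →L[ℝ] Gen V) : Set (Cx (Gen V)) := {a | a.map J = a.iMul}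

/-- The complex conjugate `L̄` of the `+i`-eigenspace. -/
def eigenLbar (J : Gen V →L[ℝ] Gen V) : Set (Cx (Gen V)) := {a | a.conj ∈ eigenL J}

theorem clifford_add (a : Gen V) (φ ψ : Spinor V) :
    clifford a (φ + ψ) = clifford a φ + clifford a ψ := by
  funext k
  cases k <;> ext v <;> simp [clifford, Finset.sum_add_distrib]
  ring

theorem clifford_smul (a : Gen V) (c : ℂ) (φ : Spinor V) :
    clifford a (c • φ) = c • clifford a φ := by
  funext k
  cases k <;> ext v <;> simp [clifford, Finset.mul_sum, mul_left_comm]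

theorem cliffordC_add (a : Cx (Gen V)) (φ ψ : Spinor V) :
    cliffordC a (φ + ψ) = cliffordC a φ + cliffordC a ψ := by
  simp only [cliffordC, clifford_add, smul_add]
  abel

theorem cliffordC_smul (a : Cx (Gen V)) (c : ℂ) (φ : Spinor V) :
    cliffordC a (c • φ) = c • cliffordC a φ := by
  simp only [cliffordC, clifford_smul, smul_add, smul_comm c Complex.I]

/-- The canonical line `U₀` of spinors annihilated by `L`. -/
def canonicalLine (J : Gen V →L[ℝ] Gen V) : Submodule ℂ (Spinor V) where
  carrier := {φ | ∀ a ∈ eigenL J, cliffordC a φ = 0}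
  add_mem' hφ hψ a ha := by rw [cliffordC_add, hφ a ha, hψ a ha, add_zero]
  zero_mem' a _ := by
    have h := cliffordC_smul a 0 0
    rwa [zero_smul ℂ (0 : Spinor V), zero_smul ℂ (cliffordC a 0)] at h
  smul_mem' c φ hφ a ha := by rw [cliffordC_smul, hφ a ha]; exact smul_zero (A := Spinor V) c

/-- `∧^k L̄ · U₀`, the span of all `a₁ · a₂ ⋯ a_k · φ` with `a_i ∈ L̄` and `φ ∈ U₀`
(as `L̄` is isotropic, its elements anticommute in the Clifford algebra, so that such a product
is the action of `a₁ ∧ ⋯ ∧ a_k`). -/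
def wedgeLbar (J : Gen V →L[ℝ] Gen V) : ℕ → Submodule ℂ (Spinor V)
  | 0 => canonicalLine J
  | k + 1 => Submodule.span ℂ
      {ψ | ∃ a ∈ eigenLbar J, ∃ φ ∈ wedgeLbar J k, ψ = cliffordC a φ}

/-- The grading `U_k`: `U_k = ∧^k L̄ · U₀` for `0 ≤ k ≤ dim V` and `U_k = 0` otherwise. -/
def gradedU (J : Gen V →L[ℝ] Gen V) (k : ℤ) : Submodule ℂ (Spinor V) :=
  if 0 ≤ k ∧ k ≤ (finrank ℝ V : ℤ) then wedgeLbar J k.toNat else ⊥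

open Classical in
/-- The projection `π_k` onto `U_k` along the other summands of `∧^• V* ⊗ ℂ = ⨁ U_j`. -/
def projU (J : Gen V →L[ℝ] Gen V) (k : ℤ) (φ : Spinor V) : Spinor V :=
  if h : DirectSum.IsInternal (gradedU J) then
    ((LinearEquiv.ofBijective (DirectSum.coeLinearMap (gradedU J)) h).symm φ k : Spinor V)
  else 0

end Linear

/-! ### Calculus on a manifold -/

section Manifold

variable {E : Type*} [NormedAddCommGroup E] [NormedSpace ℝ E]
  {M : Type*} [TopologicalSpace M] [ChartedSpace E M]

variable (E) in
/-- The fibre `T_x` of the tangent bundle. -/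
abbrev T (x : M) : Type _ := TangentSpace 𝓘(ℝ, E) x

variable (E) in
/-- The fibre of `T ⊕ T*` at `x`. -/
abbrev TT (x : M) : Type _ := T E x × (T E x →L[ℝ] ℝ)

section Forms

variable {F : Type*} [NormedAddCommGroup F] [NormedSpace ℝ F] {k : ℕ}

/-- Smoothness of an `F`-valued `k`-form on `M`. -/
def SmoothForm [IsManifold 𝓘(ℝ, E) ∞ M] (w : ∀ x : M, T E x [⋀^Fin k]→L[ℝ] F) : Prop :=
  ContMDiff 𝓘(ℝ, E) (𝓘(ℝ, E).prod 𝓘(ℝ, E [⋀^Fin k]→L[ℝ] F)) ∞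
    (fun x => Bundle.TotalSpace.mk' (E [⋀^Fin k]→L[ℝ] F)
      (E := fun x : M => T E x [⋀^Fin k]→L[ℝ] Bundle.Trivial M F x) x (w x))

/-- The exterior derivative of a `k`-form on `M`: at `x`, pull the form back to the model space
by the inverse of the chart at `x`, differentiate there, and pull the result back by the chart. -/
def extD (w : ∀ x : M, T E x [⋀^Fin k]→L[ℝ] F) (x : M) : T E x [⋀^Fin (k + 1)]→L[ℝ] F :=
  let w' : E → E [⋀^Fin k]→L[ℝ] F := fun y =>
    (w ((extChartAt 𝓘(ℝ, E) x).symm y)).compContinuousLinearMap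
      (mfderiv 𝓘(ℝ, E) 𝓘(ℝ, E) (extChartAt 𝓘(ℝ, E) x).symm y)
  (extDeriv w' (extChartAt 𝓘(ℝ, E) x x)).compContinuousLinearMap
    (mfderiv 𝓘(ℝ, E) 𝓘(ℝ, E) (extChartAt 𝓘(ℝ, E) x) x)

end Forms

/-- Smoothness of a section of `T ⊕ T*`: both of its components are smooth. -/
def SmoothTT [IsManifold 𝓘(ℝ, E) ∞ M] (A : ∀ x : M, TT E x) : Prop :=
  ContMDiff 𝓘(ℝ, E) (𝓘(ℝ, E).prod 𝓘(ℝ, E)) ∞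
    (fun x => Bundle.TotalSpace.mk' E (E := fun x : M => T E x) x (A x).1) ∧
  ContMDiff 𝓘(ℝ, E) (𝓘(ℝ, E).prod 𝓘(ℝ, E →L[ℝ] ℝ)) ∞
    (fun x => Bundle.TotalSpace.mk' (E →L[ℝ] ℝ)
      (E := fun x : M => T E x →L[ℝ] Bundle.Trivial M ℝ x) x (A x).2)

/-- The differential of a function, as a one-form. -/
def dFun (f : M → ℝ) (x : M) : T E x →L[ℝ] ℝ := mfderiv 𝓘(ℝ, E) 𝓘(ℝ, ℝ) f x

/-- The Lie derivative `L_X η = i_X dη + d(i_X η)` of a one-form. -/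
def lieD (X : ∀ x : M, T E x) (η : ∀ x : M, T E x →L[ℝ] ℝ) (x : M) : T E x →L[ℝ] ℝ :=
  (ContinuousAlternatingMap.ofSubsingleton ℝ (T E x) ℝ (0 : Fin 1)).symm
    (interior (X x)
      (extD (fun y => ContinuousAlternatingMap.ofSubsingleton ℝ (T E y) ℝ (0 : Fin 1) (η y)) x))
  + dFun (fun y => η y (X y)) x

/-- The Courant bracket
`[X + ξ, Y + η] = [X, Y] + L_X η - L_Y ξ - d(i_X η - i_Y ξ) / 2`. -/
def courant (A B : ∀ x : M, TT E x) (x : M) : TT E x :=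
  (VectorField.mlieBracket 𝓘(ℝ, E) (fun y => (A y).1) (fun y => (B y).1) x,
    lieD (fun y => (A y).1) (fun y => (B y).2) x
      - lieD (fun y => (B y).1) (fun y => (A y).2) x
      - (1 / 2 : ℝ) • dFun (fun y => (B y).2 (A y).1 - (A y).2 (B y).1) x)

/-- The complex bilinear extension of the Courant bracket to sections of `(T ⊕ T*) ⊗ ℂ`. -/
def courantC (A B : ∀ x : M, Cx (TT E x)) (x : M) : Cx (TT E x) :=
  ⟨courant (fun y => (A y).re) (fun y => (B y).re) x
      - courant (fun y => (A y).im) (fun y => (B y).im) x,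
    courant (fun y => (A y).re) (fun y => (B y).im) x
      + courant (fun y => (A y).im) (fun y => (B y).re) x⟩

/-- The exterior derivative on inhomogeneous complex forms. -/
def extDC (ρ : ∀ x : M, Spinor (T E x)) (x : M) : Spinor (T E x)
  | 0 => 0
  | k + 1 => extD (fun y => ρ y k) x

variable (E M) in
/-- A generalized almost complex structure: a smooth bundle endomorphism `J` of `T ⊕ T*` with
`J² = -1` which is orthogonal for the inner product. Smoothness of `J` is expressed on sections:
`J` maps smooth sections to smooth sections. (On a Hausdorff manifold local frames can be cut off to
global sections, so this is the smoothness of the matrix entries of `J` in local frames.) -/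
structure GenAlmostComplex [IsManifold 𝓘(ℝ, E) ∞ M] where
  /-- the endomorphism of each fibre -/
  J : ∀ x : M, TT E x →L[ℝ] TT E x
  sq : ∀ (x : M) (a : TT E x), J x (J x a) = -a
  orthogonal : ∀ (x : M) (a b : TT E x), pairing (J x a) (J x b) = pairing a b
  smooth : ∀ A : (∀ x : M, TT E x), SmoothTT A → SmoothTT fun x => J x (A x)

namespace GenAlmostComplex

variable [IsManifold 𝓘(ℝ, E) ∞ M] (𝒥 : GenAlmostComplex E M)

/-- `A ∈ C^∞(L)`, where `L` is the `+i`-eigenbundle. -/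
def IsSectionL (A : ∀ x : M, Cx (TT E x)) : Prop :=
  SmoothTT (fun x => (A x).re) ∧ SmoothTT (fun x => (A x).im) ∧ ∀ x, A x ∈ eigenL (𝒥.J x)

/-- Integrability: the `+i`-eigenbundle `L` is Courant involutive. -/
def Integrable : Prop :=
  ∀ A B : ∀ x : M, Cx (TT E x), 𝒥.IsSectionL A → 𝒥.IsSectionL B →
    ∀ x, courantC A B x ∈ eigenL (𝒥.J x)

/-- The fibre at `x` of the bundle `U_k`. -/
def U (x : M) (k : ℤ) : Submodule ℂ (Spinor (T E x)) := gradedU (𝒥.J x) k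

/-- `ρ ∈ C^∞(U_k)`: a smooth form with values in `U_k`. -/
def IsSectionU (k : ℤ) (ρ : ∀ x : M, Spinor (T E x)) : Prop :=
  (∀ j : ℕ, SmoothForm (fun x => ρ x j)) ∧ ∀ x, ρ x ∈ 𝒥.U x k

/-- `∂̄ = π_{k+1} ∘ d` on `C^∞(U_k)`. -/
def delbar (k : ℤ) (ρ : ∀ x : M, Spinor (T E x)) (x : M) : Spinor (T E x) :=
  projU (𝒥.J x) (k + 1) (extDC ρ x)

/-- `∂ = π_{k-1} ∘ d` on `C^∞(U_k)`. -/
def del (k : ℤ) (ρ : ∀ x : M, Spinor (T E x)) (x : M) : Spinor (T E x) :=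
  projU (𝒥.J x) (k - 1) (extDC ρ x)

end GenAlmostComplex

end Manifold

end

end GenCx

/-!
Pointwise, the theorem is about the Clifford module of spinors. For a generalized vector `a` let
`lop a` and `lbar a` be the actions of `a - i J a ∈ L` and `a + i J a ∈ L̄`. As `L` and `L̄` are
isotropic, the operators of each kind anticommute, and `lop a` and `lbar b` anticommute up to a
scalar. For dual frames `b`, `b'` of `V ⊕ V*`, the number operator `N = (1/4) ∑ lbar bᵢ ∘ lop b'ᵢ`
therefore satisfies `[N, lbar a] = lbar a` and `[N, lop a] = -lop a`. It vanishes on `U₀`, hence it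
is multiplication by `k` on `U_k`. So the `U_k` are independent; an induction over a basis of `L`
shows that they span (`isInternal_gradedU`). Moreover `L̄` raises and `L` lowers the grading by one,
and each projection `π_k` is a polynomial in `N` (`aeval_numOp_projPoly`). Since there are dual
frames of smooth sections near every point (`exists_smooth_dualFrame`), the projections preserve
smoothness (`smooth_projU`), so `∂` and `∂̄` map sections to sections.

The link with integrability is that the Courant bracket is a derived bracket
(`derived_bracket_courant`): in the graded commutator algebra of operators on forms,
`[[d, A], B] = [A, B] + d ⟨A, B⟩`. In a chart, this is a computation with `d = ∑ εⁱ ∧ ∂ᵢ` and the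
Clifford relation. For sections of an isotropic subbundle, such as `L` or `L̄`, the last term
vanishes (`derived_bracket_courantC`).

The equation `d = ∂ + ∂̄` on `C^∞(U_k)` says that `d` maps `C^∞(U_k)` to sections of
`U_{k-1} ⊕ U_{k+1}`, the subspace `adjU`. If `J` is integrable, this is proved by induction on `k`
(`Integrable.extDC_mem_adjU`).
* For `k < 0` there is nothing to prove.
* For `k = 0` and `k = 1`, the derived bracket of two sections of `L` and the induction hypothesis
  give `L · L · dρ ⊆ U_{k-3} ⊕ U_{k-1}`, so that `dρ` has components only in degree `0`, in degree
  `1` and in degree `k + 1`. The component of the wrong parity vanishes: by irreducibility of the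
  spinor representation the operator `(-1)^k` on `U_k` is, up to a locally constant sign, the parity
  of the degree of forms, which `d` reverses (`gradedParity_eq`, `parity_extDC`).
* For `k ≥ 2`, a section of `U_k` is locally a sum of sections of `L̄ · L̄ · U_{k-2}`
  (`sum_lbar_lbar_lop_lop`), to which the derived bracket of two sections of `L̄` applies.

Conversely, if `d = ∂ + ∂̄`, then the derived bracket shows that the Courant bracket of two sections
of `L` maps `U_k` into `U_{k-3} ⊕ U_{k-1}`. Its `L̄`-component maps `U_k` into `U_{k+1}`, hence
annihilates all spinors and vanishes (`integrable_of_extDC_mem_adjU`).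
-/

namespace GenCx

noncomputable section

/-! ### The Clifford relation for spinors -/

section CliffordRelation

variable {V : Type*} [AddCommGroup V] [Module ℝ V] [TopologicalSpace V]

theorem interior_interior {k : ℕ} (X : V) (φ : V [⋀^Fin (k + 2)]→L[ℝ] ℂ) :
    interior X (interior X φ) = 0 := by
  ext v
  exact φ.map_eq_zero_of_eq (i := 0) (j := 1) _ rfl (by simp)

theorem interior_wedgeOne_zero (X : V) (ξ : V →L[ℝ] ℝ) (φ : V [⋀^Fin 0]→L[ℝ] ℂ) :
    interior X (wedgeOne ξ φ) = ξ X • φ := by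
  ext v
  simp only [interior_apply, wedgeOne_apply, ContinuousAlternatingMap.smul_apply]
  rw [Fin.sum_univ_succ, Finset.univ_eq_empty, Finset.sum_empty, add_zero, Fin.val_zero, pow_zero,
    one_smul]
  rfl

theorem interior_wedgeOne {k : ℕ} (X : V) (ξ : V →L[ℝ] ℝ) (φ : V [⋀^Fin (k + 1)]→L[ℝ] ℂ) :
    interior X (wedgeOne ξ φ) = ξ X • φ - wedgeOne ξ (interior X φ) := by
  ext v
  simp only [interior_apply, wedgeOne_apply, ContinuousAlternatingMap.sub_apply,
    ContinuousAlternatingMap.smul_apply]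
  rw [Fin.sum_univ_succ, sub_eq_add_neg, ← Finset.sum_neg_distrib]
  congr 1
  · simp only [Fin.val_zero, pow_zero, one_smul, Matrix.cons_val_zero]
    rfl
  · refine Finset.sum_congr rfl fun i _ => ?_
    have hv : i.succ.removeNth (Matrix.vecCons X v : Fin (k + 2) → V) =
        Matrix.vecCons X (i.removeNth v) := by
      funext j
      refine Fin.cases ?_ (fun j => ?_) j
      · simp [Fin.removeNth]
      · simp [Fin.removeNth]
    rw [Fin.val_succ, pow_succ, mul_neg_one, neg_smul, hv]
    rfl

theorem wedgeOne_wedgeOne {k : ℕ} (ξ : V →L[ℝ] ℝ) (φ : V [⋀^Fin k]→L[ℝ] ℂ) :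
    wedgeOne ξ (wedgeOne ξ φ) = 0 := by
  ext v
  have h := AlternatingMap.alternatizeUncurryFin_alternatizeUncurryFinLM_comp_of_symmetric
    (f := (ξ : V →ₗ[ℝ] ℝ).smulRight ((ξ : V →ₗ[ℝ] ℝ).smulRight φ.toAlternatingMap))
    (fun x y => by
      simp only [LinearMap.smulRight_apply, LinearMap.smul_apply]
      rw [smul_comm])
  have h' := congrArg (fun f => f v) h
  rw [AlternatingMap.alternatizeUncurryFin_apply] at h'
  simp only [LinearMap.comp_apply, AlternatingMap.alternatizeUncurryFinLM_apply,
    LinearMap.smulRight_apply, LinearMap.map_smul, AlternatingMap.smul_apply] at h'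
  rw [wedgeOne_apply]
  exact h'

theorem interior_add {k : ℕ} (X : V) (φ ψ : V [⋀^Fin (k + 1)]→L[ℝ] ℂ) :
    interior X (φ + ψ) = interior X φ + interior X ψ := rfl

theorem wedgeOne_add {k : ℕ} (ξ : V →L[ℝ] ℝ) (φ ψ : V [⋀^Fin k]→L[ℝ] ℂ) :
    wedgeOne ξ (φ + ψ) = wedgeOne ξ φ + wedgeOne ξ ψ := by
  ext v
  simp [Finset.sum_add_distrib]

theorem pairing_comm (a b : Gen V) : pairing a b = pairing b a := by
  simp only [pairing]; ring

theorem pairing_add_left (a b c : Gen V) : pairing (a + b) c = pairing a c + pairing b c := by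
  simp [pairing]; ring

theorem pairing_smul_left (r : ℝ) (a b : Gen V) : pairing (r • a) b = r * pairing a b := by
  simp [pairing]; ring

theorem pairing_neg_left (a b : Gen V) : pairing (-a) b = -pairing a b := by
  simp [pairing]; ring

theorem pairing_add_right (a b c : Gen V) : pairing a (b + c) = pairing a b + pairing a c := by
  simp [pairing]; ring

theorem pairing_neg_right (a b : Gen V) : pairing a (-b) = -pairing a b := by
  simp [pairing]; ring

theorem clifford_clifford (a : Gen V) (φ : Spinor V) :
    clifford a (clifford a φ) = (pairing a a : ℂ) • φ := by
  have hp : pairing a a = a.2 a.1 := by simp only [pairing]; ring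
  rw [hp]
  funext k
  match k with
  | 0 =>
    simp only [clifford, interior_add, interior_interior, interior_wedgeOne_zero, zero_add]
    ext v; simp
  | 1 =>
    simp only [clifford, interior_add, interior_interior, interior_wedgeOne, zero_add]
    ext v; simp
  | k + 2 =>
    simp only [clifford, interior_add, interior_interior, interior_wedgeOne, wedgeOne_add,
      wedgeOne_wedgeOne, zero_add, add_zero]
    ext v; simp

theorem clifford_add_left (a b : Gen V) (φ : Spinor V) :
    clifford (a + b) φ = clifford a φ + clifford b φ := by
  have h : ∀ {k : ℕ} (χ : V [⋀^Fin (k + 1)]→L[ℝ] ℂ),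
      interior (a.1 + b.1) χ = interior a.1 χ + interior b.1 χ := fun χ => by
    ext v
    simpa using χ.toAlternatingMap.map_vecCons_add (m := v) a.1 b.1
  have h' : ∀ {k : ℕ} (χ : V [⋀^Fin k]→L[ℝ] ℂ),
      wedgeOne (a.2 + b.2) χ = wedgeOne a.2 χ + wedgeOne b.2 χ := fun χ => by
    ext v
    simp [add_mul, Finset.sum_add_distrib]
  funext k
  cases k
  · exact h _
  · simp only [clifford, Prod.fst_add, Prod.snd_add, h, h', Pi.add_apply]
    abel

theorem clifford_smul_left (r : ℝ) (a : Gen V) (φ : Spinor V) :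
    clifford (r • a) φ = (r : ℂ) • clifford a φ := by
  have h : ∀ {k : ℕ} (χ : V [⋀^Fin (k + 1)]→L[ℝ] ℂ),
      interior (r • a.1) χ = (r : ℂ) • interior a.1 χ := fun χ => by
    ext v
    simpa using χ.toAlternatingMap.map_vecCons_smul (m := v) r a.1
  have h' : ∀ {k : ℕ} (χ : V [⋀^Fin k]→L[ℝ] ℂ),
      wedgeOne (r • a.2) χ = (r : ℂ) • wedgeOne a.2 χ := fun χ => by
    ext v
    simp only [wedgeOne_apply, _root_.smul_apply, ContinuousAlternatingMap.smul_apply,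
      Finset.smul_sum]
    refine Finset.sum_congr rfl fun i _ => ?_
    simp; ring
  funext k
  cases k
  · exact h _
  · simp only [clifford, Prod.smul_fst, Prod.smul_snd, h, h', Pi.smul_apply, smul_add]

/-- The Clifford action of a generalized vector as a complex linear endomorphism of spinors. -/
def cl (a : Gen V) : Module.End ℂ (Spinor V) where
  toFun := clifford a
  map_add' := clifford_add a
  map_smul' := clifford_smul a

@[simp] theorem cl_apply (a : Gen V) (φ : Spinor V) : cl a φ = clifford a φ := rfl

theorem cl_add (a b : Gen V) : cl (a + b) = cl a + cl b :=
  LinearMap.ext fun φ => clifford_add_left a b φ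

theorem cl_smul (r : ℝ) (a : Gen V) : cl (r • a) = (r : ℂ) • cl a :=
  LinearMap.ext fun φ => clifford_smul_left r a φ

theorem cl_mul_self (a : Gen V) : cl a * cl a = (pairing a a : ℂ) • 1 :=
  LinearMap.ext fun φ => clifford_clifford a φ

end CliffordRelation

/-! ### Clifford modules and the number operator -/

section CliffordModule

variable {V : Type*} [AddCommGroup V] [Module ℝ V] [TopologicalSpace V]
  {S : Type*} [AddCommGroup S] [Module ℂ S]

/-- A real linear action of `V ⊕ V*` on a complex vector space `S` satisfying the Clifford
relation `a · a · φ = ⟨a, a⟩ φ`. -/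
structure IsCliffordAction (c : Gen V → Module.End ℂ S) : Prop where
  add : ∀ a b, c (a + b) = c a + c b
  smul : ∀ (r : ℝ) a, c (r • a) = (r : ℂ) • c a
  mul_self : ∀ a, c a * c a = (pairing a a : ℂ) • 1

theorem isCliffordAction_cl : IsCliffordAction (cl (V := V)) :=
  ⟨cl_add, cl_smul, cl_mul_self⟩

/-- An orthogonal complex structure on `V ⊕ V*`. -/
structure IsGC (J : Gen V → Gen V) : Prop where
  add : ∀ a b, J (a + b) = J a + J b
  smul : ∀ (r : ℝ) a, J (r • a) = r • J a
  sq : ∀ a, J (J a) = -a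
  orth : ∀ a b, pairing (J a) (J b) = pairing a b

theorem IsGC.map_neg {J : Gen V → Gen V} (hJ : IsGC J) (a : Gen V) : J (-a) = -J a := by
  rw [← neg_one_smul ℝ a, hJ.smul, neg_one_smul ℝ (J a)]

theorem IsGC.neg {J : Gen V → Gen V} (hJ : IsGC J) : IsGC (fun a => -J a) where
  add a b := by rw [hJ.add]; exact neg_add _ _
  smul r a := by rw [hJ.smul, smul_neg]
  sq a := by rw [hJ.map_neg, neg_neg, hJ.sq]
  orth a b := by rw [pairing_neg_left, pairing_neg_right, hJ.orth, neg_neg]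

theorem IsGC.skew {J : Gen V → Gen V} (hJ : IsGC J) (a b : Gen V) :
    pairing (J a) b = -pairing a (J b) := by
  have h := hJ.orth a (J b)
  rw [hJ.sq, pairing_neg_right] at h
  rw [← h, neg_neg]

namespace IsCliffordAction

variable {c : Gen V → Module.End ℂ S}

theorem neg (hc : IsCliffordAction c) (a : Gen V) : c (-a) = -c a := by
  have h := hc.smul (-1) a
  rw [neg_one_smul ℝ a] at h
  simpa using h

theorem zero (hc : IsCliffordAction c) : c 0 = 0 := by
  have h := hc.smul 0 0
  simpa using h

theorem sum {ι : Type*} (hc : IsCliffordAction c) (s : Finset ι) (f : ι → Gen V) :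
    c (∑ i ∈ s, f i) = ∑ i ∈ s, c (f i) := by
  classical
  induction s using Finset.induction_on with
  | empty => simp [hc.zero]
  | insert i s hi ih => rw [Finset.sum_insert hi, Finset.sum_insert hi, hc.add, ih]

theorem anticomm (hc : IsCliffordAction c) (a b : Gen V) :
    c a * c b + c b * c a = (2 * pairing a b : ℂ) • 1 := by
  have h := hc.mul_self (a + b)
  rw [hc.add, add_mul, mul_add, mul_add, hc.mul_self, hc.mul_self, pairing_add_left,
    pairing_add_right, pairing_add_right, pairing_comm b a] at h
  push_cast at h
  linear_combination (norm := module) h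

end IsCliffordAction

/-- The operator `c(a) - i c(J a)`, the action of twice the `L`-component of `a`. -/
def lop (c : Gen V → Module.End ℂ S) (J : Gen V → Gen V) (a : Gen V) : Module.End ℂ S :=
  c a - Complex.I • c (J a)

/-- The operator `c(a) + i c(J a)`, the action of twice the `L̄`-component of `a`. -/
def lbar (c : Gen V → Module.End ℂ S) (J : Gen V → Gen V) (a : Gen V) : Module.End ℂ S :=
  c a + Complex.I • c (J a)

section

variable {c : Gen V → Module.End ℂ S} {J : Gen V → Gen V}

theorem lop_neg (hc : IsCliffordAction c) (a : Gen V) :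
    lop c (fun b => -J b) a = lbar c J a := by
  simp only [lop, lbar, hc.neg, smul_neg, sub_neg_eq_add]

theorem lop_add (hc : IsCliffordAction c) (hJ : IsGC J) (a b : Gen V) :
    lop c J (a + b) = lop c J a + lop c J b := by
  simp only [lop, hJ.add, hc.add]
  module

theorem lop_smul (hc : IsCliffordAction c) (hJ : IsGC J) (r : ℝ) (a : Gen V) :
    lop c J (r • a) = (r : ℂ) • lop c J a := by
  simp only [lop, hJ.smul, hc.smul]
  module

theorem lop_J (hc : IsCliffordAction c) (hJ : IsGC J) (a : Gen V) :
    lop c J (J a) = Complex.I • lop c J a := by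
  simp only [lop, hJ.sq, hc.neg, smul_sub, smul_smul, Complex.I_mul_I]
  module

theorem lbar_smul (hc : IsCliffordAction c) (hJ : IsGC J) (r : ℝ) (a : Gen V) :
    lbar c J (r • a) = (r : ℂ) • lbar c J a := by
  simp only [← lop_neg hc, lop_smul hc hJ.neg]

theorem lbar_J (hc : IsCliffordAction c) (hJ : IsGC J) (a : Gen V) :
    lbar c J (J a) = -Complex.I • lbar c J a := by
  simp only [lbar, hJ.sq, hc.neg, smul_add, smul_smul, neg_mul, Complex.I_mul_I]
  module

theorem lop_sum {ι : Type*} (hc : IsCliffordAction c) (hJ : IsGC J) (s : Finset ι)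
    (f : ι → Gen V) : lop c J (∑ i ∈ s, f i) = ∑ i ∈ s, lop c J (f i) := by
  classical
  induction s using Finset.induction_on with
  | empty => simpa using lop_smul hc hJ 0 0
  | insert i s hi ih => rw [Finset.sum_insert hi, Finset.sum_insert hi, lop_add hc hJ, ih]

theorem lbar_sum {ι : Type*} (hc : IsCliffordAction c) (hJ : IsGC J) (s : Finset ι)
    (f : ι → Gen V) : lbar c J (∑ i ∈ s, f i) = ∑ i ∈ s, lbar c J (f i) := by
  simp only [← lop_neg hc, lop_sum hc hJ.neg]

/-- `L` is isotropic, so its elements anticommute. -/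
theorem lop_mul_lop (hc : IsCliffordAction c) (hJ : IsGC J) (a b : Gen V) :
    lop c J a * lop c J b = -(lop c J b * lop c J a) := by
  have h1 := hc.anticomm a b
  have h2 := hc.anticomm a (J b)
  have h3 := hc.anticomm (J a) b
  have h4 := hc.anticomm (J a) (J b)
  rw [hJ.orth] at h4
  rw [hJ.skew] at h3
  push_cast at h3
  simp only [lop, sub_mul, mul_sub, smul_mul_assoc, mul_smul_comm, smul_smul, smul_sub,
    Complex.I_mul_I]
  linear_combination (norm := module) h1 - Complex.I • h2 - Complex.I • h3 - h4

theorem lop_mul_self (hc : IsCliffordAction c) (hJ : IsGC J) (a : Gen V) :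
    lop c J a * lop c J a = 0 := by
  have h : (2 : ℂ) • (lop c J a * lop c J a) = 0 := by
    rw [two_smul]
    nth_rewrite 1 [lop_mul_lop hc hJ a a]
    exact neg_add_cancel _
  exact (smul_eq_zero.1 h).resolve_left two_ne_zero

/-- The complex bilinear pairing `⟨a - i J a, b + i J b⟩`, up to a factor `2`. -/
def herm (J : Gen V → Gen V) (a b : Gen V) : ℂ := pairing a b + Complex.I * pairing a (J b)

theorem lop_mul_lbar (hc : IsCliffordAction c) (hJ : IsGC J) (a b : Gen V) :
    lop c J a * lbar c J b = (4 * herm J a b) • 1 - lbar c J b * lop c J a := by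
  have h1 := hc.anticomm a b
  have h2 := hc.anticomm a (J b)
  have h3 := hc.anticomm (J a) b
  have h4 := hc.anticomm (J a) (J b)
  rw [hJ.orth] at h4
  rw [hJ.skew] at h3
  push_cast at h3
  simp only [lop, lbar, herm, sub_mul, mul_sub, add_mul, mul_add, smul_mul_assoc, mul_smul_comm,
    smul_smul, smul_sub, smul_add, Complex.I_mul_I]
  linear_combination (norm := module) h1 + Complex.I • h2 - Complex.I • h3 + h4

theorem lbar_mul_lbar (hc : IsCliffordAction c) (hJ : IsGC J) (a b : Gen V) :
    lbar c J a * lbar c J b = -(lbar c J b * lbar c J a) := by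
  simp only [← lop_neg hc, lop_mul_lop hc hJ.neg a b]

/-- A pair of families `b`, `b'` of generalized vectors with `2 ∑ᵢ bᵢ ⊗ b'ᵢ` the inverse of the
pairing, for instance a frame together with its dual frame. -/
structure IsDualFrame {ι : Type*} [Fintype ι] (b b' : ι → Gen V) : Prop where
  expand : ∀ a, a = ∑ i, (2 * pairing (b' i) a) • b i
  expand' : ∀ a, a = ∑ i, (2 * pairing (b i) a) • b' i

/-- The number operator: it acts on `U_k` as multiplication by `k`. The factor `1 / 4` is due to
`lop` and `lbar` being twice the action of the components in `L` and `L̄`. -/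
def numOp {ι : Type*} [Fintype ι] (c : Gen V → Module.End ℂ S) (J : Gen V → Gen V)
    (b b' : ι → Gen V) : Module.End ℂ S :=
  (1 / 4 : ℂ) • ∑ i, lbar c J (b i) * lop c J (b' i)

/-- `[N, x] = x` for the number operator `N` and `x ∈ L̄`: multiplication by `L̄` raises the
eigenvalue by `1`. -/
theorem numOp_mul_lbar {ι : Type*} [Fintype ι] {b b' : ι → Gen V} (hc : IsCliffordAction c)
    (hJ : IsGC J) (hb : IsDualFrame b b') (a : Gen V) :
    numOp c J b b' * lbar c J a = lbar c J a * numOp c J b b' + lbar c J a := by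
  have h1 : ∑ i, (2 * pairing (b' i) a : ℂ) • lbar c J (b i) = lbar c J a := by
    conv_rhs => rw [hb.expand a, lbar_sum hc hJ]
    refine Finset.sum_congr rfl fun i _ => ?_
    rw [lbar_smul hc hJ]; push_cast; rfl
  have h2 : ∑ i, (2 * pairing (b' i) (J a) : ℂ) • lbar c J (b i) = -Complex.I • lbar c J a := by
    rw [← lbar_J hc hJ]
    conv_rhs => rw [hb.expand (J a), lbar_sum hc hJ]
    refine Finset.sum_congr rfl fun i _ => ?_
    rw [lbar_smul hc hJ]; push_cast; rfl
  have h3 : ∀ i, lbar c J (b i) * lop c J (b' i) * lbar c J a =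
      (2 : ℂ) • ((2 * pairing (b' i) a : ℂ) • lbar c J (b i)) +
      (2 * Complex.I) • ((2 * pairing (b' i) (J a) : ℂ) • lbar c J (b i)) +
      lbar c J a * (lbar c J (b i) * lop c J (b' i)) := fun i => by
    rw [mul_assoc, lop_mul_lbar hc hJ, mul_sub, ← mul_assoc, lbar_mul_lbar hc hJ (b i) a,
      mul_smul_comm, mul_one, neg_mul, mul_assoc, herm]
    module
  rw [numOp, smul_mul_assoc, Finset.sum_mul, Finset.sum_congr rfl fun i _ => h3 i,
    Finset.sum_add_distrib, Finset.sum_add_distrib, ← Finset.smul_sum, ← Finset.smul_sum, h1, h2,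
    mul_smul_comm, ← Finset.mul_sum, smul_smul, mul_neg, mul_assoc, Complex.I_mul_I]
  module

/-- `[N, x] = -x` for the number operator `N` and `x ∈ L`: multiplication by `L` lowers the
eigenvalue by `1`. -/
theorem numOp_mul_lop {ι : Type*} [Fintype ι] {b b' : ι → Gen V} (hc : IsCliffordAction c)
    (hJ : IsGC J) (hb : IsDualFrame b b') (a : Gen V) :
    numOp c J b b' * lop c J a = lop c J a * numOp c J b b' - lop c J a := by
  have h1 : ∑ i, (2 * pairing (b i) a : ℂ) • lop c J (b' i) = lop c J a := by
    conv_rhs => rw [hb.expand' a, lop_sum hc hJ]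
    refine Finset.sum_congr rfl fun i _ => ?_
    rw [lop_smul hc hJ]; push_cast; rfl
  have h2 : ∑ i, (2 * pairing (b i) (J a) : ℂ) • lop c J (b' i) = Complex.I • lop c J a := by
    rw [← lop_J hc hJ]
    conv_rhs => rw [hb.expand' (J a), lop_sum hc hJ]
    refine Finset.sum_congr rfl fun i _ => ?_
    rw [lop_smul hc hJ]; push_cast; rfl
  have h3 : ∀ i, lbar c J (b i) * lop c J (b' i) * lop c J a =
      lop c J a * (lbar c J (b i) * lop c J (b' i)) -
      (2 : ℂ) • ((2 * pairing (b i) a : ℂ) • lop c J (b' i)) +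
      (2 * Complex.I) • ((2 * pairing (b i) (J a) : ℂ) • lop c J (b' i)) := fun i => by
    have h4 : lbar c J (b i) * lop c J a =
        (4 * herm J a (b i)) • 1 - lop c J a * lbar c J (b i) := by
      rw [lop_mul_lbar hc hJ]; abel
    have h5 : pairing a (J (b i)) = -pairing (b i) (J a) := by
      rw [pairing_comm, hJ.skew]
    rw [mul_assoc, lop_mul_lop hc hJ (b' i) a, mul_neg, ← mul_assoc, h4, sub_mul, smul_mul_assoc,
      one_mul, mul_assoc, herm, pairing_comm a (b i), h5]
    push_cast
    module
  rw [numOp, smul_mul_assoc, Finset.sum_mul, Finset.sum_congr rfl fun i _ => h3 i,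
    Finset.sum_add_distrib, Finset.sum_sub_distrib, ← Finset.smul_sum, ← Finset.smul_sum, h1, h2,
    mul_smul_comm, ← Finset.mul_sum, smul_smul, mul_assoc, Complex.I_mul_I]
  module

end

end CliffordModule

/-! ### Complex bases of the eigenspaces -/

section ComplexBasis

/-- A real vector space with a complex structure has complex coordinates `xᵢ + i yᵢ`. -/
theorem exists_complex_coordinates {G : Type*} [AddCommGroup G] [Module ℝ G]
    [FiniteDimensional ℝ G] (J : G →ₗ[ℝ] G) (hJ : ∀ a, J (J a) = -a) :
    ∃ (n : ℕ) (e : Fin n → G) (x y : Fin n → G →ₗ[ℝ] ℝ), 2 * n = finrank ℝ G ∧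
      (∀ a, a = ∑ i, (x i a • e i + y i a • J (e i))) ∧
      (∀ i j, x i (e j) = if i = j then 1 else 0) ∧ (∀ i j, y i (e j) = 0) ∧
      ∀ i a, x i (J a) = -y i a := by
  -- `J` turns `G` into a complex vector space, of which a basis is taken.
  have hJ' : J * J = -1 := LinearMap.ext hJ
  let F : ℂ →ₐ[ℝ] Module.End ℝ G := Complex.lift ⟨J, hJ'⟩
  let _ : Module ℂ G := Module.compHom G F.toRingHom
  have hsm : ∀ (z : ℂ) (a : G), z • a = z.re • a + z.im • J a := fun z a => by
    change F z a = _
    simp [F, Complex.lift_apply, Complex.liftAux_apply]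
  have : IsScalarTower ℝ ℂ G := ⟨fun r z a => by
    rw [hsm, hsm]
    simp [mul_smul]⟩
  have : FiniteDimensional ℂ G := FiniteDimensional.right ℝ ℂ G
  let b := Module.finBasis ℂ G
  let z : Fin (finrank ℂ G) → G →ₗ[ℝ] ℂ := fun i => (b.coord i).restrictScalars ℝ
  have hz : ∀ i a, z i a = b.repr a i := fun i a => rfl
  refine ⟨finrank ℂ G, b, fun i => Complex.reLm.comp (z i), fun i => Complex.imLm.comp (z i),
    ?_, ?_, ?_, ?_, ?_⟩
  · rw [← Complex.finrank_real_complex, Module.finrank_mul_finrank]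
  · intro a
    conv_lhs => rw [← b.sum_repr a]
    exact Finset.sum_congr rfl fun i _ => hsm _ _
  · intro i j
    simp only [LinearMap.comp_apply, hz, b.repr_self, Finsupp.single_apply, eq_comm]
    split_ifs <;> simp
  · intro i j
    simp only [LinearMap.comp_apply, hz, b.repr_self, Finsupp.single_apply]
    split_ifs <;> simp
  · intro i a
    have h : J a = Complex.I • a := by rw [hsm]; simp
    simp only [LinearMap.comp_apply, hz, h, map_smul, Finsupp.smul_apply]
    simp

end ComplexBasis

section DualFrame

variable {V : Type*} [AddCommGroup V] [Module ℝ V] [TopologicalSpace V]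

/-- A basis of `V` and the dual basis of `V*` make up a basis of `V ⊕ V*`, and exchanging their
roles gives the dual basis. -/
theorem isDualFrame_sum {ι : Type*} [Fintype ι] (e : ι → V) (ε : ι → V →L[ℝ] ℝ)
    (h : ∀ v, v = ∑ i, ε i v • e i) :
    IsDualFrame (Sum.elim (fun i => ((e i, 0) : Gen V)) (fun i => (0, ε i)))
      (Sum.elim (fun i => (0, ε i)) (fun i => (e i, 0))) := by
  have h' : ∀ ξ : V →L[ℝ] ℝ, ξ = ∑ i, ξ (e i) • ε i := fun ξ => by
    ext v
    conv_lhs => rw [h v]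
    simp [mul_comm]
  constructor
  · intro a
    rw [Fintype.sum_sum_type]
    refine Prod.ext ?_ ?_
    · simp only [Sum.elim_inl, Sum.elim_inr, pairing, Prod.fst_add, Prod.fst_sum, Prod.smul_fst,
        smul_zero, Finset.sum_const_zero, add_zero, map_zero]
      conv_lhs => rw [h a.1]
      exact Finset.sum_congr rfl fun i _ => by congr 1; ring
    · simp only [Sum.elim_inl, Sum.elim_inr, pairing, Prod.snd_add, Prod.snd_sum, Prod.smul_snd,
        smul_zero, Finset.sum_const_zero, zero_add, _root_.zero_apply]
      conv_lhs => rw [h' a.2]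
      exact Finset.sum_congr rfl fun i _ => by congr 1; ring
  · intro a
    rw [Fintype.sum_sum_type]
    refine Prod.ext ?_ ?_
    · simp only [Sum.elim_inl, Sum.elim_inr, pairing, Prod.fst_add, Prod.fst_sum, Prod.smul_fst,
        smul_zero, Finset.sum_const_zero, zero_add, map_zero]
      conv_lhs => rw [h a.1]
      exact Finset.sum_congr rfl fun i _ => by congr 1; ring
    · simp only [Sum.elim_inl, Sum.elim_inr, pairing, Prod.snd_add, Prod.snd_sum, Prod.smul_snd,
        smul_zero, Finset.sum_const_zero, add_zero, _root_.zero_apply]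
      conv_lhs => rw [h' a.2]
      exact Finset.sum_congr rfl fun i _ => by congr 1; ring

variable [IsTopologicalAddGroup V] [ContinuousSMul ℝ V] [T2Space V] [FiniteDimensional ℝ V]

variable (V) in
theorem exists_basis_continuous_dual : ∃ (e : Fin (finrank ℝ V) → V)
    (ε : Fin (finrank ℝ V) → V →L[ℝ] ℝ), (∀ v, v = ∑ i, ε i v • e i) ∧
      ∀ i j, ε i (e j) = if i = j then 1 else 0 := by
  let b := Module.finBasis ℝ V
  refine ⟨b, fun i => LinearMap.toContinuousLinearMap (b.coord i), fun v => ?_, fun i j => ?_⟩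
  · exact (b.sum_repr v).symm
  · simp [Finsupp.single_apply, eq_comm]

variable (V) in
theorem exists_isDualFrame : ∃ b b' : Fin (finrank ℝ V) ⊕ Fin (finrank ℝ V) → Gen V,
    IsDualFrame b b' := by
  obtain ⟨e, ε, h, -⟩ := exists_basis_continuous_dual V
  exact ⟨_, _, isDualFrame_sum e ε h⟩

variable (V) in
theorem finrank_gen : finrank ℝ (Gen V) = 2 * finrank ℝ V := by
  have h : finrank ℝ (V →L[ℝ] ℝ) = finrank ℝ V := by
    rw [← (LinearMap.toContinuousLinearMap (𝕜 := ℝ) (E := V) (F' := ℝ)).finrank_eq]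
    exact Subspace.dual_finrank_eq
  have : FiniteDimensional ℝ (V →L[ℝ] ℝ) :=
    (LinearMap.toContinuousLinearMap (𝕜 := ℝ) (E := V) (F' := ℝ)).finiteDimensional
  rw [Module.finrank_prod, h]; ring

/-- The `+i`-eigenspace `L` has a complex basis of `dim V` vectors, and `L̄` contains the
dual basis. -/
theorem exists_lagrangian_dual_bases {J : Gen V → Gen V} (hJ : IsGC J) :
    ∃ (e f : Fin (finrank ℝ V) → Gen V) (x y : Fin (finrank ℝ V) → Gen V → ℝ),
      (∀ a, a = ∑ i, (x i a • e i + y i a • J (e i))) ∧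
      ∀ i j, herm J (e i) (f j) = if i = j then 1 else 0 := by
  have : FiniteDimensional ℝ (V →L[ℝ] ℝ) :=
    (LinearMap.toContinuousLinearMap (𝕜 := ℝ) (E := V) (F' := ℝ)).finiteDimensional
  obtain ⟨n, e, x, y, hn, h1, h2, h3, h4⟩ := exists_complex_coordinates
    (G := Gen V) ⟨⟨J, hJ.add⟩, hJ.smul⟩ hJ.sq
  rw [finrank_gen V] at hn
  obtain rfl : n = finrank ℝ V := by omega
  obtain ⟨b, b', hb⟩ := exists_isDualFrame V
  -- The vector `g i` represents the real part of the `i`-th complex coordinate.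
  have hf : ∀ i, ∃ g : Gen V, ∀ a, pairing a g = x i a := fun i => by
    refine ⟨∑ k, (2 * x i (b k)) • b' k, fun a => ?_⟩
    have hs : pairing a (∑ k, (2 * x i (b k)) • b' k) =
        ∑ k, (2 * x i (b k)) * pairing a (b' k) := by
      rw [pairing_comm]
      let P : Gen V →+ ℝ := ⟨⟨fun g => pairing g a, by simp [pairing]⟩,
        fun g g' => pairing_add_left g g' a⟩
      change P _ = _
      rw [map_sum]
      refine Finset.sum_congr rfl fun k _ => ?_
      change pairing _ a = _
      rw [pairing_smul_left, pairing_comm]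
    rw [hs]
    conv_rhs => rw [hb.expand a, map_sum]
    refine Finset.sum_congr rfl fun k _ => ?_
    rw [map_smul, smul_eq_mul, pairing_comm a]
    ring
  choose f hf using hf
  refine ⟨e, f, fun i => x i, fun i => y i, h1, fun i j => ?_⟩
  have h5 : pairing (e i) (J (f j)) = 0 := by
    have h6 : x j (J (e i)) = 0 := (h4 j (e i)).trans (by rw [h3, neg_zero])
    rw [pairing_comm, hJ.skew, pairing_comm, hf, h6, neg_zero]
  rw [herm, hf, h5, h2]
  simp only [eq_comm]
  split_ifs <;> simp

end DualFrame

/-! ### The grading of spinors by the subspaces `U_k` -/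

section Grading

variable {V : Type*} [AddCommGroup V] [Module ℝ V] [TopologicalSpace V] {J : Gen V →L[ℝ] Gen V}

theorem isGC_of_continuousLinearMap (h1 : ∀ a, J (J a) = -a)
    (h2 : ∀ a b, pairing (J a) (J b) = pairing a b) : IsGC J :=
  ⟨map_add J, map_smul J, h1, h2⟩

theorem mem_eigenL_iff (hJ : IsGC J) (a : Cx (Gen V)) : a ∈ eigenL J ↔ a.im = -J a.re := by
  constructor
  · intro h
    have h1 : J a.re = -a.im := congrArg Cx.re h
    rw [h1, neg_neg]
  · intro h
    refine Cx.ext ?_ ?_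
    · change J a.re = -a.im
      rw [h, neg_neg]
    · change J a.im = a.re
      rw [h, hJ.map_neg, hJ.sq, neg_neg]

theorem mem_eigenLbar_iff (hJ : IsGC J) (a : Cx (Gen V)) : a ∈ eigenLbar J ↔ a.im = J a.re := by
  change a.conj ∈ eigenL J ↔ _
  rw [mem_eigenL_iff hJ]
  exact neg_inj

theorem cliffordC_of_mem_eigenL (hJ : IsGC J) {a : Cx (Gen V)} (ha : a ∈ eigenL J)
    (φ : Spinor V) : cliffordC a φ = lop cl J a.re φ := by
  rw [mem_eigenL_iff hJ] at ha
  rw [cliffordC, ha, ← cl_apply (-J a.re), isCliffordAction_cl.neg, lop, LinearMap.sub_apply,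
    LinearMap.smul_apply, LinearMap.neg_apply, smul_neg, ← sub_eq_add_neg]
  rfl

theorem cliffordC_of_mem_eigenLbar (hJ : IsGC J) {a : Cx (Gen V)} (ha : a ∈ eigenLbar J)
    (φ : Spinor V) : cliffordC a φ = lbar cl J a.re φ := by
  rw [mem_eigenLbar_iff hJ] at ha
  rw [cliffordC, ha, lbar]
  rfl

theorem mem_canonicalLine_iff (hJ : IsGC J) (φ : Spinor V) :
    φ ∈ canonicalLine J ↔ ∀ a, lop cl J a φ = 0 := by
  constructor
  · intro h a
    have ha : (⟨a, -J a⟩ : Cx (Gen V)) ∈ eigenL J := (mem_eigenL_iff hJ _).2 rfl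
    rw [← h _ ha, cliffordC_of_mem_eigenL hJ ha]
  · intro h a ha
    rw [cliffordC_of_mem_eigenL hJ ha, h]

theorem lbar_mem_wedgeLbar (hJ : IsGC J) {k : ℕ} (a : Gen V) {φ : Spinor V}
    (hφ : φ ∈ wedgeLbar J k) : lbar cl J a φ ∈ wedgeLbar J (k + 1) := by
  have ha : (⟨a, J a⟩ : Cx (Gen V)) ∈ eigenLbar J := (mem_eigenLbar_iff hJ _).2 rfl
  exact Submodule.subset_span ⟨_, ha, φ, hφ, (cliffordC_of_mem_eigenLbar hJ ha φ).symm⟩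

/-- A subspace contains `∧^{k+1} L̄ · U₀` if it contains all products of `a + i J a`, for `a` real,
with elements of `∧^k L̄ · U₀`. -/
theorem wedgeLbar_succ_le (hJ : IsGC J) {k : ℕ} {W : Submodule ℂ (Spinor V)}
    (h : ∀ a, ∀ φ ∈ wedgeLbar J k, lbar cl J a φ ∈ W) : wedgeLbar J (k + 1) ≤ W := by
  refine Submodule.span_le.2 ?_
  rintro _ ⟨a, ha, φ, hφ, rfl⟩
  rw [cliffordC_of_mem_eigenLbar hJ ha]
  exact h _ _ hφ

variable {ι : Type*} [Fintype ι] {b b' : ι → Gen V}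

theorem numOp_apply_of_mem_wedgeLbar (hJ : IsGC J) (hb : IsDualFrame b b') (k : ℕ) :
    wedgeLbar J k ≤ (numOp cl J b b').eigenspace (k : ℂ) := by
  induction k with
  | zero =>
    intro φ hφ
    rw [Module.End.mem_eigenspace_iff, Nat.cast_zero, zero_smul ℂ φ, numOp, LinearMap.smul_apply,
      LinearMap.sum_apply, Finset.sum_eq_zero, smul_zero]
    intro i _
    rw [Module.End.mul_apply, (mem_canonicalLine_iff hJ φ).1 hφ, map_zero]
  | succ k ih =>
    refine wedgeLbar_succ_le hJ fun a φ hφ => ?_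
    have h := LinearMap.congr_fun (numOp_mul_lbar isCliffordAction_cl hJ hb a) φ
    rw [Module.End.mul_apply, LinearMap.add_apply, Module.End.mul_apply,
      Module.End.mem_eigenspace_iff.1 (ih hφ), map_smul] at h
    rw [Module.End.mem_eigenspace_iff, h]
    push_cast
    rw [add_smul, one_smul]

theorem gradedU_le_eigenspace (hJ : IsGC J) (hb : IsDualFrame b b') (k : ℤ) :
    gradedU J k ≤ (numOp cl J b b').eigenspace (k : ℂ) := by
  rw [gradedU]
  split_ifs with h
  · have h' := numOp_apply_of_mem_wedgeLbar hJ hb k.toNat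
    have hk : ((k.toNat : ℕ) : ℂ) = (k : ℂ) := by
      rw [← Int.cast_natCast, Int.toNat_of_nonneg h.1]
    rwa [hk] at h'
  · exact bot_le

theorem numOp_apply_of_mem_gradedU (hJ : IsGC J) (hb : IsDualFrame b b') {k : ℤ} {φ : Spinor V}
    (hφ : φ ∈ gradedU J k) : numOp cl J b b' φ = (k : ℂ) • φ :=
  Module.End.mem_eigenspace_iff.1 (gradedU_le_eigenspace hJ hb k hφ)

theorem wedgeLbar_le_gradedU {k : ℕ} (hk : k ≤ finrank ℝ V) :
    wedgeLbar J k ≤ gradedU J (k : ℤ) := by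
  rw [gradedU, if_pos ⟨by omega, by exact_mod_cast hk⟩, Int.toNat_natCast]

/-- Spinors killed by all but `N` vectors of a basis of `L` lie in `∑_{k ≤ N} ∧^k L̄ · U₀`, because
`φ = f · (e · φ) + e · (f · φ)` for `e ∈ L`, `f ∈ L̄` with `2 ⟨e, f⟩ = 1`, where `e · φ` and
`e · (f · φ)` are killed by `e` as well. -/
theorem mem_iSup_wedgeLbar (hJ : IsGC J) {n : ℕ} {e f : Fin n → Gen V} {x y : Fin n → Gen V → ℝ}
    (h1 : ∀ a, a = ∑ i, (x i a • e i + y i a • J (e i)))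
    (h2 : ∀ i j, herm J (e i) (f j) = if i = j then 1 else 0) (s : Finset (Fin n)) :
    ∀ φ : Spinor V, (∀ i ∉ s, lop cl J (e i) φ = 0) →
      φ ∈ ⨆ k : Fin (s.card + 1), wedgeLbar J k := by
  have hc := isCliffordAction_cl (V := V)
  induction s using Finset.induction_on with
  | empty =>
    intro φ hφ
    refine Submodule.mem_iSup_of_mem 0 ((mem_canonicalLine_iff hJ φ).2 fun a => ?_)
    rw [h1 a, lop_sum hc hJ, LinearMap.sum_apply]
    refine Finset.sum_eq_zero fun i _ => ?_
    rw [lop_add hc hJ, lop_smul hc hJ, lop_smul hc hJ, lop_J hc hJ, LinearMap.add_apply,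
      LinearMap.smul_apply, LinearMap.smul_apply, LinearMap.smul_apply,
      hφ i (Finset.notMem_empty i)]
    simp only [smul_zero, add_zero]
  | insert i s hi ih =>
    intro φ hφ
    rw [Finset.card_insert_of_notMem hi]
    have hll : ∀ a d (ψ : Spinor V), lop cl J a (lop cl J d ψ) = -lop cl J d (lop cl J a ψ) :=
      fun a d ψ => LinearMap.congr_fun (lop_mul_lop hc hJ a d) ψ
    have hlb : ∀ a d (ψ : Spinor V), lop cl J a (lbar cl J d ψ) =
        (4 * herm J a d) • ψ - lbar cl J d (lop cl J a ψ) :=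
      fun a d ψ => LinearMap.congr_fun (lop_mul_lbar hc hJ a d) ψ
    have hself : ∀ a (ψ : Spinor V), lop cl J a (lop cl J a ψ) = 0 :=
      fun a ψ => LinearMap.congr_fun (lop_mul_self hc hJ a) ψ
    have hA : lop cl J (e i) φ ∈ ⨆ k : Fin (s.card + 1), wedgeLbar J k := by
      refine ih _ fun j hj => ?_
      by_cases hji : j = i
      · rw [hji, hself]
      · rw [hll, hφ j (by simp [hji, hj]), map_zero, neg_zero]
    have hB : lop cl J (e i) (lbar cl J (f i) φ) ∈ ⨆ k : Fin (s.card + 1), wedgeLbar J k := by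
      refine ih _ fun j hj => ?_
      by_cases hji : j = i
      · rw [hji, hself]
      · rw [hll, hlb, h2, if_neg hji, hφ j (by simp [hji, hj]), map_zero, mul_zero,
          zero_smul ℂ φ, sub_zero, map_zero, neg_zero]
    have hle : (⨆ k : Fin (s.card + 1), wedgeLbar J k) ≤
        ⨆ k : Fin (s.card + 1 + 1), wedgeLbar J k :=
      iSup_le fun k => le_iSup (fun k : Fin (s.card + 1 + 1) => wedgeLbar J k) k.castSucc
    have hle' : (⨆ k : Fin (s.card + 1), wedgeLbar J k) ≤
        (⨆ k : Fin (s.card + 1 + 1), wedgeLbar J k).comap (lbar cl J (f i)) :=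
      iSup_le fun k ψ hψ => Submodule.mem_iSup_of_mem k.succ (lbar_mem_wedgeLbar hJ _ hψ)
    have hφ4 : φ = (1 / 4 : ℂ) • (lop cl J (e i) (lbar cl J (f i) φ) +
        lbar cl J (f i) (lop cl J (e i) φ)) := by
      rw [hlb, h2, if_pos rfl, sub_add_cancel, smul_smul]
      norm_num
    rw [hφ4]
    exact Submodule.smul_mem _ _ (Submodule.add_mem _ (hle hB) (hle' hA))

variable [IsTopologicalAddGroup V] [ContinuousSMul ℝ V] [T2Space V] [FiniteDimensional ℝ V]

/-- The decomposition of spinors into the subspaces `U_k`. They lie in eigenspaces of the number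
operator to different eigenvalues, hence are independent, and they span because a finite basis of
`L` consists of `dim V` vectors. -/
theorem isInternal_gradedU (hJ : IsGC J) : DirectSum.IsInternal (gradedU J) := by
  obtain ⟨b, b', hb⟩ := exists_isDualFrame V
  rw [DirectSum.isInternal_submodule_iff_iSupIndep_and_iSup_eq_top]
  constructor
  · refine ((numOp cl J b b').eigenspaces_iSupIndep.comp
      (f := fun k : ℤ => (k : ℂ)) Int.cast_injective).mono fun k => ?_
    exact gradedU_le_eigenspace hJ hb k
  · rw [eq_top_iff]
    intro φ _
    obtain ⟨e, f, x, y, h1, h2⟩ := exists_lagrangian_dual_bases hJ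
    have h := mem_iSup_wedgeLbar hJ h1 h2 Finset.univ φ fun i hi => absurd (Finset.mem_univ i) hi
    refine (iSup_le fun k => ?_ : _ ≤ ⨆ k, gradedU J k) h
    refine (wedgeLbar_le_gradedU ?_).trans (le_iSup (gradedU J) _)
    exact (Nat.lt_succ_iff.1 k.2).trans (by rw [Finset.card_univ, Fintype.card_fin])

end Grading

/-! ### The projections onto the summands `U_k` -/

theorem eq_zero_of_smul_eq_smul {S : Type*} [AddCommGroup S] [Module ℂ S] {z w : ℂ} (h : z ≠ w)
    {x : S} (hx : z • x = w • x) : x = 0 := by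
  rw [← sub_eq_zero, ← sub_smul] at hx
  exact (smul_eq_zero.1 hx).resolve_left (sub_ne_zero.2 h)

theorem interior_zero_left {V : Type*} [AddCommGroup V] [Module ℝ V] [TopologicalSpace V] {k : ℕ}
    (φ : V [⋀^Fin (k + 1)]→L[ℝ] ℂ) : interior 0 φ = 0 := by
  ext v
  exact φ.toAlternatingMap.map_coord_zero 0 rfl

theorem add_one_smul {S : Type*} [AddCommGroup S] [Module ℂ S] (z : ℂ) (x : S) :
    (z + 1) • x = z • x + x := by
  rw [add_smul, one_smul]

theorem sub_one_smul {S : Type*} [AddCommGroup S] [Module ℂ S] (z : ℂ) (x : S) :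
    (z - 1) • x = z • x - x := by
  rw [sub_smul, one_smul]

section Projection

variable {V : Type*} [AddCommGroup V] [Module ℝ V] [TopologicalSpace V] {J : Gen V →L[ℝ] Gen V}

theorem projU_mem (J : Gen V →L[ℝ] Gen V) (k : ℤ) (φ : Spinor V) :
    projU J k φ ∈ gradedU J k := by
  rw [projU]
  split_ifs
  · exact Subtype.prop _
  · exact Submodule.zero_mem _

theorem projU_add (J : Gen V →L[ℝ] Gen V) (k : ℤ) (φ ψ : Spinor V) :
    projU J k (φ + ψ) = projU J k φ + projU J k ψ := by
  simp only [projU]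
  split_ifs
  · rw [map_add]; rfl
  · exact (add_zero (0 : Spinor V)).symm

theorem projU_smul (J : Gen V →L[ℝ] Gen V) (k : ℤ) (z : ℂ) (φ : Spinor V) :
    projU J k (z • φ) = z • projU J k φ := by
  simp only [projU]
  split_ifs
  · rw [map_smul]; rfl
  · exact (smul_zero (A := Spinor V) z).symm

/-- The projection `π_k` as a linear map. -/
def projL (J : Gen V →L[ℝ] Gen V) (k : ℤ) : Module.End ℂ (Spinor V) where
  toFun := projU J k
  map_add' := projU_add J k
  map_smul' := projU_smul J k

@[simp] theorem projL_apply (k : ℤ) (φ : Spinor V) : projL J k φ = projU J k φ := rfl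

/-- `U_k` vanishes outside the range `0 ≤ k ≤ dim V`. -/
theorem gradedU_eq_bot {k : ℤ} (hk : k ∉ Finset.Icc 0 (finrank ℝ V : ℤ)) : gradedU J k = ⊥ := by
  rw [Finset.mem_Icc] at hk
  rw [gradedU, if_neg hk]

variable [IsTopologicalAddGroup V] [ContinuousSMul ℝ V] [T2Space V] [FiniteDimensional ℝ V]

/-- The projection `π_k` is the identity on `U_k` and zero on the other summands. -/
theorem projU_of_mem (hJ : IsGC J) {j : ℤ} {φ : Spinor V} (hφ : φ ∈ gradedU J j) (k : ℤ) :
    projU J k φ = if k = j then φ else 0 := by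
  have h := isInternal_gradedU hJ
  rw [projU, dif_pos h]
  have h1 : (LinearEquiv.ofBijective (DirectSum.coeLinearMap (gradedU J)) h).symm φ =
      DirectSum.lof ℂ ℤ (fun i => gradedU J i) j ⟨φ, hφ⟩ := by
    rw [LinearEquiv.symm_apply_eq]
    exact (DirectSum.coeLinearMap_lof (gradedU J) j ⟨φ, hφ⟩).symm
  rw [h1]
  split_ifs with hk
  · subst hk
    rw [DirectSum.lof_apply]
  · rw [DirectSum.lof_eq_of, DirectSum.of_eq_of_ne _ _ _ hk]
    rfl

/-- A property of spinors that is additive holds if it holds on every `U_k`. -/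
@[elab_as_elim]
theorem spinor_induction (hJ : IsGC J) {P : Spinor V → Prop}
    (hU : ∀ k, ∀ φ ∈ gradedU J k, P φ) (hadd : ∀ φ ψ, P φ → P ψ → P (φ + ψ)) (φ : Spinor V) :
    P φ := by
  have h := (isInternal_gradedU hJ).submodule_iSup_eq_top
  have hφ : φ ∈ ⨆ k, gradedU J k := by rw [h]; trivial
  exact Submodule.iSup_induction _ (motive := P) hφ hU (hU 0 0 (Submodule.zero_mem _)) hadd

theorem sum_projU (hJ : IsGC J) (φ : Spinor V) :
    ∑ k ∈ Finset.Icc 0 (finrank ℝ V : ℤ), projU J k φ = φ := by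
  refine spinor_induction hJ (fun j φ hφ => ?_) (fun φ ψ h1 h2 => ?_) φ
  · rw [Finset.sum_congr rfl fun k _ => projU_of_mem hJ hφ k, Finset.sum_ite_eq']
    split_ifs with hj
    · rfl
    · rw [gradedU_eq_bot hj, Submodule.mem_bot] at hφ
      exact hφ.symm
  · rw [Finset.sum_congr rfl fun k _ => projU_add J k φ ψ, Finset.sum_add_distrib, h1, h2]

/-- A submodule contains a spinor as soon as it contains all the components of it. -/
theorem mem_of_projU_mem (hJ : IsGC J) {W : Submodule ℂ (Spinor V)} {φ : Spinor V}
    (h : ∀ k, projU J k φ ∈ W) : φ ∈ W := by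
  rw [← sum_projU hJ φ]
  exact Submodule.sum_mem _ fun k _ => h k

variable {ι : Type*} [Fintype ι] {b b' : ι → Gen V}

theorem projU_numOp (hJ : IsGC J) (hb : IsDualFrame b b') (k : ℤ) (φ : Spinor V) :
    projU J k (numOp cl J b b' φ) = (k : ℂ) • projU J k φ := by
  refine spinor_induction hJ (fun j φ hφ => ?_) (fun φ ψ h1 h2 => ?_) φ
  · rw [numOp_apply_of_mem_gradedU hJ hb hφ, projU_smul, projU_of_mem hJ hφ]
    split_ifs with h
    · rw [h]
    · exact (smul_zero (A := Spinor V) (j : ℂ)).trans (smul_zero (A := Spinor V) (k : ℂ)).symm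
  · rw [map_add, projU_add, h1, h2, projU_add, smul_add]

theorem mem_gradedU_of_projU (hJ : IsGC J) {k : ℤ} {φ : Spinor V}
    (h : ∀ j, j ≠ k → projU J j φ = 0) : φ ∈ gradedU J k := by
  refine mem_of_projU_mem hJ fun j => ?_
  by_cases hj : j = k
  · rw [hj]; exact projU_mem J k φ
  · rw [h j hj]; exact Submodule.zero_mem _

/-- `U_k` is the full eigenspace of the number operator. -/
theorem mem_gradedU_iff (hJ : IsGC J) (hb : IsDualFrame b b') {k : ℤ} {φ : Spinor V} :
    φ ∈ gradedU J k ↔ numOp cl J b b' φ = (k : ℂ) • φ := by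
  refine ⟨numOp_apply_of_mem_gradedU hJ hb, fun h => mem_gradedU_of_projU hJ fun j hj => ?_⟩
  have h1 := projU_numOp hJ hb j φ
  rw [h, projU_smul] at h1
  exact eq_zero_of_smul_eq_smul (by exact_mod_cast hj.symm) h1

theorem lbar_mem_gradedU (hJ : IsGC J) (a : Gen V) {k : ℤ} {φ : Spinor V}
    (hφ : φ ∈ gradedU J k) : lbar cl J a φ ∈ gradedU J (k + 1) := by
  obtain ⟨b, b', hb⟩ := exists_isDualFrame V
  have h := LinearMap.congr_fun (numOp_mul_lbar isCliffordAction_cl hJ hb a) φ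
  rw [Module.End.mul_apply, LinearMap.add_apply, Module.End.mul_apply,
    (mem_gradedU_iff hJ hb).1 hφ, map_smul] at h
  rw [mem_gradedU_iff hJ hb, h]
  rw [Int.cast_add, Int.cast_one]
  exact (add_one_smul (k : ℂ) (lbar cl J a φ)).symm

theorem lop_mem_gradedU (hJ : IsGC J) (a : Gen V) {k : ℤ} {φ : Spinor V}
    (hφ : φ ∈ gradedU J k) : lop cl J a φ ∈ gradedU J (k - 1) := by
  obtain ⟨b, b', hb⟩ := exists_isDualFrame V
  have h := LinearMap.congr_fun (numOp_mul_lop isCliffordAction_cl hJ hb a) φ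
  rw [Module.End.mul_apply, LinearMap.sub_apply, Module.End.mul_apply,
    (mem_gradedU_iff hJ hb).1 hφ, map_smul] at h
  rw [mem_gradedU_iff hJ hb, h]
  rw [Int.cast_sub, Int.cast_one]
  exact (sub_one_smul (k : ℂ) (lop cl J a φ)).symm

theorem projU_lop (hJ : IsGC J) (a : Gen V) (k : ℤ) (φ : Spinor V) :
    projU J k (lop cl J a φ) = lop cl J a (projU J (k + 1) φ) := by
  refine spinor_induction hJ (fun j φ hφ => ?_) (fun φ ψ h1 h2 => ?_) φ
  · rw [projU_of_mem hJ (lop_mem_gradedU hJ a hφ), projU_of_mem hJ hφ]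
    by_cases h : k = j - 1
    · rw [if_pos h, if_pos (by omega)]
    · rw [if_neg h, if_neg (by omega), map_zero]
  · rw [map_add, projU_add, h1, h2, projU_add, map_add]

variable (V) in
/-- A polynomial with value `1` at `k` and `0` at the other integers between `0` and `dim V`. -/
def projPoly (k : ℤ) : Polynomial ℂ :=
  if k ∈ Finset.Icc 0 (finrank ℝ V : ℤ) then
    Lagrange.basis (Finset.Icc 0 (finrank ℝ V : ℤ)) (fun j : ℤ => (j : ℂ)) k else 0

/-- The projections are polynomials in the number operator. -/
theorem aeval_numOp_projPoly (hJ : IsGC J) (hb : IsDualFrame b b') (k : ℤ) (φ : Spinor V) :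
    Polynomial.aeval (numOp cl J b b') (projPoly V k) φ = projU J k φ := by
  refine spinor_induction hJ (fun j φ hφ => ?_) (fun φ ψ h1 h2 => ?_) φ
  · rw [projU_of_mem hJ hφ]
    by_cases hφ0 : φ = 0
    · rw [hφ0, map_zero, ite_self]
    have hj : j ∈ Finset.Icc 0 (finrank ℝ V : ℤ) := by
      by_contra hj
      rw [gradedU_eq_bot hj, Submodule.mem_bot] at hφ
      exact hφ0 hφ
    rw [Module.End.aeval_apply_of_hasEigenvector
      (⟨gradedU_le_eigenspace hJ hb j hφ, hφ0⟩ : (numOp cl J b b').HasEigenvector (j : ℂ) φ),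
      projPoly]
    have hinj : Set.InjOn (fun j : ℤ => (j : ℂ)) (Finset.Icc 0 (finrank ℝ V : ℤ)) :=
      Int.cast_injective.injOn
    split_ifs with h1 h2 h2
    · rw [h2, Lagrange.eval_basis_self hinj hj, one_smul]
    · rw [Lagrange.eval_basis_of_ne h2 hj, zero_smul ℂ φ]
    · exact absurd (h2 ▸ hj) h1
    · rw [Polynomial.eval_zero, zero_smul ℂ φ]
  · rw [map_add, h1, h2, projU_add]

/-- Two applications of `L` detect all of `U_j` with `j ≥ 2`. -/
theorem eq_zero_of_lop_lop (hJ : IsGC J) {j : ℤ} (h0 : j ≠ 0) (h1 : j ≠ 1) {φ : Spinor V}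
    (hφ : φ ∈ gradedU J j) (h : ∀ a d, lop cl J a (lop cl J d φ) = 0) : φ = 0 := by
  obtain ⟨b, b', hb⟩ := exists_isDualFrame V
  have key : ∀ (k : ℤ) (ψ : Spinor V), k ≠ 0 → ψ ∈ gradedU J k → (∀ a, lop cl J a ψ = 0) →
      ψ = 0 := fun k ψ hk hψ hl => by
    have h2 := (mem_gradedU_iff hJ hb).1 hψ
    rw [numOp, LinearMap.smul_apply, LinearMap.sum_apply, Finset.sum_eq_zero, smul_zero] at h2
    · exact (smul_eq_zero.1 h2.symm).resolve_left (by exact_mod_cast hk)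
    · intro i _
      rw [Module.End.mul_apply, hl, map_zero]
  refine key j φ h0 hφ fun d => ?_
  exact key (j - 1) _ (by omega) (lop_mem_gradedU hJ d hφ) fun a => h a d

end Projection

/-! ### Parity -/

section Parity

variable {V : Type*} [AddCommGroup V] [Module ℝ V] [TopologicalSpace V] {J : Gen V →L[ℝ] Gen V}

variable (V) in
/-- The constant function `1` as a spinor. -/
def oneSpinor : Spinor V
  | 0 => ContinuousAlternatingMap.constOfIsEmpty ℝ V (Fin 0) (1 : ℂ)
  | _ + 1 => 0

theorem oneSpinor_ne_zero : oneSpinor V ≠ 0 := fun h => by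
  have h1 := congrArg (fun φ : Spinor V => φ 0 ![]) h
  exact one_ne_zero (α := ℂ) h1

/-- A spinor killed by all interior products is a constant function. -/
theorem eq_smul_oneSpinor {φ : Spinor V} (h : ∀ X : V, clifford (X, 0) φ = 0) :
    φ = (φ 0 ![]) • oneSpinor V := by
  funext k
  ext v
  cases k with
  | zero =>
    have hv : v = ![] := Subsingleton.elim _ _
    rw [hv]
    simp [oneSpinor]
  | succ k =>
    have hw : ∀ ψ : V [⋀^Fin k]→L[ℝ] ℂ, wedgeOne (0 : V →L[ℝ] ℝ) ψ = 0 := fun ψ => by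
      ext w; simp
    have h1 : interior (v 0) (φ (k + 1)) = 0 := by
      have h2 := congrFun (h (v 0)) k
      cases k with
      | zero => exact h2
      | succ k =>
        have h3 : interior (v 0) (φ (k + 1 + 1)) + wedgeOne (0 : V →L[ℝ] ℝ) (φ k) = 0 := h2
        have h4 : wedgeOne (0 : V →L[ℝ] ℝ) (φ k) = 0 := by ext w; simp
        rwa [h4, add_zero] at h3
    have h2 := congrArg (fun ψ : V [⋀^Fin k]→L[ℝ] ℂ => ψ (Matrix.vecTail v)) h1
    have h3 : Matrix.vecCons (v 0) (Matrix.vecTail v) = v := Matrix.cons_head_tail v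
    rw [interior_apply, h3] at h2
    rw [h2]
    simp [oneSpinor]

/-- The parity operator `(-1)^{deg}`. -/
def parity : Module.End ℂ (Spinor V) where
  toFun φ k := (-1 : ℂ) ^ k • φ k
  map_add' _ _ := funext fun _ => smul_add _ _ _
  map_smul' z φ := funext fun k => smul_comm ((-1 : ℂ) ^ k) z (φ k)

theorem parity_apply (φ : Spinor V) (k : ℕ) : parity φ k = (-1 : ℂ) ^ k • φ k := rfl

theorem parity_clifford (a : Gen V) (φ : Spinor V) :
    parity (clifford a φ) = -clifford a (parity φ) := by
  funext k
  ext v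
  cases k with
  | zero => simp [parity_apply, clifford]
  | succ k =>
    simp only [parity_apply, clifford, Pi.neg_apply, ContinuousAlternatingMap.smul_apply,
      ContinuousAlternatingMap.neg_apply, ContinuousAlternatingMap.add_apply, interior_apply,
      wedgeOne_apply, smul_eq_mul, mul_add, Finset.mul_sum, neg_add, ← Finset.sum_neg_distrib]
    congr 1
    · ring
    · refine Finset.sum_congr rfl fun i _ => ?_
      simp only [zsmul_eq_mul, Complex.real_smul]
      ring

theorem clifford_vector_oneSpinor (X : V) : clifford (X, 0) (oneSpinor V) = 0 := by
  funext k
  match k with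
  | 0 => ext v; simp [clifford, oneSpinor]
  | 1 => ext v; simp [clifford, oneSpinor]
  | k + 2 => ext v; simp [clifford, oneSpinor]

theorem parity_oneSpinor : parity (oneSpinor V) = oneSpinor V := by
  funext k
  cases k with
  | zero => simp [parity_apply]
  | succ k => exact ContinuousAlternatingMap.ext fun v => mul_zero ((-1 : ℂ) ^ (k + 1))

variable [IsTopologicalAddGroup V] [ContinuousSMul ℝ V] [T2Space V] [FiniteDimensional ℝ V]

/-- The spinor representation is irreducible: it is generated by the constant function `1`,
by Euler's formula `∑ ε_i ∧ i_{e_i} φ = (deg φ) φ`. -/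
theorem eq_top_of_oneSpinor_mem {W : Submodule ℂ (Spinor V)} (h1 : oneSpinor V ∈ W)
    (hW : ∀ a, ∀ φ ∈ W, clifford a φ ∈ W) : W = ⊤ := by
  classical
  obtain ⟨e, ε, he, -⟩ := exists_basis_continuous_dual V
  -- Euler's formula writes a form of degree `k + 1` in terms of one-forms and forms of degree `k`.
  have hs : ∀ (k : ℕ) (χ : V [⋀^Fin k]→L[ℝ] ℂ), (Pi.single k χ : Spinor V) ∈ W := by
    intro k
    induction k with
    | zero =>
      intro χ
      have h2 : (Pi.single 0 χ : Spinor V) = (χ ![]) • oneSpinor V := by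
        funext k
        ext v
        cases k with
        | zero =>
          have hv : v = ![] := Subsingleton.elim _ _
          rw [hv]
          simp [oneSpinor]
        | succ k => simp [oneSpinor]
      rw [h2]
      exact W.smul_mem _ h1
    | succ k ih =>
      intro χ
      have h3 : ((k + 1 : ℕ) : ℂ) • (Pi.single (k + 1) χ : Spinor V) =
          ∑ i, clifford (0, ε i) (Pi.single k (interior (e i) χ)) := by
        funext l
        ext v
        rw [Finset.sum_apply, ContinuousAlternatingMap.sum_apply]
        by_cases hl : l = k + 1
        · subst hl
          have h4 : ∀ i, clifford (0, ε i) (Pi.single k (interior (e i) χ) : Spinor V) (k + 1) =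
              wedgeOne (ε i) (interior (e i) χ) := fun i => by
            simp only [clifford]
            rw [Pi.single_eq_same, Pi.single_eq_of_ne (by omega)]
            ext w; simp
          have h5 : ∀ j : Fin (k + 1), ∑ i, ε i (v j) • χ (Matrix.vecCons (e i) (j.removeNth v)) =
              χ (Matrix.vecCons (v j) (j.removeNth v)) := fun j => by
            let f : V →ₗ[ℝ] ℂ :=
              { toFun := fun X => χ (Matrix.vecCons X (j.removeNth v))
                map_add' := fun X Y => χ.toAlternatingMap.map_vecCons_add _ X Y
                map_smul' := fun r X => χ.toAlternatingMap.map_vecCons_smul _ r X }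
            change ∑ i, ε i (v j) • f (e i) = f (v j)
            conv_rhs => rw [he (v j), map_sum]
            exact Finset.sum_congr rfl fun i _ => (map_smul f _ _).symm
          have h6 := congrArg (fun ψ => ψ v)
            (AlternatingMap.alternatizeUncurryFin_curryLeft χ.toAlternatingMap)
          rw [AlternatingMap.alternatizeUncurryFin_apply] at h6
          simp only [h4, wedgeOne_apply, interior_apply]
          rw [Finset.sum_comm, Pi.smul_apply, Pi.single_eq_same]
          simp only [← Finset.smul_sum, h5]
          rw [ContinuousAlternatingMap.smul_apply, Nat.cast_smul_eq_nsmul]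
          exact h6.symm
        · rw [Pi.smul_apply, Pi.single_eq_of_ne hl, Finset.sum_eq_zero]
          · simp
          · intro i _
            cases l with
            | zero => simp [clifford, interior_zero_left]
            | succ l =>
              simp only [clifford, interior_zero_left]
              rw [Pi.single_eq_of_ne (show l ≠ k by omega)]
              simp
      have h4 : (Pi.single (k + 1) χ : Spinor V) = ((k + 1 : ℕ) : ℂ)⁻¹ •
          ∑ i, clifford (0, ε i) (Pi.single k (interior (e i) χ)) := by
        rw [← h3, smul_smul, inv_mul_cancel₀ (by exact_mod_cast Nat.succ_ne_zero k), one_smul]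
      rw [h4]
      exact W.smul_mem _ (Submodule.sum_mem _ fun i _ => hW _ _ (ih _))
  refine eq_top_iff.2 fun φ _ => ?_
  -- Forms of degree greater than `dim V` vanish.
  have hφ : φ = ∑ k ∈ Finset.range (finrank ℝ V + 1), (Pi.single k (φ k) : Spinor V) := by
    funext l
    rw [Finset.sum_apply, Finset.sum_pi_single]
    split_ifs with hl
    · rfl
    · ext v
      refine φ l |>.toAlternatingMap.map_linearDependent v fun hv => hl ?_
      have := hv.fintype_card_le_finrank
      rw [Fintype.card_fin] at this
      rw [Finset.mem_range]
      omega
  rw [hφ]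
  exact Submodule.sum_mem _ fun k _ => hs k _

/-- The operator `(-1)^k` on `U_k`. -/
def gradedParity (J : Gen V →L[ℝ] Gen V) : Module.End ℂ (Spinor V) :=
  ∑ k ∈ Finset.Icc 0 (finrank ℝ V : ℤ), (-1 : ℂ) ^ k • projL J k

theorem gradedParity_of_mem (hJ : IsGC J) {k : ℤ} {φ : Spinor V} (hφ : φ ∈ gradedU J k) :
    gradedParity J φ = (-1 : ℂ) ^ k • φ := by
  rw [gradedParity, LinearMap.sum_apply]
  simp only [LinearMap.smul_apply, projL_apply, projU_of_mem hJ hφ, smul_ite, smul_zero]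
  rw [Finset.sum_ite_eq']
  split_ifs with hj
  · rfl
  · rw [gradedU_eq_bot hj, Submodule.mem_bot] at hφ
    rw [hφ, smul_zero]

theorem gradedParity_clifford (hJ : IsGC J) (a : Gen V) (φ : Spinor V) :
    gradedParity J (clifford a φ) = -clifford a (gradedParity J φ) := by
  have ha : ∀ φ : Spinor V, clifford a φ = (1 / 2 : ℂ) • (lop cl J a φ + lbar cl J a φ) :=
    fun φ => by
      rw [lop, lbar, LinearMap.sub_apply, LinearMap.add_apply, LinearMap.smul_apply, cl_apply]
      module
  refine spinor_induction hJ (fun k φ hφ => ?_) (fun φ ψ h1 h2 => ?_) φ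
  · rw [gradedParity_of_mem hJ hφ, clifford_smul, ha, map_smul, map_add,
      gradedParity_of_mem hJ (lop_mem_gradedU hJ a hφ),
      gradedParity_of_mem hJ (lbar_mem_gradedU hJ a hφ),
      zpow_sub₀ (by norm_num), zpow_add₀ (by norm_num), zpow_one]
    module
  · rw [clifford_add, map_add, map_add, clifford_add, h1, h2, neg_add]

theorem gradedParity_gradedParity (hJ : IsGC J) (φ : Spinor V) :
    gradedParity J (gradedParity J φ) = φ := by
  refine spinor_induction hJ (fun k φ hφ => ?_) (fun φ ψ h1 h2 => ?_) φ
  · rw [gradedParity_of_mem hJ hφ, map_smul, gradedParity_of_mem hJ hφ, smul_smul, ← mul_zpow]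
    norm_num
  · rw [map_add, map_add, h1, h2]

/-- The sign by which the parity of the `U_k`-grading and the parity of the degree of forms
differ. It is read off as the degree zero component of `gradedParity J 1`. -/
def paritySign (J : Gen V →L[ℝ] Gen V) : ℂ := gradedParity J (oneSpinor V) 0 ![]

/-- Every `U_k` consists of forms of pure parity. By Schur's lemma the two parity operators, which
both anticommute with the Clifford action, agree up to a sign. -/
theorem gradedParity_eq (hJ : IsGC J) (φ : Spinor V) :
    gradedParity J φ = paritySign J • parity φ := by
  have h1 : gradedParity J (oneSpinor V) = paritySign J • oneSpinor V :=
    eq_smul_oneSpinor fun X => by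
      have h := gradedParity_clifford hJ (X, 0) (oneSpinor V)
      rw [clifford_vector_oneSpinor, map_zero] at h
      exact neg_eq_zero.1 h.symm
  have h2 := parity_oneSpinor (V := V)
  have h3 : LinearMap.eqLocus (gradedParity J) (paritySign J • parity) = ⊤ := by
    refine eq_top_of_oneSpinor_mem ?_ fun a φ hφ => ?_
    · rw [LinearMap.mem_eqLocus, h1, LinearMap.smul_apply, h2]
    · rw [LinearMap.mem_eqLocus, LinearMap.smul_apply] at hφ ⊢
      rw [gradedParity_clifford hJ, parity_clifford, hφ, clifford_smul, smul_neg]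
  have h4 : φ ∈ LinearMap.eqLocus (gradedParity J) (paritySign J • parity) := h3 ▸ trivial
  exact h4

theorem paritySign_mul_self (hJ : IsGC J) : paritySign J * paritySign J = 1 := by
  have h := gradedParity_gradedParity hJ (oneSpinor V)
  have h2 := parity_oneSpinor (V := V)
  rw [gradedParity_eq hJ, gradedParity_eq hJ, h2, map_smul, h2, smul_smul] at h
  have h3 := congrArg (fun φ : Spinor V => φ 0 ![]) h
  simpa [oneSpinor] using h3

theorem parity_of_mem_gradedU (hJ : IsGC J) {k : ℤ} {φ : Spinor V} (hφ : φ ∈ gradedU J k) :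
    parity φ = (paritySign J * (-1 : ℂ) ^ k) • φ := by
  rw [mul_smul, ← gradedParity_of_mem hJ hφ, gradedParity_eq hJ, smul_smul,
    paritySign_mul_self hJ, one_smul]

/-- A spinor whose parity is that of `U_k` has no components in the `U_j` of other parity. -/
theorem projU_eq_zero_of_parity (hJ : IsGC J) {j k : ℤ} (hjk : ¬ Even (j - k)) {φ : Spinor V}
    (hφ : parity φ = (paritySign J * (-1 : ℂ) ^ k) • φ) : projU J j φ = 0 := by
  have h1 : gradedParity J φ = (-1 : ℂ) ^ k • φ := by
    rw [gradedParity_eq hJ, hφ, smul_smul, ← mul_assoc, paritySign_mul_self hJ, one_mul]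
  have h2 : ∀ φ, projU J j (gradedParity J φ) = (-1 : ℂ) ^ j • projU J j φ := fun φ => by
    refine spinor_induction hJ (fun i φ hφ => ?_) (fun φ ψ h1 h2 => ?_) φ
    · rw [gradedParity_of_mem hJ hφ, projU_smul, projU_of_mem hJ hφ]
      split_ifs with h
      · rw [h]
      · have h0 : ∀ z : ℂ, z • (0 : Spinor V) = 0 := fun z => smul_zero (A := Spinor V) z
        exact (h0 _).trans (h0 _).symm
    · rw [map_add, projU_add, h1, h2, projU_add, smul_add]
  have h3 := h2 φ
  rw [h1, projU_smul] at h3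
  refine eq_zero_of_smul_eq_smul (fun h4 => ?_) h3
  rcases Int.even_or_odd j with hj | hj <;> rcases Int.even_or_odd k with hk | hk
  · exact hjk (hj.sub hk)
  · rw [hj.neg_one_zpow, hk.neg_one_zpow] at h4
    norm_num at h4
  · rw [hj.neg_one_zpow, hk.neg_one_zpow] at h4
    norm_num at h4
  · exact hjk (hj.sub_odd hk)

end Parity

/-! ### The derived bracket on a vector space -/

section DerivedBracketAlgebra

variable {V : Type*} [AddCommGroup V] [Module ℝ V] [TopologicalSpace V]
  {S : Type*} [AddCommGroup S] [Module ℂ S] {c : Gen V → Module.End ℂ S}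

/-- The contribution of one coordinate direction to the derived bracket `[[d, A], B]`, where
`d = ∑ c(ε) ∂`: here `A'`, `B'`, `s'` stand for the derivatives of `A`, `B` and of the spinor `s`
in this direction. -/
theorem derived_bracket_term (hc : IsCliffordAction c) (ε A B A' B' : Gen V) (s s' : S) :
    c ε (c A' (c B s) + c A (c B' s + c B s')) + c A (c ε (c B' s + c B s'))
      - c B (c ε (c A' s + c A s')) - c B (c A (c ε s')) =
    c ((2 * pairing ε A) • B' - (2 * pairing ε B) • A' + (2 * pairing A' B) • ε) s := by
  have h : ∀ (a b : Gen V) (t : S), c a (c b t) = (2 * pairing a b : ℂ) • t - c b (c a t) :=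
    fun a b t => by
      have := LinearMap.congr_fun (hc.anticomm a b) t
      rw [LinearMap.add_apply, Module.End.mul_apply, Module.End.mul_apply, LinearMap.smul_apply,
        Module.End.one_apply] at this
      rw [← this, add_sub_cancel_right]
  rw [sub_eq_add_neg ((2 * pairing ε A) • B'), hc.add, hc.add, hc.neg, hc.smul, hc.smul, hc.smul]
  simp only [map_add, LinearMap.add_apply, LinearMap.neg_apply, LinearMap.smul_apply]
  rw [h ε A (c B' s), h ε A (c B s'), h ε A s', h A' B s, map_sub, map_sub, map_smul, map_smul,
    h ε B (c A' s)]
  push_cast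
  module

end DerivedBracketAlgebra

section DerivedBracket

variable {E : Type*} [NormedAddCommGroup E] [NormedSpace ℝ E]

variable (E) in
/-- Interior multiplication as a continuous bilinear map. -/
def interiorB (k : ℕ) : E →L[ℝ] (E [⋀^Fin (k + 1)]→L[ℝ] ℂ) →L[ℝ] (E [⋀^Fin k]→L[ℝ] ℂ) :=
  (ContinuousAlternatingMap.curryLeftLI (𝕜 := ℝ) (E := E) (F := ℂ)
    (n := k)).toContinuousLinearMap.flip

variable (E) in
/-- Multiplication by a one-form as a continuous bilinear map. -/
def wedgeB (k : ℕ) :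
    (E →L[ℝ] ℝ) →L[ℝ] (E [⋀^Fin k]→L[ℝ] ℂ) →L[ℝ] (E [⋀^Fin (k + 1)]→L[ℝ] ℂ) :=
  (ContinuousLinearMap.compL ℝ (E [⋀^Fin k]→L[ℝ] ℂ) (E →L[ℝ] E [⋀^Fin k]→L[ℝ] ℂ)
    (E [⋀^Fin (k + 1)]→L[ℝ] ℂ)
    (ContinuousAlternatingMap.alternatizeUncurryFinCLM ℝ E ℂ)).comp
    (ContinuousLinearMap.smulRightL ℝ E (E [⋀^Fin k]→L[ℝ] ℂ))

theorem wedgeB_apply (k : ℕ) (ξ : E →L[ℝ] ℝ) (φ : E [⋀^Fin k]→L[ℝ] ℂ) :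
    wedgeB E k ξ φ = wedgeOne ξ φ := by
  ext v
  rw [wedgeOne_apply]
  exact ContinuousAlternatingMap.alternatizeUncurryFin_apply _ _

/-- The exterior derivative of inhomogeneous forms on a vector space. -/
def extDerivS (σ : E → Spinor E) (y : E) : Spinor E
  | 0 => 0
  | k + 1 => extDeriv (fun z => σ z k) y

/-- The directional derivative of inhomogeneous forms on a vector space. -/
def fderivS (σ : E → Spinor E) (y v : E) : Spinor E := fun k => fderiv ℝ (fun z => σ z k) y v

/-- The Leibniz rule for the Clifford action. -/
theorem hasFDerivAt_clifford {A : E → Gen E} {σ : E → Spinor E} {y : E}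
    (hA : DifferentiableAt ℝ A y) (hσ : ∀ k, DifferentiableAt ℝ (fun z => σ z k) y) (k : ℕ) :
    DifferentiableAt ℝ (fun z => clifford (A z) (σ z) k) y ∧
    ∀ v, fderiv ℝ (fun z => clifford (A z) (σ z) k) y v =
      (clifford (fderiv ℝ A y v) (σ y) + clifford (A y) (fderivS σ y v)) k := by
  have h1 : HasFDerivAt (fun z => (A z).1) _ y := hA.hasFDerivAt.fst
  have h2 : HasFDerivAt (fun z => (A z).2) _ y := hA.hasFDerivAt.snd
  have hi : ∀ k, HasFDerivAt (fun z => interior (A z).1 (σ z (k + 1))) _ y := fun k =>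
    (interiorB E k).hasFDerivAt_of_bilinear h1 (hσ (k + 1)).hasFDerivAt
  have hw : ∀ k, HasFDerivAt (fun z => wedgeB E k (A z).2 (σ z k)) _ y := fun k =>
    (wedgeB E k).hasFDerivAt_of_bilinear h2 (hσ k).hasFDerivAt
  cases k with
  | zero =>
    refine ⟨(hi 0).differentiableAt, fun v => ?_⟩
    change fderiv ℝ (fun z => interior (A z).1 (σ z (0 + 1))) y v = _
    rw [(hi 0).fderiv]
    exact add_comm _ _
  | succ k =>
    simp only [wedgeB_apply] at hw
    have h := (hi (k + 1)).add (hw k)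
    refine ⟨h.differentiableAt, fun v => ?_⟩
    have h3 : fderiv ℝ (fun z => clifford (A z) (σ z) (k + 1)) y = _ := h.fderiv
    rw [h3]
    change (interior _ _ + interior _ _) + (wedgeB E k _ _ + wedgeB E k _ _) =
      (interior _ _ + wedgeOne _ _) + (interior _ _ + wedgeOne _ _)
    rw [wedgeB_apply, wedgeB_apply, add_comm (interior _ _), add_comm (wedgeOne _ _),
      add_add_add_comm]
    rfl

theorem contDiffAt_bilinear {F G H : Type*} [NormedAddCommGroup F] [NormedSpace ℝ F]
    [NormedAddCommGroup G] [NormedSpace ℝ G] [NormedAddCommGroup H] [NormedSpace ℝ H]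
    (B : F →L[ℝ] G →L[ℝ] H) {f : E → F} {g : E → G} {y : E} (hf : ContDiffAt ℝ ∞ f y)
    (hg : ContDiffAt ℝ ∞ g y) : ContDiffAt ℝ ∞ (fun z => B (f z) (g z)) y :=
  (B.contDiff.contDiffAt.comp y hf).clm_apply hg

theorem contDiffAt_clifford {A : E → Gen E} {σ : E → Spinor E} {y : E}
    (hA1 : ContDiffAt ℝ ∞ (fun z => (A z).1) y) (hA2 : ContDiffAt ℝ ∞ (fun z => (A z).2) y)
    (hσ : ∀ k, ContDiffAt ℝ ∞ (fun z => σ z k) y) (k : ℕ) :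
    ContDiffAt ℝ ∞ (fun z => clifford (A z) (σ z) k) y := by
  have hi : ∀ k, ContDiffAt ℝ ∞ (fun z => interior (A z).1 (σ z (k + 1))) y := fun k =>
    contDiffAt_bilinear (interiorB E k) hA1 (hσ (k + 1))
  have hw : ∀ k, ContDiffAt ℝ ∞ (fun z => wedgeB E k (A z).2 (σ z k)) y := fun k =>
    contDiffAt_bilinear (wedgeB E k) hA2 (hσ k)
  simp only [wedgeB_apply] at hw
  cases k with
  | zero => exact hi 0
  | succ k => exact (hi (k + 1)).add (hw k)

/-- The exterior derivative is `∑ εᵢ ∧ ∂ᵢ`. -/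
theorem extDerivS_eq_sum {ι : Type*} [Fintype ι] {e : ι → E} {ε : ι → E →L[ℝ] ℝ}
    (he : ∀ v, v = ∑ i, ε i v • e i) (σ : E → Spinor E) (y : E) :
    extDerivS σ y = ∑ i, clifford (0, ε i) (fderivS σ y (e i)) := by
  funext k
  rw [Finset.sum_apply]
  cases k with
  | zero =>
    rw [Finset.sum_eq_zero]
    · rfl
    · intro i _
      exact interior_zero_left _
  | succ k =>
    have h1 : ∀ i, clifford (0, ε i) (fderivS σ y (e i)) (k + 1) =
        wedgeOne (ε i) (fderiv ℝ (fun z => σ z k) y (e i)) := fun i => by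
      simp only [clifford, interior_zero_left, zero_add]
      rfl
    rw [Finset.sum_congr rfl fun i _ => h1 i]
    ext v
    rw [ContinuousAlternatingMap.sum_apply]
    simp only [wedgeOne_apply]
    rw [Finset.sum_comm]
    refine (ContinuousAlternatingMap.alternatizeUncurryFin_apply _ _).trans ?_
    refine Finset.sum_congr rfl fun j _ => ?_
    rw [← Finset.smul_sum]
    congr 1
    conv_lhs => rw [he (v j), map_sum, ContinuousAlternatingMap.sum_apply]
    exact Finset.sum_congr rfl fun i _ => by
      rw [map_smul, ContinuousAlternatingMap.smul_apply]

/-- The Dorfman bracket `D_X B - D_Y A + 2 ⟨DA, B⟩` of `A = X + ξ` and `B = Y + η`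
on a vector space. -/
def dorfman (A B : E → Gen E) (y : E) : Gen E :=
  fderiv ℝ B y (A y).1 - fderiv ℝ A y (B y).1 +
    (0, ((ContinuousLinearMap.snd ℝ E (E →L[ℝ] ℝ)).comp (fderiv ℝ A y)).flip (B y).1 +
      (B y).2.comp ((ContinuousLinearMap.fst ℝ E (E →L[ℝ] ℝ)).comp (fderiv ℝ A y)))

theorem dorfman_eq_sum {ι : Type*} [Fintype ι] {e : ι → E} {ε : ι → E →L[ℝ] ℝ}
    (he : ∀ v, v = ∑ i, ε i v • e i) (A B : E → Gen E) (y : E) :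
    dorfman A B y = ∑ i, ((2 * pairing (0, ε i) (A y)) • fderiv ℝ B y (e i)
      - (2 * pairing (0, ε i) (B y)) • fderiv ℝ A y (e i)
      + (2 * pairing (fderiv ℝ A y (e i)) (B y)) • ((0, ε i) : Gen E)) := by
  have h1 : ∀ (L : E →L[ℝ] Gen E) (a : Gen E),
      ∑ i, (2 * pairing (0, ε i) a) • L (e i) = L a.1 := fun L a => by
    conv_rhs => rw [he a.1, map_sum]
    refine Finset.sum_congr rfl fun i _ => ?_
    rw [map_smul]
    congr 1
    simp [pairing]
  rw [Finset.sum_add_distrib, Finset.sum_sub_distrib, h1, h1, dorfman]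
  congr 1
  refine Prod.ext ?_ ?_
  · simp [Prod.fst_sum]
  · rw [Prod.snd_sum]
    ext v
    rw [_root_.sum_apply]
    have h2 : ∀ v, (((ContinuousLinearMap.snd ℝ E (E →L[ℝ] ℝ)).comp (fderiv ℝ A y)).flip (B y).1 +
      (B y).2.comp ((ContinuousLinearMap.fst ℝ E (E →L[ℝ] ℝ)).comp (fderiv ℝ A y))) v =
        2 * pairing (fderiv ℝ A y v) (B y) := fun v => by
      simp [pairing]
    conv_lhs => rw [he v, map_sum]
    refine Finset.sum_congr rfl fun i _ => ?_
    rw [map_smul, h2]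
    exact mul_comm _ _

/-- The Dorfman bracket is the derived bracket `[[d, A], B]`. -/
theorem derived_bracket [FiniteDimensional ℝ E] {A B : E → Gen E} {σ : E → Spinor E} {y : E}
    (hA : DifferentiableAt ℝ A y) (hB : DifferentiableAt ℝ B y)
    (hσ : ∀ k, DifferentiableAt ℝ (fun z => σ z k) y) :
    extDerivS (fun z => clifford (A z) (clifford (B z) (σ z))) y
      + clifford (A y) (extDerivS (fun z => clifford (B z) (σ z)) y)
      - clifford (B y) (extDerivS (fun z => clifford (A z) (σ z)) y)
      - clifford (B y) (clifford (A y) (extDerivS σ y)) = clifford (dorfman A B y) (σ y) := by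
  obtain ⟨e, ε, he, -⟩ := exists_basis_continuous_dual E
  have hd : ∀ {A : E → Gen E} {σ : E → Spinor E}, DifferentiableAt ℝ A y →
      (∀ k, DifferentiableAt ℝ (fun z => σ z k) y) → ∀ v,
      fderivS (fun z => clifford (A z) (σ z)) y v =
        cl (fderiv ℝ A y v) (σ y) + cl (A y) (fderivS σ y v) := fun hA hσ v =>
    funext fun k => (hasFDerivAt_clifford hA hσ k).2 v
  have hBσ : ∀ k, DifferentiableAt ℝ (fun z => clifford (B z) (σ z) k) y := fun k =>
    (hasFDerivAt_clifford hB hσ k).1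
  simp only [extDerivS_eq_sum he, hd hA hBσ, hd hB hσ, hd hA hσ]
  simp only [← cl_apply, map_sum]
  rw [← Finset.sum_add_distrib, ← Finset.sum_sub_distrib, ← Finset.sum_sub_distrib,
    dorfman_eq_sum he, isCliffordAction_cl.sum, LinearMap.sum_apply]
  exact Finset.sum_congr rfl fun i _ =>
    derived_bracket_term isCliffordAction_cl (0, ε i) (A y) (B y) _ _ (σ y) _

end DerivedBracket

/-! ### Change of coordinates for forms and spinors -/

section Pull

variable {V W : Type*} [AddCommGroup V] [Module ℝ V] [TopologicalSpace V]
  [AddCommGroup W] [Module ℝ W] [TopologicalSpace W]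

/-- The pullback of an inhomogeneous form along a linear map. -/
def pullSpinor (P : W →L[ℝ] V) (φ : Spinor V) : Spinor W :=
  fun k => (φ k).compContinuousLinearMap P

/-- The map `V ⊕ V* → W ⊕ W*` induced by an isomorphism `Q : V → W` with inverse `P`. Both maps
are data, so that no invertibility has to be proved in order to write it down. -/
def pullGen (P : W →L[ℝ] V) (Q : V →L[ℝ] W) (a : Gen V) : Gen W := (Q a.1, a.2.comp P)

theorem pullSpinor_add (P : W →L[ℝ] V) (φ φ' : Spinor V) :
    pullSpinor P (φ + φ') = pullSpinor P φ + pullSpinor P φ' := rfl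

theorem pullSpinor_smul (P : W →L[ℝ] V) (z : ℂ) (φ : Spinor V) :
    pullSpinor P (z • φ) = z • pullSpinor P φ := rfl

theorem pullSpinor_sub (P : W →L[ℝ] V) (φ φ' : Spinor V) :
    pullSpinor P (φ - φ') = pullSpinor P φ - pullSpinor P φ' := rfl

theorem pullSpinor_injective {P : W →L[ℝ] V} {Q : V →L[ℝ] W} (hPQ : ∀ v, P (Q v) = v) :
    Function.Injective (pullSpinor P) := fun φ φ' h => by
  funext k
  ext v
  have := DFunLike.congr_fun (congrFun h k) (Q ∘ v)
  simpa [pullSpinor, Function.comp_def, hPQ] using this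

theorem pullGen_injective {P : W →L[ℝ] V} {Q : V →L[ℝ] W} (hPQ : ∀ v, P (Q v) = v) :
    Function.Injective (pullGen P Q) := fun a a' h => by
  refine Prod.ext ?_ ?_
  · have := congrArg P (congrArg Prod.fst h)
    simpa [pullGen, hPQ] using this
  · ext v
    have := DFunLike.congr_fun (congrArg Prod.snd h) (Q v)
    simpa [pullGen, hPQ] using this

theorem clifford_pull {P : W →L[ℝ] V} {Q : V →L[ℝ] W} (hPQ : ∀ v, P (Q v) = v) (a : Gen V)
    (φ : Spinor V) :
    clifford (pullGen P Q a) (pullSpinor P φ) = pullSpinor P (clifford a φ) := by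
  have hi : ∀ k, interior (Q a.1) ((φ (k + 1)).compContinuousLinearMap P) =
      (interior a.1 (φ (k + 1))).compContinuousLinearMap P := fun k => by
    ext v
    change φ (k + 1) (P ∘ Matrix.vecCons (Q a.1) v) = φ (k + 1) (Matrix.vecCons a.1 (P ∘ v))
    congr 1
    funext i
    exact Fin.cases (hPQ _) (fun _ => rfl) i
  funext k
  cases k with
  | zero => exact hi 0
  | succ k =>
    change interior (Q a.1) ((φ (k + 2)).compContinuousLinearMap P) + _ = _
    rw [hi]
    ext v
    simp [pullGen, pullSpinor, clifford, Function.comp_def]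
    rfl

end Pull

/-! ### Sections in a chart -/

section Charts

variable {E : Type*} [NormedAddCommGroup E] [NormedSpace ℝ E]
  {M : Type*} [TopologicalSpace M] [ChartedSpace E M]

theorem chartInv_mem_source {x₀ : M} {y : E} (hy : y ∈ (extChartAt 𝓘(ℝ, E) x₀).target) :
    (extChartAt 𝓘(ℝ, E) x₀).symm y ∈ (chartAt E x₀).source := by
  have := (extChartAt 𝓘(ℝ, E) x₀).map_target hy
  rwa [extChartAt_source] at this

theorem eventually_mem_target (x₀ : M) :
    ∀ᶠ y in nhds (extChartAt 𝓘(ℝ, E) x₀ x₀), y ∈ (extChartAt 𝓘(ℝ, E) x₀).target :=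
  (isOpen_extChartAt_target x₀).mem_nhds (mem_extChartAt_target x₀)

theorem contMDiffAt_iff_contDiffAt {G : Type*} [NormedAddCommGroup G] [NormedSpace ℝ G]
    {f : M → G} {x₀ : M} : ContMDiffAt 𝓘(ℝ, E) 𝓘(ℝ, G) ∞ f x₀ ↔
      ContDiffAt ℝ ∞ (fun y => f ((extChartAt 𝓘(ℝ, E) x₀).symm y))
        (extChartAt 𝓘(ℝ, E) x₀ x₀) := by
  rw [contMDiffAt_iff_source, ModelWithCorners.range_eq_univ, contMDiffWithinAt_univ,
    _root_.contMDiffAt_iff_contDiffAt]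
  rfl

variable [IsManifold 𝓘(ℝ, E) ∞ M]

/-- The coordinate frame of the chart at `x₀`, as a map from the model space to `T_x`. It is
meaningful for `x` in the chart domain. -/
def frame (x₀ x : M) : E →L[ℝ] T E x :=
  (trivializationAt E (TangentSpace 𝓘(ℝ, E)) x₀).symmL ℝ x

/-- The coordinates on `T_x` in the chart at `x₀`. -/
def coframe (x₀ x : M) : T E x →L[ℝ] E :=
  (trivializationAt E (TangentSpace 𝓘(ℝ, E)) x₀).continuousLinearMapAt ℝ x

theorem coframe_frame {x₀ x : M} (hx : x ∈ (chartAt E x₀).source) (v : E) :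
    coframe x₀ x (frame x₀ x v) = v :=
  (trivializationAt E (TangentSpace 𝓘(ℝ, E)) x₀).continuousLinearMapAt_symmL (R := ℝ) hx v

theorem frame_coframe {x₀ x : M} (hx : x ∈ (chartAt E x₀).source) (v : T E x) :
    frame x₀ x (coframe x₀ x v) = v :=
  (trivializationAt E (TangentSpace 𝓘(ℝ, E)) x₀).symmL_continuousLinearMapAt (R := ℝ) hx v

theorem coframe_eq_mfderiv {x₀ x : M} (hx : x ∈ (chartAt E x₀).source) :
    coframe x₀ x = mfderiv 𝓘(ℝ, E) 𝓘(ℝ, E) (extChartAt 𝓘(ℝ, E) x₀) x :=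
  TangentBundle.continuousLinearMapAt_trivializationAt hx

theorem frame_eq_mfderiv {x₀ x : M} (hx : x ∈ (chartAt E x₀).source) :
    frame (E := E) x₀ x = mfderiv 𝓘(ℝ, E) 𝓘(ℝ, E) (extChartAt 𝓘(ℝ, E) x₀).symm
      (extChartAt 𝓘(ℝ, E) x₀ x) := by
  have h := TangentBundle.symmL_trivializationAt (I := 𝓘(ℝ, E)) hx
  rw [ModelWithCorners.range_eq_univ, mfderivWithin_univ] at h
  exact h

theorem frame_chartInv {x₀ : M} {y : E} (hy : y ∈ (extChartAt 𝓘(ℝ, E) x₀).target) :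
    frame (E := E) x₀ ((extChartAt 𝓘(ℝ, E) x₀).symm y) =
      mfderiv 𝓘(ℝ, E) 𝓘(ℝ, E) (extChartAt 𝓘(ℝ, E) x₀).symm y := by
  have h := frame_eq_mfderiv (chartInv_mem_source hy)
  rw [(extChartAt 𝓘(ℝ, E) x₀).right_inv hy] at h
  exact h

/-- A form in the chart at `x₀`. -/
def locForm {F : Type*} [NormedAddCommGroup F] [NormedSpace ℝ F] {k : ℕ} (x₀ : M)
    (w : ∀ x : M, T E x [⋀^Fin k]→L[ℝ] F) (y : E) : E [⋀^Fin k]→L[ℝ] F :=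
  (w ((extChartAt 𝓘(ℝ, E) x₀).symm y)).compContinuousLinearMap
    (frame x₀ ((extChartAt 𝓘(ℝ, E) x₀).symm y))

/-- An inhomogeneous form in the chart at `x₀`. -/
def locSpinor (x₀ : M) (ρ : ∀ x : M, Spinor (T E x)) (y : E) : Spinor E :=
  pullSpinor (frame x₀ ((extChartAt 𝓘(ℝ, E) x₀).symm y)) (ρ ((extChartAt 𝓘(ℝ, E) x₀).symm y))

/-- The element of `E ⊕ E*` representing an element of `T_x ⊕ T_x*` in the chart at `x₀`. -/
def coordTT (x₀ x : M) (a : TT E x) : Gen E := pullGen (frame x₀ x) (coframe x₀ x) a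

/-- A section of `T ⊕ T*` in the chart at `x₀`. -/
def locTT (x₀ : M) (A : ∀ x : M, TT E x) (y : E) : Gen E :=
  coordTT x₀ _ (A ((extChartAt 𝓘(ℝ, E) x₀).symm y))

theorem locTT_extChartAt {x₀ x : M} (hx : x ∈ (chartAt E x₀).source) (A : ∀ x : M, TT E x) :
    locTT x₀ A (extChartAt 𝓘(ℝ, E) x₀ x) = coordTT x₀ x (A x) := by
  rw [locTT, (extChartAt 𝓘(ℝ, E) x₀).left_inv (by rwa [extChartAt_source])]

theorem locSpinor_extChartAt {x₀ x : M} (hx : x ∈ (chartAt E x₀).source)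
    (ρ : ∀ x : M, Spinor (T E x)) :
    locSpinor x₀ ρ (extChartAt 𝓘(ℝ, E) x₀ x) = pullSpinor (frame x₀ x) (ρ x) := by
  rw [locSpinor, (extChartAt 𝓘(ℝ, E) x₀).left_inv (by rwa [extChartAt_source])]

/-- A form is smooth if and only if it is smooth at the centre of every chart. -/
theorem smoothForm_iff {F : Type*} [NormedAddCommGroup F] [NormedSpace ℝ F] {k : ℕ}
    {w : ∀ x : M, T E x [⋀^Fin k]→L[ℝ] F} : SmoothForm w ↔
      ∀ x₀ : M, ContDiffAt ℝ ∞ (locForm x₀ w) (extChartAt 𝓘(ℝ, E) x₀ x₀) := by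
  refine forall_congr' fun x₀ => ?_
  rw [Bundle.contMDiffAt_section, contMDiffAt_iff_contDiffAt]
  have h : ∀ x : M, (trivializationAt (E [⋀^Fin k]→L[ℝ] F)
      (fun x => T E x [⋀^Fin k]→L[ℝ] Bundle.Trivial M F x) x₀ ⟨x, w x⟩).2 =
      (w x).compContinuousLinearMap (frame x₀ x) := fun x => by
    ext v
    have := FiberBundle.trivializationAt_continuousAlternatingMap_apply (𝕜 := ℝ) (ι := Fin k)
      (F₁ := E) (E₁ := fun x : M => T E x) (F₂ := F) (E₂ := Bundle.Trivial M F) x₀ ⟨x, w x⟩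
    rw [this]
    change (Bundle.Trivial.trivialization M F).continuousLinearMapAt ℝ x _ = _
    rw [Bundle.Trivial.continuousLinearMapAt_trivialization]
    rfl
  simp only [h]
  rfl

/-- A section of `T ⊕ T*` is smooth if and only if it is smooth at the centre of every chart. -/
theorem smoothTT_iff {A : ∀ x : M, TT E x} : SmoothTT A ↔
      ∀ x₀ : M, ContDiffAt ℝ ∞ (fun y => (locTT x₀ A y).1) (extChartAt 𝓘(ℝ, E) x₀ x₀) ∧
        ContDiffAt ℝ ∞ (fun y => (locTT x₀ A y).2) (extChartAt 𝓘(ℝ, E) x₀ x₀) := by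
  rw [SmoothTT, forall_and]
  refine and_congr (forall_congr' fun x₀ => ?_) (forall_congr' fun x₀ => ?_)
  · rw [Bundle.contMDiffAt_section, contMDiffAt_iff_contDiffAt]
    have h : (fun y => (trivializationAt E (TangentSpace 𝓘(ℝ, E)) x₀
        ⟨(extChartAt 𝓘(ℝ, E) x₀).symm y, (A ((extChartAt 𝓘(ℝ, E) x₀).symm y)).1⟩).2)
        =ᶠ[nhds (extChartAt 𝓘(ℝ, E) x₀ x₀)] fun y => (locTT x₀ A y).1 := by
      filter_upwards [eventually_mem_target x₀] with y hy
      exact (congrFun ((trivializationAt E (TangentSpace 𝓘(ℝ, E)) x₀).coe_linearMapAt_of_mem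
        (R := ℝ) (chartInv_mem_source hy)) _).symm
    exact ⟨fun hA => hA.congr_of_eventuallyEq h.symm, fun hA => hA.congr_of_eventuallyEq h⟩
  · rw [Bundle.contMDiffAt_section, contMDiffAt_iff_contDiffAt]
    have h : ∀ x : M, (trivializationAt (E →L[ℝ] ℝ)
        (fun x => T E x →L[ℝ] Bundle.Trivial M ℝ x) x₀ ⟨x, (A x).2⟩).2 =
        (A x).2.comp (frame x₀ x) := fun x => by
      ext v
      rw [hom_trivializationAt_apply]
      change (Bundle.Trivial.trivialization M ℝ).continuousLinearMapAt ℝ x _ = _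
      rw [Bundle.Trivial.continuousLinearMapAt_trivialization]
      rfl
    simp only [h]
    rfl

end Charts

/-! ### The exterior derivative and the Courant bracket in a chart -/

section Charts

variable {E : Type*} [NormedAddCommGroup E] [NormedSpace ℝ E]
  {M : Type*} [TopologicalSpace M] [ChartedSpace E M] [IsManifold 𝓘(ℝ, E) ∞ M]

/-- The derivative of the change of coordinates between the charts at `x₀` and `x`. -/
theorem fderiv_chart_change {x₀ x : M} {y : E} (hy : y ∈ (extChartAt 𝓘(ℝ, E) x₀).target)
    (hx : (extChartAt 𝓘(ℝ, E) x₀).symm y ∈ (chartAt E x).source) :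
    fderiv ℝ (fun z => extChartAt 𝓘(ℝ, E) x ((extChartAt 𝓘(ℝ, E) x₀).symm z)) y =
      (coframe x ((extChartAt 𝓘(ℝ, E) x₀).symm y)).comp
        (frame x₀ ((extChartAt 𝓘(ℝ, E) x₀).symm y)) := by
  have h1 : MDifferentiableAt 𝓘(ℝ, E) 𝓘(ℝ, E) (extChartAt 𝓘(ℝ, E) x₀).symm y := by
    have := mdifferentiableWithinAt_extChartAt_symm (I := 𝓘(ℝ, E)) hy
    rwa [ModelWithCorners.range_eq_univ, mdifferentiableWithinAt_univ] at this
  rw [coframe_eq_mfderiv hx, frame_chartInv hy, ← mfderiv_eq_fderiv]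
  exact mfderiv_comp y (mdifferentiableAt_extChartAt hx) h1

theorem contDiffAt_chart_change {x₀ x : M} {y : E} (hy : y ∈ (extChartAt 𝓘(ℝ, E) x₀).target)
    (hx : (extChartAt 𝓘(ℝ, E) x₀).symm y ∈ (chartAt E x).source) :
    ContDiffAt ℝ ∞ (fun z => extChartAt 𝓘(ℝ, E) x ((extChartAt 𝓘(ℝ, E) x₀).symm z)) y := by
  rw [← _root_.contMDiffAt_iff_contDiffAt]
  exact (contMDiffAt_extChartAt' hx).comp y ((contMDiffOn_extChartAt_symm x₀).contMDiffAt
    ((isOpen_extChartAt_target x₀).mem_nhds hy))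

theorem extD_eq {F : Type*} [NormedAddCommGroup F] [NormedSpace ℝ F] {k : ℕ}
    (w : ∀ x : M, T E x [⋀^Fin k]→L[ℝ] F) (x : M) :
    extD w x = (extDeriv (locForm x w) (extChartAt 𝓘(ℝ, E) x x)).compContinuousLinearMap
      (coframe x x) := by
  rw [coframe_eq_mfderiv (mem_chart_source E x)]
  have h : (fun y => (w ((extChartAt 𝓘(ℝ, E) x).symm y)).compContinuousLinearMap
      (mfderiv 𝓘(ℝ, E) 𝓘(ℝ, E) (extChartAt 𝓘(ℝ, E) x).symm y))
      =ᶠ[nhds (extChartAt 𝓘(ℝ, E) x x)] locForm x w := by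
    filter_upwards [eventually_mem_target x] with y hy
    rw [locForm, frame_chartInv hy]
  rw [← h.extDeriv_eq]
  rfl

theorem two_le_infty : (2 : WithTop ℕ∞) ≤ ∞ := by
  exact WithTop.coe_le_coe.2 (le_top : (2 : ℕ∞) ≤ ⊤)

/-- The exterior derivative may be computed in any chart: it commutes with the pullback along the
change of coordinates. -/
theorem locForm_extD {F : Type*} [NormedAddCommGroup F] [NormedSpace ℝ F] {k : ℕ}
    {w : ∀ x : M, T E x [⋀^Fin k]→L[ℝ] F} (hw : SmoothForm w) {x₀ x : M}
    (hx : x ∈ (chartAt E x₀).source) :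
    (extD w x).compContinuousLinearMap (frame x₀ x) =
      extDeriv (locForm x₀ w) (extChartAt 𝓘(ℝ, E) x₀ x) := by
  have hx' : x ∈ (extChartAt 𝓘(ℝ, E) x₀).source := by rwa [extChartAt_source]
  have hy := (extChartAt 𝓘(ℝ, E) x₀).map_source hx'
  have hl := (extChartAt 𝓘(ℝ, E) x₀).left_inv hx'
  set y := extChartAt 𝓘(ℝ, E) x₀ x with hy_def
  have hc : ∀ᶠ z in nhds y, z ∈ (extChartAt 𝓘(ℝ, E) x₀).target ∧
      (extChartAt 𝓘(ℝ, E) x₀).symm z ∈ (chartAt E x).source := by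
    refine Filter.Eventually.and ((isOpen_extChartAt_target x₀).mem_nhds hy) ?_
    refine (continuousAt_extChartAt_symm'' hy).eventually_mem ?_
    rw [hl]
    exact chart_source_mem_nhds E x
  have h : locForm x₀ w =ᶠ[nhds y] fun z =>
      (locForm x w (extChartAt 𝓘(ℝ, E) x ((extChartAt 𝓘(ℝ, E) x₀).symm z))).compContinuousLinearMap
        (fderiv ℝ (fun z => extChartAt 𝓘(ℝ, E) x ((extChartAt 𝓘(ℝ, E) x₀).symm z)) z) := by
    filter_upwards [hc] with z hz
    rw [fderiv_chart_change hz.1 hz.2, locForm, locForm,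
      (extChartAt 𝓘(ℝ, E) x).left_inv (by rw [extChartAt_source]; exact hz.2)]
    ext v
    refine congrArg (w _) (funext fun i => ?_)
    exact (frame_coframe hz.2 _).symm
  have hxx : (extChartAt 𝓘(ℝ, E) x₀).symm y ∈ (chartAt E x).source := hc.self_of_nhds.2
  have hd : DifferentiableAt ℝ (locForm x w) (extChartAt 𝓘(ℝ, E) x
      ((extChartAt 𝓘(ℝ, E) x₀).symm y)) := by
    rw [hl]
    exact (smoothForm_iff.1 hw x).differentiableAt (by simp)
  rw [h.extDeriv_eq, extDeriv_pullback (r := ∞)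
    (f := fun z => extChartAt 𝓘(ℝ, E) x ((extChartAt 𝓘(ℝ, E) x₀).symm z)) hd
    (contDiffAt_chart_change hy hxx) (by simpa using two_le_infty),
    fderiv_chart_change hy hxx, hl, extD_eq]
  rfl

/-- Smoothness of an inhomogeneous form. -/
def SmoothSpinor (ρ : ∀ x : M, Spinor (T E x)) : Prop := ∀ k, SmoothForm fun x => ρ x k

theorem smoothSpinor_iff {ρ : ∀ x : M, Spinor (T E x)} : SmoothSpinor ρ ↔
    ∀ (x₀ : M) k, ContDiffAt ℝ ∞ (fun y => locSpinor x₀ ρ y k) (extChartAt 𝓘(ℝ, E) x₀ x₀) :=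
  (forall_congr' fun _ => smoothForm_iff).trans forall_comm

theorem pullSpinor_extDC {ρ : ∀ x : M, Spinor (T E x)} (hρ : SmoothSpinor ρ) {x₀ x : M}
    (hx : x ∈ (chartAt E x₀).source) :
    pullSpinor (frame x₀ x) (extDC ρ x) =
      extDerivS (locSpinor x₀ ρ) (extChartAt 𝓘(ℝ, E) x₀ x) := by
  funext k
  cases k with
  | zero => rfl
  | succ k => exact locForm_extD (hρ k) hx

theorem locSpinor_extDC {ρ : ∀ x : M, Spinor (T E x)} (hρ : SmoothSpinor ρ) {x₀ : M} {y : E}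
    (hy : y ∈ (extChartAt 𝓘(ℝ, E) x₀).target) :
    locSpinor x₀ (extDC ρ) y = extDerivS (locSpinor x₀ ρ) y := by
  rw [locSpinor, pullSpinor_extDC hρ (chartInv_mem_source hy),
    (extChartAt 𝓘(ℝ, E) x₀).right_inv hy]

set_option synthInstance.maxHeartbeats 200000 in
theorem contDiffAt_extDeriv {F : Type*} [NormedAddCommGroup F] [NormedSpace ℝ F] {k : ℕ}
    {w : E → E [⋀^Fin k]→L[ℝ] F} {y : E} (hw : ContDiffAt ℝ ∞ w y) :
    ContDiffAt ℝ ∞ (extDeriv w) y := by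
  have h : ContDiffAt ℝ ∞ (fderiv ℝ w) y := hw.fderiv_right (m := ∞) (by simp)
  let L : (E →L[ℝ] E [⋀^Fin k]→L[ℝ] F) →L[ℝ] E [⋀^Fin (k + 1)]→L[ℝ] F :=
    ContinuousAlternatingMap.alternatizeUncurryFinCLM ℝ E F
  exact h.continuousLinearMap_comp L

theorem SmoothSpinor.extDC {ρ : ∀ x : M, Spinor (T E x)} (hρ : SmoothSpinor ρ) :
    SmoothSpinor (extDC ρ) := by
  rw [smoothSpinor_iff] at hρ ⊢
  intro x₀ k
  have h : (fun y => locSpinor x₀ (GenCx.extDC ρ) y k) =ᶠ[nhds (extChartAt 𝓘(ℝ, E) x₀ x₀)]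
      fun y => extDerivS (locSpinor x₀ ρ) y k := by
    filter_upwards [eventually_mem_target x₀] with y hy
    rw [locSpinor_extDC (smoothSpinor_iff.2 hρ) hy]
  refine ContDiffAt.congr_of_eventuallyEq ?_ h
  cases k with
  | zero => exact contDiffAt_const
  | succ k => exact contDiffAt_extDeriv (hρ x₀ k)

theorem locSpinor_clifford {x₀ : M} {y : E} (hy : y ∈ (extChartAt 𝓘(ℝ, E) x₀).target)
    (A : ∀ x : M, TT E x) (ρ : ∀ x : M, Spinor (T E x)) :
    locSpinor x₀ (fun x => clifford (A x) (ρ x)) y =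
      clifford (locTT x₀ A y) (locSpinor x₀ ρ y) :=
  (clifford_pull (frame_coframe (chartInv_mem_source hy)) _ _).symm

theorem SmoothSpinor.clifford {ρ : ∀ x : M, Spinor (T E x)} (hρ : SmoothSpinor ρ)
    {A : ∀ x : M, TT E x} (hA : SmoothTT A) : SmoothSpinor fun x => clifford (A x) (ρ x) := by
  rw [smoothSpinor_iff] at hρ ⊢
  rw [smoothTT_iff] at hA
  intro x₀ k
  refine (contDiffAt_clifford (hA x₀).1 (hA x₀).2 (hρ x₀) k).congr_of_eventuallyEq ?_
  filter_upwards [eventually_mem_target x₀] with y hy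
  rw [locSpinor_clifford hy]

theorem SmoothTT.differentiableAt {A : ∀ x : M, TT E x} (hA : SmoothTT A) (x₀ : M) :
    DifferentiableAt ℝ (locTT x₀ A) (extChartAt 𝓘(ℝ, E) x₀ x₀) :=
  (((smoothTT_iff.1 hA x₀).1.prodMk (smoothTT_iff.1 hA x₀).2)).differentiableAt (by simp)

theorem SmoothSpinor.differentiableAt {ρ : ∀ x : M, Spinor (T E x)} (hρ : SmoothSpinor ρ)
    (x₀ : M) (k : ℕ) : DifferentiableAt ℝ (fun y => locSpinor x₀ ρ y k)
      (extChartAt 𝓘(ℝ, E) x₀ x₀) :=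
  (smoothSpinor_iff.1 hρ x₀ k).differentiableAt (by simp)

end Charts

/-! ### The Courant bracket as a derived bracket -/

section Courant

variable {E : Type*} [NormedAddCommGroup E] [NormedSpace ℝ E]
  {M : Type*} [TopologicalSpace M] [ChartedSpace E M] [IsManifold 𝓘(ℝ, E) ∞ M]

/-- The differential of a function `f` at the centre of a chart in which `f` is represented by
`f'`. -/
theorem dFun_eq {f : M → ℝ} {f' : E → ℝ} {x₀ : M}
    (hf : DifferentiableAt ℝ f' (extChartAt 𝓘(ℝ, E) x₀ x₀))
    (hff' : ∀ y ∈ (extChartAt 𝓘(ℝ, E) x₀).target, f ((extChartAt 𝓘(ℝ, E) x₀).symm y) = f' y) :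
    dFun (E := E) f x₀ = (fderiv ℝ f' (extChartAt 𝓘(ℝ, E) x₀ x₀)).comp (coframe x₀ x₀) := by
  have h : f =ᶠ[nhds x₀] f' ∘ extChartAt 𝓘(ℝ, E) x₀ := by
    filter_upwards [(isOpen_extChartAt_source (I := 𝓘(ℝ, E)) x₀).mem_nhds
      (mem_extChartAt_source (I := 𝓘(ℝ, E)) x₀)] with x hx
    rw [Function.comp_apply, ← hff' _ ((extChartAt 𝓘(ℝ, E) x₀).map_source hx),
      (extChartAt 𝓘(ℝ, E) x₀).left_inv hx]
  rw [coframe_eq_mfderiv (mem_chart_source E x₀), dFun, h.mfderiv_eq]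
  have := mfderiv_comp x₀ hf.mdifferentiableAt
    (mdifferentiableAt_extChartAt (I := 𝓘(ℝ, E)) (mem_chart_source E x₀))
  rw [this, mfderiv_eq_fderiv]
  rfl

/-- The Lie bracket of vector fields at the centre of a chart is the bracket of their coordinate
representations. -/
theorem coframe_mlieBracket (X Y : ∀ x : M, T E x) (x₀ : M) :
    coframe x₀ x₀ (VectorField.mlieBracket 𝓘(ℝ, E) X Y x₀) =
      VectorField.lieBracket ℝ (fun y => coframe x₀ _ (X ((extChartAt 𝓘(ℝ, E) x₀).symm y)))
        (fun y => coframe x₀ _ (Y ((extChartAt 𝓘(ℝ, E) x₀).symm y)))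
        (extChartAt 𝓘(ℝ, E) x₀ x₀) := by
  have hinv : ∀ y ∈ (extChartAt 𝓘(ℝ, E) x₀).target, ∀ v,
      (mfderiv 𝓘(ℝ, E) 𝓘(ℝ, E) (extChartAt 𝓘(ℝ, E) x₀).symm y).inverse v =
        coframe (E := E) x₀ ((extChartAt 𝓘(ℝ, E) x₀).symm y) v := fun y hy v => by
    have h := chartInv_mem_source hy
    refine DFunLike.congr_fun (ContinuousLinearMap.inverse_eq
      (g := coframe (E := E) x₀ ((extChartAt 𝓘(ℝ, E) x₀).symm y)) ?_ ?_) v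
    · refine ContinuousLinearMap.ext fun v => ?_
      exact (DFunLike.congr_fun (frame_chartInv hy) _).symm.trans (frame_coframe h v)
    · refine ContinuousLinearMap.ext fun v => ?_
      exact (congrArg (coframe (E := E) x₀ ((extChartAt 𝓘(ℝ, E) x₀).symm y))
        (DFunLike.congr_fun (frame_chartInv hy) v).symm).trans (coframe_frame h v)
  have h : ∀ X : (∀ x : M, T E x), (VectorField.mpullbackWithin 𝓘(ℝ, E) 𝓘(ℝ, E)
      (extChartAt 𝓘(ℝ, E) x₀).symm X (Set.range 𝓘(ℝ, E)))
      =ᶠ[nhds (extChartAt 𝓘(ℝ, E) x₀ x₀)]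
      fun y => coframe (E := E) x₀ _ (X ((extChartAt 𝓘(ℝ, E) x₀).symm y)) := fun X => by
    filter_upwards [eventually_mem_target x₀] with y hy
    rw [VectorField.mpullbackWithin_apply, ModelWithCorners.range_eq_univ, mfderivWithin_univ]
    exact hinv y hy _
  have hlie : VectorField.lieBracketWithin ℝ (VectorField.mpullbackWithin 𝓘(ℝ, E) 𝓘(ℝ, E)
      (extChartAt 𝓘(ℝ, E) x₀).symm X (Set.range 𝓘(ℝ, E)))
      (VectorField.mpullbackWithin 𝓘(ℝ, E) 𝓘(ℝ, E)
      (extChartAt 𝓘(ℝ, E) x₀).symm Y (Set.range 𝓘(ℝ, E))) Set.univ (extChartAt 𝓘(ℝ, E) x₀ x₀) =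
      VectorField.lieBracket ℝ
        (fun y => coframe (E := E) x₀ _ (X ((extChartAt 𝓘(ℝ, E) x₀).symm y)))
        (fun y => coframe (E := E) x₀ _ (Y ((extChartAt 𝓘(ℝ, E) x₀).symm y)))
        (extChartAt 𝓘(ℝ, E) x₀ x₀) := by
    refine (congrFun VectorField.lieBracketWithin_univ _).trans ?_
    exact (h X).lieBracket_vectorField_eq (h Y)
  rw [← hlie]
  have hset : (extChartAt 𝓘(ℝ, E) x₀).symm ⁻¹' Set.univ ∩ Set.range 𝓘(ℝ, E) = Set.univ := by
    rw [ModelWithCorners.range_eq_univ, Set.preimage_univ, Set.inter_univ]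
  have hb := VectorField.mlieBracketWithin_apply (I := 𝓘(ℝ, E)) (V := X) (W := Y) (s := Set.univ)
    (x₀ := x₀)
  rw [hset, VectorField.mlieBracketWithin_univ] at hb
  rw [hb]
  have hfr : ∀ v : E, (mfderiv 𝓘(ℝ, E) 𝓘(ℝ, E) (extChartAt 𝓘(ℝ, E) x₀) x₀).inverse v =
      frame (E := E) x₀ x₀ v := fun v => by
    have h := mem_chart_source E x₀
    refine DFunLike.congr_fun (ContinuousLinearMap.inverse_eq (g := frame (E := E) x₀ x₀) ?_ ?_) v
    · refine ContinuousLinearMap.ext fun v => ?_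
      exact (DFunLike.congr_fun (coframe_eq_mfderiv h) _).symm.trans (coframe_frame h v)
    · refine ContinuousLinearMap.ext fun v => ?_
      exact (congrArg (frame (E := E) x₀ x₀)
        (DFunLike.congr_fun (coframe_eq_mfderiv h) v).symm).trans (frame_coframe h v)
  exact (congrArg (coframe (E := E) x₀ x₀) (hfr _)).trans (coframe_frame (mem_chart_source E x₀) _)

/-- The Lie derivative of a one-form in a chart. -/
theorem lieD_frame {X : ∀ x : M, T E x} {η : ∀ x : M, T E x →L[ℝ] ℝ} {X' : E → E}
    {η' : E → E →L[ℝ] ℝ} {x₀ : M}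
    (hX : DifferentiableAt ℝ X' (extChartAt 𝓘(ℝ, E) x₀ x₀))
    (hη : DifferentiableAt ℝ η' (extChartAt 𝓘(ℝ, E) x₀ x₀))
    (hXX' : ∀ y, coframe x₀ _ (X ((extChartAt 𝓘(ℝ, E) x₀).symm y)) = X' y)
    (hηη' : ∀ y, (η ((extChartAt 𝓘(ℝ, E) x₀).symm y)).comp (frame x₀ _) = η' y) (v : E) :
    lieD X η x₀ (frame x₀ x₀ v) =
      fderiv ℝ η' (extChartAt 𝓘(ℝ, E) x₀ x₀) (X' (extChartAt 𝓘(ℝ, E) x₀ x₀)) v +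
        η' (extChartAt 𝓘(ℝ, E) x₀ x₀) (fderiv ℝ X' (extChartAt 𝓘(ℝ, E) x₀ x₀) v) := by
  have hx := mem_chart_source E x₀
  set p := extChartAt 𝓘(ℝ, E) x₀ x₀ with hp
  have hXp : coframe x₀ x₀ (X x₀) = X' p := by
    rw [← hXX', hp, (extChartAt 𝓘(ℝ, E) x₀).left_inv (mem_extChartAt_source x₀)]
  have h1 : dFun (E := E) (fun x => η x (X x)) x₀ (frame x₀ x₀ v) =
      fderiv ℝ η' p v (X' p) + η' p (fderiv ℝ X' p v) := by
    rw [dFun_eq (f' := fun y => η' y (X' y)) (hη.clm_apply hX), ContinuousLinearMap.comp_apply,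
      coframe_frame hx, fderiv_clm_apply hη hX]
    · simp [add_comm]
    · intro y hy
      rw [← hXX', ← hηη', ContinuousLinearMap.comp_apply, frame_coframe (chartInv_mem_source hy)]
  let Λ : (E →L[ℝ] ℝ) ≃ₗᵢ[ℝ] E [⋀^Fin 1]→L[ℝ] ℝ :=
    ContinuousAlternatingMap.ofSubsingletonLIE (0 : Fin 1)
  have h2 : locForm x₀ (fun y => ContinuousAlternatingMap.ofSubsingleton ℝ (T E y) ℝ (0 : Fin 1)
      (η y)) = fun y => Λ (η' y) := by
    funext y
    rw [← hηη']
    rfl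
  have h3 : extD (fun y => ContinuousAlternatingMap.ofSubsingleton ℝ (T E y) ℝ (0 : Fin 1) (η y))
      x₀ (Matrix.vecCons (X x₀) fun _ : Fin 1 => frame x₀ x₀ v) =
      fderiv ℝ η' p (X' p) v - fderiv ℝ η' p v (X' p) := by
    have h4 : fderiv ℝ (fun y => Λ (η' y)) p =
        (Λ.toContinuousLinearEquiv : (E →L[ℝ] ℝ) →L[ℝ] E [⋀^Fin 1]→L[ℝ] ℝ).comp
          (fderiv ℝ η' p) := Λ.toContinuousLinearEquiv.comp_fderiv (f := η') (x := p)
    rw [extD_eq, h2]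
    refine (ContinuousAlternatingMap.alternatizeUncurryFin_apply _ _).trans ?_
    rw [Fin.sum_univ_two, h4, sub_eq_add_neg]
    simp only [Fin.val_zero, Fin.val_one, pow_zero, pow_one, one_smul, neg_smul]
    have h5 : coframe x₀ x₀ (frame x₀ x₀ v) = v := coframe_frame hx v
    refine congrArg₂ (fun a b : ℝ => a + -b) ?_ ?_
    · refine (congrArg₂ (fun a b => fderiv ℝ η' p a b) hXp h5)
    · refine (congrArg₂ (fun a b => fderiv ℝ η' p a b) h5 hXp)
  rw [lieD, _root_.add_apply, h1]
  refine (congrArg (· + _) h3).trans ?_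
  ring

/-- In a chart, the Dorfman bracket is the Courant bracket corrected by `d ⟨A, B⟩`. -/
theorem coordTT_courant {A B : ∀ x : M, TT E x} (hA : SmoothTT A) (hB : SmoothTT B) (x₀ : M) :
    coordTT x₀ x₀ (courant A B x₀ + (0, dFun (fun x => pairing (A x) (B x)) x₀)) =
      dorfman (locTT x₀ A) (locTT x₀ B) (extChartAt 𝓘(ℝ, E) x₀ x₀) := by
  have hA' := (hA.differentiableAt x₀).hasFDerivAt
  have hB' := (hB.differentiableAt x₀).hasFDerivAt
  have hx := mem_chart_source E x₀
  set p := extChartAt 𝓘(ℝ, E) x₀ x₀ with hp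
  have hA1 : HasFDerivAt (fun y => (locTT x₀ A y).1) _ p := hA'.fst
  have hA2 : HasFDerivAt (fun y => (locTT x₀ A y).2) _ p := hA'.snd
  have hB1 : HasFDerivAt (fun y => (locTT x₀ B y).1) _ p := hB'.fst
  have hB2 : HasFDerivAt (fun y => (locTT x₀ B y).2) _ p := hB'.snd
  refine Prod.ext ?_ ?_
  · have h : coframe (E := E) x₀ x₀ (VectorField.mlieBracket 𝓘(ℝ, E) (fun y => (A y).1)
        (fun y => (B y).1) x₀ + 0) =
        (fderiv ℝ (locTT x₀ B) p (locTT x₀ A p).1 - fderiv ℝ (locTT x₀ A) p (locTT x₀ B p).1).1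
          + 0 := by
      rw [add_zero, add_zero, coframe_mlieBracket, VectorField.lieBracket_eq]
      change fderiv ℝ (fun y => (locTT x₀ B y).1) p _ - fderiv ℝ (fun y => (locTT x₀ A y).1) p _ = _
      rw [hA1.fderiv, hB1.fderiv]
      rfl
    exact h
  · have hlie : ∀ {A B : ∀ x : M, TT E x}, SmoothTT A → SmoothTT B → ∀ v,
        lieD (fun y => (A y).1) (fun y => (B y).2) x₀ (frame (E := E) x₀ x₀ v) =
        (fderiv ℝ (locTT x₀ B) p (locTT x₀ A p).1).2 v +
          (locTT x₀ B p).2 (fderiv ℝ (locTT x₀ A) p v).1 := fun {A B} hA hB v => by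
      have hA1 : HasFDerivAt (fun y => (locTT x₀ A y).1) _ p :=
        (hA.differentiableAt x₀).hasFDerivAt.fst
      have hB2 : HasFDerivAt (fun y => (locTT x₀ B y).2) _ p :=
        (hB.differentiableAt x₀).hasFDerivAt.snd
      rw [lieD_frame (X' := fun y => (locTT x₀ A y).1) (η' := fun y => (locTT x₀ B y).2)
        hA1.differentiableAt hB2.differentiableAt (fun _ => rfl) (fun _ => rfl), hA1.fderiv,
        hB2.fderiv]
      rfl
    have hpair : ∀ y ∈ (extChartAt 𝓘(ℝ, E) x₀).target, ∀ {A B : ∀ x : M, TT E x},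
        (B ((extChartAt 𝓘(ℝ, E) x₀).symm y)).2 (A ((extChartAt 𝓘(ℝ, E) x₀).symm y)).1 =
        (locTT x₀ B y).2 (locTT x₀ A y).1 := fun y hy A B =>
      congrArg _ (frame_coframe (chartInv_mem_source hy) _).symm
    have hAB := hA2.clm_apply hB1
    have hBA := hB2.clm_apply hA1
    have hd1 := dFun_eq (x₀ := x₀) (f := fun y => (B y).2 (A y).1 - (A y).2 (B y).1)
      (hBA.sub hAB).differentiableAt (fun y hy => by rw [hpair y hy, hpair y hy]; rfl)
    have hd2 := dFun_eq (x₀ := x₀) (f := fun y => pairing (A y) (B y))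
      ((hAB.add hBA).const_mul (1 / 2 : ℝ)).differentiableAt
      (fun y hy => by rw [pairing, hpair y hy, hpair y hy]; rfl)
    rw [(hBA.sub hAB).fderiv] at hd1
    rw [((hAB.add hBA).const_mul (1 / 2 : ℝ)).fderiv] at hd2
    ext v
    have h5 : coframe x₀ x₀ (frame x₀ x₀ v) = v := coframe_frame hx v
    have hd1' := DFunLike.congr_fun hd1 (frame x₀ x₀ v)
    have hd2' := DFunLike.congr_fun hd2 (frame x₀ x₀ v)
    rw [ContinuousLinearMap.comp_apply, h5] at hd1' hd2'
    have hl1 := hlie hA hB v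
    have hl2 := hlie hB hA v
    change lieD (fun y => (A y).1) (fun y => (B y).2) x₀ (frame x₀ x₀ v)
      - lieD (fun y => (B y).1) (fun y => (A y).2) x₀ (frame x₀ x₀ v)
      - (1 / 2 : ℝ) * dFun (fun y => (B y).2 (A y).1 - (A y).2 (B y).1) x₀ (frame x₀ x₀ v)
      + dFun (fun x => pairing (A x) (B x)) x₀ (frame x₀ x₀ v) =
      ((fderiv ℝ (locTT x₀ B) p (locTT x₀ A p).1).2 v
        - (fderiv ℝ (locTT x₀ A) p (locTT x₀ B p).1).2 v) +
      ((fderiv ℝ (locTT x₀ A) p v).2 (locTT x₀ B p).1 +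
        (locTT x₀ B p).2 (fderiv ℝ (locTT x₀ A) p v).1)
    rw [hl1, hl2, hd1', hd2']
    simp
    ring

end Courant

/-! ### Linearity of the exterior derivative and the complex derived bracket -/

section DerivedBracket

variable {E : Type*} [NormedAddCommGroup E] [NormedSpace ℝ E]
  {M : Type*} [TopologicalSpace M] [ChartedSpace E M] [IsManifold 𝓘(ℝ, E) ∞ M]

theorem SmoothSpinor.add {ρ ρ' : ∀ x : M, Spinor (T E x)} (hρ : SmoothSpinor ρ)
    (hρ' : SmoothSpinor ρ') : SmoothSpinor fun x => ρ x + ρ' x := by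
  rw [smoothSpinor_iff] at *
  exact fun x₀ k => (hρ x₀ k).add (hρ' x₀ k)

theorem SmoothSpinor.smul {ρ : ∀ x : M, Spinor (T E x)} (hρ : SmoothSpinor ρ) (z : ℂ) :
    SmoothSpinor fun x => z • ρ x := by
  rw [smoothSpinor_iff] at *
  exact fun x₀ k => (hρ x₀ k).const_smul z

theorem smoothSpinor_zero : SmoothSpinor fun x : M => (0 : Spinor (T E x)) := by
  rw [smoothSpinor_iff]
  exact fun x₀ k => contDiffAt_const (c := (0 : E [⋀^Fin k]→L[ℝ] ℂ))

theorem SmoothSpinor.sum {ι : Type*} (s : Finset ι) {ρ : ι → ∀ x : M, Spinor (T E x)}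
    (hρ : ∀ i, SmoothSpinor (ρ i)) : SmoothSpinor fun x => ∑ i ∈ s, ρ i x := by
  classical
  induction s using Finset.induction_on with
  | empty => simpa using smoothSpinor_zero
  | insert i s hi ih =>
    simp only [Finset.sum_insert hi]
    exact (hρ i).add ih

theorem SmoothTT.add {A B : ∀ x : M, TT E x} (hA : SmoothTT A) (hB : SmoothTT B) :
    SmoothTT fun x => A x + B x := by
  rw [smoothTT_iff] at *
  refine fun x₀ => ⟨?_, (hA x₀).2.add (hB x₀).2⟩
  refine ((hA x₀).1.add (hB x₀).1).congr_of_eventuallyEq (Filter.Eventually.of_forall fun y => ?_)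
  exact map_add (coframe x₀ _) _ _

theorem SmoothTT.const_smul {A : ∀ x : M, TT E x} (hA : SmoothTT A) (r : ℝ) :
    SmoothTT fun x => r • A x := by
  rw [smoothTT_iff] at *
  refine fun x₀ => ⟨?_, (hA x₀).2.const_smul r⟩
  refine ((hA x₀).1.const_smul r).congr_of_eventuallyEq (Filter.Eventually.of_forall fun y => ?_)
  exact map_smul (coframe x₀ _) _ _

theorem SmoothTT.neg {A : ∀ x : M, TT E x} (hA : SmoothTT A) : SmoothTT fun x => -A x := by
  convert hA.const_smul (-1) using 2 with x
  exact (neg_one_smul ℝ (A x)).symm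

theorem smoothTT_zero : SmoothTT fun x : M => (0 : TT E x) := by
  rw [smoothTT_iff]
  refine fun x₀ => ⟨?_, contDiffAt_const (c := (0 : E →L[ℝ] ℝ))⟩
  refine contDiffAt_const (c := (0 : E)) |>.congr_of_eventuallyEq
    (Filter.Eventually.of_forall fun y => ?_)
  exact map_zero (coframe x₀ _)

theorem SmoothTT.sum {ι : Type*} (s : Finset ι) {A : ι → ∀ x : M, TT E x}
    (hA : ∀ i, SmoothTT (A i)) : SmoothTT fun x => ∑ i ∈ s, A i x := by
  classical
  induction s using Finset.induction_on with
  | empty => simpa using smoothTT_zero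
  | insert i s hi ih =>
    simp only [Finset.sum_insert hi]
    exact (hA i).add ih

theorem extDerivS_congr {σ σ' : E → Spinor E} {y : E} (h : ∀ᶠ z in nhds y, σ z = σ' z) :
    extDerivS σ y = extDerivS σ' y := by
  funext k
  cases k with
  | zero => rfl
  | succ k => exact Filter.EventuallyEq.extDeriv_eq (h.mono fun z hz => congrFun hz k)

/-- The exterior derivative at a point, in the chart at this point. -/
theorem extDC_eq (ρ : ∀ x : M, Spinor (T E x)) (x : M) :
    extDC ρ x = pullSpinor (coframe x x) (extDerivS (locSpinor x ρ) (extChartAt 𝓘(ℝ, E) x x)) := by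
  funext k
  cases k with
  | zero => rfl
  | succ k => exact extD_eq (E := E) (F := ℂ) (fun y => ρ y k) x

theorem extDC_congr {ρ ρ' : ∀ x : M, Spinor (T E x)} {x : M} (h : ∀ᶠ z in nhds x, ρ z = ρ' z) :
    extDC ρ x = extDC ρ' x := by
  rw [extDC_eq, extDC_eq, extDerivS_congr]
  have hc := continuousAt_extChartAt_symm (I := 𝓘(ℝ, E)) x
  rw [ContinuousAt, (extChartAt 𝓘(ℝ, E) x).left_inv (mem_extChartAt_source x)] at hc
  filter_upwards [hc.eventually h] with y hy
  rw [locSpinor, hy, locSpinor]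

theorem extDC_add {ρ ρ' : ∀ x : M, Spinor (T E x)} (hρ : SmoothSpinor ρ) (hρ' : SmoothSpinor ρ')
    (x : M) : extDC (fun y => ρ y + ρ' y) x = extDC ρ x + extDC ρ' x := by
  rw [extDC_eq, extDC_eq ρ, extDC_eq ρ', ← pullSpinor_add]
  congr 1
  funext k
  cases k with
  | zero => exact (add_zero _).symm
  | succ k => exact extDeriv_fun_add (hρ.differentiableAt x k) (hρ'.differentiableAt x k)

theorem extDC_smul {ρ : ∀ x : M, Spinor (T E x)} (hρ : SmoothSpinor ρ) (z : ℂ) (x : M) :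
    extDC (fun y => z • ρ y) x = z • extDC ρ x := by
  rw [extDC_eq, extDC_eq ρ, ← pullSpinor_smul]
  congr 1
  funext k
  cases k with
  | zero => exact (smul_zero (A := E [⋀^Fin 0]→L[ℝ] ℂ) z).symm
  | succ k =>
    change extDeriv (fun y => z • locSpinor x ρ y k) _ = z • extDeriv _ _
    have h : HasFDerivAt (fun y => z • locSpinor x ρ y k) _ _ :=
      (hρ.differentiableAt x k).hasFDerivAt.const_smul z
    ext v
    rw [extDeriv, h.fderiv]
    simp [extDeriv, ContinuousAlternatingMap.alternatizeUncurryFin_apply, Finset.mul_sum]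

theorem extDC_zero (x : M) : extDC (fun y : M => (0 : Spinor (T E y))) x = 0 := by
  have h := extDC_smul (smoothSpinor_zero (E := E) (M := M)) 0 x
  rw [zero_smul ℂ (extDC _ x)] at h
  refine Eq.trans (congrArg (extDC · x) (funext fun y => ?_)) h
  exact (smul_zero (A := Spinor (T E y)) (0 : ℂ)).symm

theorem extDC_sum {ι : Type*} (s : Finset ι) {ρ : ι → ∀ x : M, Spinor (T E x)}
    (hρ : ∀ i, SmoothSpinor (ρ i)) (x : M) :
    extDC (fun y => ∑ i ∈ s, ρ i y) x = ∑ i ∈ s, extDC (ρ i) x := by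
  classical
  induction s using Finset.induction_on with
  | empty => simpa using extDC_zero x
  | insert i s hi ih =>
    simp only [Finset.sum_insert hi]
    rw [extDC_add (hρ i) (SmoothSpinor.sum s hρ), ih]

/-- The Courant bracket as the derived bracket `[[d, A], B]`, up to the term `d ⟨A, B⟩`. -/
theorem derived_bracket_courant [FiniteDimensional ℝ E] {A B : ∀ x : M, TT E x} (hA : SmoothTT A)
    (hB : SmoothTT B) {ρ : ∀ x : M, Spinor (T E x)} (hρ : SmoothSpinor ρ) (x : M) :
    extDC (fun y => clifford (A y) (clifford (B y) (ρ y))) x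
      + clifford (A x) (extDC (fun y => clifford (B y) (ρ y)) x)
      - clifford (B x) (extDC (fun y => clifford (A y) (ρ y)) x)
      - clifford (B x) (clifford (A x) (extDC ρ x)) =
    clifford (courant A B x + (0, dFun (fun x => pairing (A x) (B x)) x)) (ρ x) := by
  have hx := mem_chart_source E x
  have hfc := frame_coframe hx
  refine pullSpinor_injective hfc ?_
  have hev : ∀ (A : ∀ x : M, TT E x) (ρ : ∀ x : M, Spinor (T E x)),
      ∀ᶠ y in nhds (extChartAt 𝓘(ℝ, E) x x), locSpinor x (fun x => clifford (A x) (ρ x)) y =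
        clifford (locTT x A y) (locSpinor x ρ y) := fun A ρ =>
    (eventually_mem_target x).mono fun y hy => locSpinor_clifford hy A ρ
  simp only [pullSpinor_add, pullSpinor_sub, ← clifford_pull hfc]
  rw [pullSpinor_extDC ((hρ.clifford hB).clifford hA) hx, pullSpinor_extDC (hρ.clifford hB) hx,
    pullSpinor_extDC (hρ.clifford hA) hx, pullSpinor_extDC hρ hx,
    extDerivS_congr (hev B ρ), extDerivS_congr (hev A ρ),
    extDerivS_congr (σ' := fun y => clifford (locTT x A y) (clifford (locTT x B y)
      (locSpinor x ρ y))) ((hev A _).mp ((hev B ρ).mono fun y h1 h2 => by rw [h2, h1]))]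
  have h := derived_bracket (hA.differentiableAt x) (hB.differentiableAt x) (hρ.differentiableAt x)
  rw [← coordTT_courant hA hB, locTT_extChartAt hx, locTT_extChartAt hx,
    locSpinor_extChartAt hx] at h
  exact h

end DerivedBracket

/-! ### Complex sections of `T ⊕ T*` -/

section ComplexSections

variable {E : Type*} [NormedAddCommGroup E] [NormedSpace ℝ E]
  {M : Type*} [TopologicalSpace M] [ChartedSpace E M]

theorem dFun_neg (f : M → ℝ) (x : M) : dFun (E := E) (fun y => -f y) x = -dFun f x :=
  mfderiv_neg (f := f) (x := x)

variable [IsManifold 𝓘(ℝ, E) ∞ M]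

/-- Smoothness of a section of `(T ⊕ T*) ⊗ ℂ`. -/
def SmoothCx (A : ∀ x : M, Cx (TT E x)) : Prop :=
  SmoothTT (fun x => (A x).re) ∧ SmoothTT fun x => (A x).im

theorem SmoothSpinor.cliffordC {ρ : ∀ x : M, Spinor (T E x)} (hρ : SmoothSpinor ρ)
    {A : ∀ x : M, Cx (TT E x)} (hA : SmoothCx A) : SmoothSpinor fun x => cliffordC (A x) (ρ x) :=
  (hρ.clifford hA.1).add ((hρ.clifford hA.2).smul Complex.I)

theorem extDC_cliffordC {ρ : ∀ x : M, Spinor (T E x)} (hρ : SmoothSpinor ρ)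
    {A : ∀ x : M, Cx (TT E x)} (hA : SmoothCx A) (x : M) :
    extDC (fun y => cliffordC (A y) (ρ y)) x =
      extDC (fun y => clifford (A y).re (ρ y)) x +
        Complex.I • extDC (fun y => clifford (A y).im (ρ y)) x := by
  rw [← extDC_smul (hρ.clifford hA.2), ← extDC_add (hρ.clifford hA.1)
    ((hρ.clifford hA.2).smul Complex.I)]
  rfl

/-- The bookkeeping for the complexification of the derived bracket. The hypotheses are the derived
brackets of the real and imaginary parts; the contributions `D` and `D'` of the differentials of
their pairings cancel. -/
theorem complex_bracket_expansion {S : Type*} [AddCommGroup S] [Module ℂ S]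
    {d₁₁ d₁₂ d₂₁ d₂₂ p₁₁ p₁₂ p₂₁ p₂₂ r₁₁ r₁₂ r₂₁ r₂₂ s₁₁ s₁₂ s₂₁ s₂₂ k₁₁ k₁₂ k₂₁ k₂₂ D D' : S}
    (h₁₁ : d₁₁ + p₁₁ - r₁₁ - s₁₁ = k₁₁ + D) (h₁₂ : d₁₂ + p₁₂ - r₁₂ - s₁₂ = k₁₂ + -D')
    (h₂₁ : d₂₁ + p₂₁ - r₂₁ - s₂₁ = k₂₁ + D') (h₂₂ : d₂₂ + p₂₂ - r₂₂ - s₂₂ = k₂₂ + D) :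
    d₁₁ + Complex.I • d₁₂ + Complex.I • (d₂₁ + Complex.I • d₂₂)
      + (p₁₁ + Complex.I • p₁₂ + Complex.I • (p₂₁ + Complex.I • p₂₂))
      - (r₁₁ + Complex.I • r₂₁ + Complex.I • (r₁₂ + Complex.I • r₂₂))
      - (s₁₁ + Complex.I • s₂₁ + Complex.I • (s₁₂ + Complex.I • s₂₂)) =
    k₁₁ + -k₂₂ + Complex.I • (k₁₂ + k₂₁) := by
  have hI : ∀ v : S, Complex.I • Complex.I • v = -v := fun v => by
    rw [smul_smul, Complex.I_mul_I, neg_one_smul]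
  simp only [smul_add, hI]
  linear_combination (norm := module) h₁₁ - h₂₂ + Complex.I • h₁₂ + Complex.I • h₂₁

/-- The complex Courant bracket of two sections of an isotropic subbundle of `(T ⊕ T*) ⊗ ℂ` as a
derived bracket; `hre` and `him` say that the real and the imaginary part of the complex bilinear
pairing of the sections vanish. -/
theorem derived_bracket_courantC [FiniteDimensional ℝ E] {A B : ∀ x : M, Cx (TT E x)}
    (hA : SmoothCx A) (hB : SmoothCx B)
    (hre : ∀ x, pairing (A x).re (B x).re = pairing (A x).im (B x).im)
    (him : ∀ x, pairing (A x).re (B x).im = -pairing (A x).im (B x).re)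
    {ρ : ∀ x : M, Spinor (T E x)} (hρ : SmoothSpinor ρ) (x : M) :
    extDC (fun y => cliffordC (A y) (cliffordC (B y) (ρ y))) x
      + cliffordC (A x) (extDC (fun y => cliffordC (B y) (ρ y)) x)
      - cliffordC (B x) (extDC (fun y => cliffordC (A y) (ρ y)) x)
      - cliffordC (B x) (cliffordC (A x) (extDC ρ x)) =
    cliffordC (courantC A B x) (ρ x) := by
  have hS := fun {C D : ∀ x : M, TT E x} (hC : SmoothTT C) (hD : SmoothTT D) =>
    derived_bracket_courant hC hD hρ x
  have h11 := hS hA.1 hB.1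
  have h12 := hS hA.1 hB.2
  have h21 := hS hA.2 hB.1
  have h22 := hS hA.2 hB.2
  have hd1 : (fun x => pairing (A x).re (B x).re) = fun x => pairing (A x).im (B x).im :=
    funext hre
  have hd2 : (fun x => pairing (A x).re (B x).im) = fun x => -pairing (A x).im (B x).re :=
    funext him
  rw [hd1] at h11
  rw [hd2, dFun_neg] at h12
  have hcl : ∀ (a b : TT E x) (φ : Spinor (T E x)),
      clifford (a + b) φ = clifford a φ + clifford b φ := fun a b φ => clifford_add_left a b φ
  have hneg : ∀ (a : TT E x) (φ : Spinor (T E x)), clifford (-a) φ = -clifford a φ := fun a φ =>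
    LinearMap.congr_fun (isCliffordAction_cl.neg a) φ
  have hz : ((0 : T E x), -dFun (E := E) (fun x => pairing (A x).im (B x).re) x) =
      -((0, dFun (fun x => pairing (A x).im (B x).re) x) : TT E x) := by
    rw [Prod.neg_mk, neg_zero]
  rw [hz] at h12
  have e2 := fun {C : ∀ x : M, TT E x} (hC : SmoothTT C) => extDC_add
    ((hρ.clifford hB.1).clifford hC) (((hρ.clifford hB.2).clifford hC).smul Complex.I) x
  have e3 := fun {C : ∀ x : M, TT E x} (hC : SmoothTT C) => extDC_smul
    ((hρ.clifford hB.2).clifford hC) Complex.I x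
  rw [extDC_cliffordC (hρ.cliffordC hB) hA, extDC_cliffordC hρ hA, extDC_cliffordC hρ hB]
  simp only [cliffordC, clifford_add, clifford_smul]
  rw [e2 hA.1, e2 hA.2, e3 hA.1, e3 hA.2]
  simp only [courantC, sub_eq_add_neg (courant _ _ x), hcl, hneg] at h11 h12 h21 h22 ⊢
  exact complex_bracket_expansion h11 h12 h21 h22

theorem dorfman_neg_left {A B : E → Gen E} (y : E) :
    dorfman (fun z => -A z) B y = -dorfman A B y := by
  have h : fderiv ℝ (fun z => -A z) y = -fderiv ℝ A y := fderiv_fun_neg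
  rw [dorfman, dorfman, h]
  refine Prod.ext ?_ ?_
  · simp
    abel
  · ext v
    simp
    ring

theorem dorfman_neg_right {A B : E → Gen E} (y : E) :
    dorfman A (fun z => -B z) y = -dorfman A B y := by
  have h : fderiv ℝ (fun z => -B z) y = -fderiv ℝ B y := fderiv_fun_neg
  rw [dorfman, dorfman, h]
  refine Prod.ext ?_ ?_
  · simp
    abel
  · ext v
    simp
    ring

theorem locTT_neg (x₀ : M) (A : ∀ x : M, TT E x) :
    locTT x₀ (fun x => -A x) = fun y => -locTT x₀ A y :=
  funext fun _ => Prod.ext (map_neg (coframe x₀ _) _) rfl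

/-- The Dorfman bracket in a chart is visibly bilinear; the Courant bracket inherits this from
`coordTT_courant`. -/
theorem courant_neg_left {A B : ∀ x : M, TT E x} (hA : SmoothTT A) (hB : SmoothTT B) (x : M) :
    courant (fun y => -A y) B x = -courant A B x := by
  have h1 := coordTT_courant hA.neg hB x
  have h2 := coordTT_courant hA hB x
  have hd : dFun (E := E) (fun x => pairing (-A x) (B x)) x =
      -dFun (fun x => pairing (A x) (B x)) x := by
    rw [← dFun_neg]
    exact congrArg (dFun · x) (funext fun y => pairing_neg_left _ _)
  have hn : ∀ a : TT E x, coordTT x x (-a) = -coordTT x x a := fun a =>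
    Prod.ext (map_neg (coframe x x) _) rfl
  rw [locTT_neg, dorfman_neg_left, ← h2, ← hn, hd] at h1
  have h3 := pullGen_injective (frame_coframe (mem_chart_source E x)) h1
  refine add_right_cancel (h3.trans ?_)
  rw [neg_add]
  exact congrArg (-courant A B x + ·) (Prod.ext (neg_zero (G := T E x)) rfl)

theorem courant_neg_right {A B : ∀ x : M, TT E x} (hA : SmoothTT A) (hB : SmoothTT B) (x : M) :
    courant A (fun y => -B y) x = -courant A B x := by
  have h1 := coordTT_courant hA hB.neg x
  have h2 := coordTT_courant hA hB x
  have hd : dFun (E := E) (fun x => pairing (A x) (-B x)) x =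
      -dFun (fun x => pairing (A x) (B x)) x := by
    rw [← dFun_neg]
    exact congrArg (dFun · x) (funext fun y => pairing_neg_right _ _)
  have hn : ∀ a : TT E x, coordTT x x (-a) = -coordTT x x a := fun a =>
    Prod.ext (map_neg (coframe x x) _) rfl
  rw [locTT_neg, dorfman_neg_right, ← h2, ← hn, hd] at h1
  have h3 := pullGen_injective (frame_coframe (mem_chart_source E x)) h1
  refine add_right_cancel (h3.trans ?_)
  rw [neg_add]
  exact congrArg (-courant A B x + ·) (Prod.ext (neg_zero (G := T E x)) rfl)

/-- The complex Courant bracket is real, that is, it commutes with complex conjugation. -/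
theorem courantC_conj {A B : ∀ x : M, Cx (TT E x)} (hA : SmoothCx A) (hB : SmoothCx B) (x : M) :
    courantC (fun y => (A y).conj) (fun y => (B y).conj) x = (courantC A B x).conj := by
  refine Cx.ext ?_ ?_
  · change courant _ _ x - courant (fun y => -(A y).im) (fun y => -(B y).im) x = _
    rw [courant_neg_left hA.2 hB.2.neg, courant_neg_right hA.2 hB.2, neg_neg]
    rfl
  · change courant (fun y => (A y).re) (fun y => -(B y).im) x +
      courant (fun y => -(A y).im) (fun y => (B y).re) x = _
    rw [courant_neg_left hA.2 hB.1, courant_neg_right hA.1 hB.2, ← neg_add]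
    rfl

end ComplexSections

/-! ### Global smooth frames near a point -/

section GlobalFrames

variable {E : Type*} [NormedAddCommGroup E] [NormedSpace ℝ E]
  {M : Type*} [TopologicalSpace M] [ChartedSpace E M] [IsManifold 𝓘(ℝ, E) ∞ M]

/-- Sections of `T ⊕ T*` that are constant in the chart at `x₀` are smooth in its domain. -/
theorem smoothAt_frame_section (e : E) (ε : E →L[ℝ] ℝ) {x₀ x₁ : M}
    (hx : x₁ ∈ (chartAt E x₀).source) :
    ContDiffAt ℝ ∞ (fun y => (locTT x₁ (fun x => (frame x₀ x e, ε.comp (coframe x₀ x))) y).1)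
        (extChartAt 𝓘(ℝ, E) x₁ x₁) ∧
      ContDiffAt ℝ ∞ (fun y => (locTT x₁ (fun x => (frame x₀ x e, ε.comp (coframe x₀ x))) y).2)
        (extChartAt 𝓘(ℝ, E) x₁ x₁) := by
  set p := extChartAt 𝓘(ℝ, E) x₁ x₁ with hp
  have hl : (extChartAt 𝓘(ℝ, E) x₁).symm p = x₁ :=
    (extChartAt 𝓘(ℝ, E) x₁).left_inv (mem_extChartAt_source x₁)
  have hpt : p ∈ (extChartAt 𝓘(ℝ, E) x₁).target := mem_extChartAt_target x₁
  have hc : ∀ᶠ y in nhds p, y ∈ (extChartAt 𝓘(ℝ, E) x₁).target ∧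
      (extChartAt 𝓘(ℝ, E) x₁).symm y ∈ (chartAt E x₀).source := by
    refine (eventually_mem_target x₁).and ?_
    refine (continuousAt_extChartAt_symm x₁).eventually_mem ?_
    rw [hl]
    exact (chartAt E x₀).open_source.mem_nhds hx
  have h1 : ContDiffAt ℝ ∞
      (fun y => extChartAt 𝓘(ℝ, E) x₀ ((extChartAt 𝓘(ℝ, E) x₁).symm y)) p :=
    contDiffAt_chart_change hpt (by rw [hl]; exact hx)
  have hx' : x₁ ∈ (extChartAt 𝓘(ℝ, E) x₀).source := by rwa [extChartAt_source]
  have h2 : ContDiffAt ℝ ∞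
      (fun y => extChartAt 𝓘(ℝ, E) x₁ ((extChartAt 𝓘(ℝ, E) x₀).symm y))
      (extChartAt 𝓘(ℝ, E) x₀ ((extChartAt 𝓘(ℝ, E) x₁).symm p)) := by
    rw [hl]
    refine contDiffAt_chart_change ((extChartAt 𝓘(ℝ, E) x₀).map_source hx') ?_
    rw [(extChartAt 𝓘(ℝ, E) x₀).left_inv hx']
    exact mem_chart_source E x₁
  constructor
  · have h3 : ContDiffAt ℝ ∞ (fun y =>
        fderiv ℝ (fun y => extChartAt 𝓘(ℝ, E) x₁ ((extChartAt 𝓘(ℝ, E) x₀).symm y))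
          (extChartAt 𝓘(ℝ, E) x₀ ((extChartAt 𝓘(ℝ, E) x₁).symm y)) e) p :=
      ((h2.fderiv_right (m := ∞) (by simp)).comp p h1).clm_apply contDiffAt_const
    refine h3.congr_of_eventuallyEq ?_
    filter_upwards [hc] with y hy
    have hy' : (extChartAt 𝓘(ℝ, E) x₁).symm y ∈ (extChartAt 𝓘(ℝ, E) x₀).source := by
      rw [extChartAt_source]; exact hy.2
    have hl' := (extChartAt 𝓘(ℝ, E) x₀).left_inv hy'
    rw [fderiv_chart_change ((extChartAt 𝓘(ℝ, E) x₀).map_source hy')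
      (by rw [hl']; exact chartInv_mem_source hy.1), hl']
    rfl
  · have h3 : ContDiffAt ℝ ∞ (fun y => ε.comp
        (fderiv ℝ (fun y => extChartAt 𝓘(ℝ, E) x₀ ((extChartAt 𝓘(ℝ, E) x₁).symm y)) y)) p :=
      contDiffAt_const.clm_comp (h1.fderiv_right (m := ∞) (by simp))
    refine h3.congr_of_eventuallyEq ?_
    filter_upwards [hc] with y hy
    rw [fderiv_chart_change hy.1 hy.2]
    rfl

/-- A section of `T ⊕ T*` that is smooth in the chart domain at `x₀` may be cut off to a smooth
global section. -/
theorem smoothTT_bump_smul [FiniteDimensional ℝ E] [T2Space M] {x₀ : M}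
    (β : SmoothBumpFunction 𝓘(ℝ, E) x₀)
    {A : ∀ x : M, TT E x} (hA : ∀ x₁ ∈ (chartAt E x₀).source,
      ContDiffAt ℝ ∞ (fun y => (locTT x₁ A y).1) (extChartAt 𝓘(ℝ, E) x₁ x₁) ∧
      ContDiffAt ℝ ∞ (fun y => (locTT x₁ A y).2) (extChartAt 𝓘(ℝ, E) x₁ x₁)) :
    SmoothTT fun x => β x • A x := by
  rw [smoothTT_iff]
  intro x₁
  by_cases hx : x₁ ∈ tsupport β
  · have hβ := contMDiffAt_iff_contDiffAt.1 (β.contMDiff.contMDiffAt (x := x₁))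
    have h := hA x₁ (β.tsupport_subset_chartAt_source hx)
    refine ⟨?_, hβ.smul h.2⟩
    refine (hβ.smul h.1).congr_of_eventuallyEq (Filter.Eventually.of_forall fun y => ?_)
    exact map_smul (coframe x₁ _) _ _
  · have h0 : ∀ᶠ y in nhds (extChartAt 𝓘(ℝ, E) x₁ x₁),
        β ((extChartAt 𝓘(ℝ, E) x₁).symm y) = 0 := by
      have hc := continuousAt_extChartAt_symm (I := 𝓘(ℝ, E)) x₁
      rw [ContinuousAt, (extChartAt 𝓘(ℝ, E) x₁).left_inv (mem_extChartAt_source x₁)] at hc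
      exact hc.eventually (notMem_tsupport_iff_eventuallyEq.1 hx)
    constructor
    · refine (contDiffAt_const (c := (0 : E))).congr_of_eventuallyEq ?_
      filter_upwards [h0] with y hy
      rw [locTT, hy]
      refine Eq.trans ?_ (map_zero (coframe x₁ ((extChartAt 𝓘(ℝ, E) x₁).symm y)))
      exact congrArg _ (zero_smul ℝ _)
    · refine (contDiffAt_const (c := (0 : E →L[ℝ] ℝ))).congr_of_eventuallyEq ?_
      filter_upwards [h0] with y hy
      rw [locTT, hy]
      ext v
      exact zero_mul _

/-- Near every point, there are smooth global sections forming a pair of dual frames. -/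
theorem exists_smooth_dualFrame [FiniteDimensional ℝ E] [T2Space M] (x₀ : M) :
    ∃ b b' : Fin (finrank ℝ E) ⊕ Fin (finrank ℝ E) → ∀ x : M, TT E x,
      (∀ i, SmoothTT (b i)) ∧ (∀ i, SmoothTT (b' i)) ∧
        ∀ᶠ x in nhds x₀, IsDualFrame (fun i => b i x) (fun i => b' i x) := by
  obtain ⟨e, ε, he, -⟩ := exists_basis_continuous_dual E
  obtain ⟨β⟩ : Nonempty (SmoothBumpFunction 𝓘(ℝ, E) x₀) := inferInstance
  have hs := fun e ε => smoothTT_bump_smul β fun x₁ hx =>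
    smoothAt_frame_section (M := M) (E := E) e ε hx
  -- The frames `(e, ε)` and `(ε, e)`, transported by the chart and cut off by `β`.
  refine ⟨fun i x => β x •
      Sum.elim (fun i => (frame x₀ x (e i), (0 : E →L[ℝ] ℝ).comp (coframe x₀ x)))
      (fun i => (frame x₀ x (0 : E), (ε i).comp (coframe x₀ x))) i,
    fun i x => β x • Sum.elim (fun i => (frame x₀ x (0 : E), (ε i).comp (coframe x₀ x)))
      (fun i => (frame x₀ x (e i), (0 : E →L[ℝ] ℝ).comp (coframe x₀ x))) i, ?_, ?_, ?_⟩
  · rintro (i | i)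
    · exact hs (e i) 0
    · exact hs 0 (ε i)
  · rintro (i | i)
    · exact hs 0 (ε i)
    · exact hs (e i) 0
  · filter_upwards [β.eventuallyEq_one, (chartAt E x₀).open_source.mem_nhds
      (mem_chart_source E x₀)] with x hβ hx
    have hβ1 : β x = 1 := hβ
    rw [hβ1]
    simp only [one_smul, map_zero, ContinuousLinearMap.zero_comp]
    refine isDualFrame_sum (e := fun i => frame x₀ x (e i))
      (ε := fun i => (ε i).comp (coframe x₀ x)) fun v => ?_
    conv_lhs => rw [← frame_coframe hx v, he (coframe x₀ x v), map_sum]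
    simp only [map_smul]
    rfl

end GlobalFrames

/-! ### Neighbouring summands of the grading -/

theorem lbar_mul_add_mul_lbar {V S : Type*} [AddCommGroup V] [Module ℝ V] [TopologicalSpace V]
    [AddCommGroup S] [Module ℂ S] {c : Gen V → Module.End ℂ S} (hc : IsCliffordAction c)
    (J : Gen V → Gen V) (q v : Gen V) : lbar c J q * c v + c v * lbar c J q =
      (2 * pairing q v + Complex.I * (2 * pairing (J q) v) : ℂ) • 1 := by
  rw [lbar, add_mul, mul_add, smul_mul_assoc, mul_smul_comm, add_smul, mul_smul Complex.I,
    ← hc.anticomm q v, ← hc.anticomm (J q) v]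
  module

section Neighbours

variable {V : Type*} [AddCommGroup V] [Module ℝ V] [TopologicalSpace V] {J : Gen V →L[ℝ] Gen V}

/-- The sum `U_{k-1} + U_{k+1}`, in which `d` of a section of `U_k` lies if `J` is integrable. -/
def adjU (J : Gen V →L[ℝ] Gen V) (k : ℤ) : Submodule ℂ (Spinor V) :=
  gradedU J (k - 1) ⊔ gradedU J (k + 1)

/-- The decomposition of the action of a complex generalized vector into its `L`- and
`L̄`-components. -/
theorem two_smul_cliffordC (hJ : IsGC J) (z : Cx (Gen V)) (φ : Spinor V) :
    (2 : ℂ) • cliffordC z φ = lop cl J (z.re + J z.im) φ + lbar cl J (z.re - J z.im) φ := by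
  have h : (2 : ℂ) • (cl z.re + Complex.I • cl z.im) =
      lop cl J (z.re + J z.im) + lbar cl J (z.re - J z.im) := by
    have hc := isCliffordAction_cl (V := V)
    simp only [sub_eq_add_neg (z.re), lop, lbar, hJ.add, hJ.map_neg, hJ.sq, hc.add, hc.neg]
    module
  exact LinearMap.congr_fun h φ

/-- For `k ≠ 0` this writes an element of `U_k` as a sum of products of `L̄` with `U_{k-1}`. -/
theorem sum_lbar_lop {ι : Type*} [Fintype ι] {b b' : ι → Gen V} (hJ : IsGC J)
    (hb : IsDualFrame b b') {k : ℤ} {φ : Spinor V} (hφ : φ ∈ gradedU J k) :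
    ∑ i, lbar cl J (b i) (lop cl J (b' i) φ) = (4 * k : ℂ) • φ := by
  have h := congrArg ((4 : ℂ) • ·) (numOp_apply_of_mem_gradedU hJ hb hφ)
  simp only [numOp, LinearMap.smul_apply, LinearMap.sum_apply, Module.End.mul_apply,
    smul_smul] at h
  rw [mul_one_div_cancel (by norm_num)] at h
  exact (one_smul ℂ _).symm.trans h

variable [IsTopologicalAddGroup V] [ContinuousSMul ℝ V] [T2Space V] [FiniteDimensional ℝ V]

theorem lop_mem_adjU (hJ : IsGC J) (a : Gen V) {k : ℤ} {φ : Spinor V} (hφ : φ ∈ adjU J k) :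
    lop cl J a φ ∈ adjU J (k - 1) := by
  obtain ⟨ψ, hψ, θ, hθ, rfl⟩ := Submodule.mem_sup.1 hφ
  rw [map_add]
  refine add_mem (Submodule.mem_sup_left (lop_mem_gradedU hJ a hψ)) (Submodule.mem_sup_right ?_)
  have h := lop_mem_gradedU hJ a hθ
  rwa [add_sub_right_comm] at h

theorem lbar_mem_adjU (hJ : IsGC J) (a : Gen V) {k : ℤ} {φ : Spinor V} (hφ : φ ∈ adjU J k) :
    lbar cl J a φ ∈ adjU J (k + 1) := by
  obtain ⟨ψ, hψ, θ, hθ, rfl⟩ := Submodule.mem_sup.1 hφ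
  rw [map_add]
  refine add_mem (Submodule.mem_sup_left ?_) (Submodule.mem_sup_right (lbar_mem_gradedU hJ a hθ))
  have h := lbar_mem_gradedU hJ a hψ
  rwa [← add_sub_right_comm] at h

theorem projU_of_mem_adjU (hJ : IsGC J) {j k : ℤ} (h1 : j ≠ k - 1) (h2 : j ≠ k + 1)
    {φ : Spinor V} (hφ : φ ∈ adjU J k) : projU J j φ = 0 := by
  obtain ⟨ψ, hψ, θ, hθ, rfl⟩ := Submodule.mem_sup.1 hφ
  rw [projU_add, projU_of_mem hJ hψ, projU_of_mem hJ hθ, if_neg h1, if_neg h2, add_zero]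

theorem mem_adjU_iff (hJ : IsGC J) {k : ℤ} {φ : Spinor V} :
    φ ∈ adjU J k ↔ φ = projU J (k - 1) φ + projU J (k + 1) φ := by
  constructor
  · intro hφ
    obtain ⟨ψ, hψ, θ, hθ, rfl⟩ := Submodule.mem_sup.1 hφ
    rw [projU_add, projU_add, projU_of_mem hJ hψ, projU_of_mem hJ hψ, projU_of_mem hJ hθ,
      projU_of_mem hJ hθ, if_pos rfl, if_neg (by omega), if_neg (by omega), if_pos rfl, add_zero,
      zero_add]
  · intro h
    rw [h]
    exact add_mem (Submodule.mem_sup_left (projU_mem J _ _))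
      (Submodule.mem_sup_right (projU_mem J _ _))

/-- If all products with two elements of `L` lie in `U_{k-3} + U_{k-1}` and the parity is that of
`U_{k+1}`, then a spinor lies in `U_{k-1} + U_{k+1}`, provided that `k = 0` or `k = 1`. -/
theorem mem_adjU_of_lop_lop (hJ : IsGC J) {k : ℤ} (hk : k = 0 ∨ k = 1) {φ : Spinor V}
    (h : ∀ a b, lop cl J a (lop cl J b φ) ∈ adjU J (k - 2))
    (hp : parity φ = (paritySign J * (-1 : ℂ) ^ (k + 1)) • φ) : φ ∈ adjU J k := by
  refine mem_of_projU_mem hJ fun j => ?_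
  by_cases h1 : j = k - 1
  · rw [h1]
    exact Submodule.mem_sup_left (projU_mem J _ _)
  by_cases h2 : j = k + 1
  · rw [h2]
    exact Submodule.mem_sup_right (projU_mem J _ _)
  have h0 : projU J j φ = 0 := by
    by_cases hj : Even (j - (k + 1))
    · refine eq_zero_of_lop_lop hJ ?_ ?_ (projU_mem J j φ) fun a b => ?_
      · rintro rfl
        obtain ⟨m, hm⟩ := hj
        omega
      · rintro rfl
        obtain ⟨m, hm⟩ := hj
        omega
      · have h3 : projU J (j - 2) (lop cl J a (lop cl J b φ)) = 0 :=
          projU_of_mem_adjU hJ (by omega) (by omega) (h a b)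
        rw [projU_lop hJ, projU_lop hJ] at h3
        convert h3 using 3
        ring_nf
    · exact projU_eq_zero_of_parity hJ hj hp
  rw [h0]
  exact zero_mem _

/-- For `k ≥ 2` this writes an element of `U_k` as a sum of elements of `L̄ · L̄ · U_{k-2}`. -/
theorem sum_lbar_lbar_lop_lop {ι : Type*} [Fintype ι] {b b' : ι → Gen V} (hJ : IsGC J)
    (hb : IsDualFrame b b') {k : ℤ} {φ : Spinor V}
    (hφ : φ ∈ gradedU J k) :
    ∑ i, ∑ j, lbar cl J (b i) (lbar cl J (b j) (lop cl J (b' j) (lop cl J (b' i) φ))) =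
      (16 * (k * (k - 1)) : ℂ) • φ := by
  have h : ∀ i, ∑ j, lbar cl J (b i) (lbar cl J (b j) (lop cl J (b' j) (lop cl J (b' i) φ))) =
      (4 * (k - 1 : ℤ) : ℂ) • lbar cl J (b i) (lop cl J (b' i) φ) := fun i => by
    rw [← map_sum, sum_lbar_lop hJ hb (lop_mem_gradedU hJ (b' i) hφ), map_smul]
  rw [Finset.sum_congr rfl fun i _ => h i, ← Finset.smul_sum, sum_lbar_lop hJ hb hφ, smul_smul]
  congr 1
  push_cast
  ring

/-- If a complex generalized vector `z` maps `φ ∈ U_k` to `U_{k-3} + U_{k-1}`, then its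
`L̄`-component annihilates `φ`, as it maps `φ` to `U_{k+1}`. -/
theorem lbar_eq_zero_of_mem_adjU (hJ : IsGC J) {z : Cx (Gen V)} {k : ℤ} {φ : Spinor V}
    (hφ : φ ∈ gradedU J k) (h : cliffordC z φ ∈ adjU J (k - 2)) :
    lbar cl J (z.re - J z.im) φ = 0 := by
  have h1 := two_smul_cliffordC hJ z φ
  rw [← sub_eq_iff_eq_add'] at h1
  have h2 : lop cl J (z.re + J z.im) φ ∈ adjU J (k - 2) := by
    refine Submodule.mem_sup_right ?_
    convert lop_mem_gradedU hJ (z.re + J z.im) hφ using 2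
    ring
  have h3 : lbar cl J (z.re - J z.im) φ ∈ adjU J (k - 2) := by
    rw [← h1]
    exact sub_mem (Submodule.smul_mem _ _ h) h2
  have h4 := projU_of_mem_adjU hJ (j := k + 1) (by omega) (by omega) h3
  rwa [projU_of_mem hJ (lbar_mem_gradedU hJ _ hφ), if_pos rfl] at h4

/-- The action of `q + i J q` on spinors determines `q`. -/
theorem eq_zero_of_lbar_oneSpinor {q : Gen V} (h1 : lbar cl J q (oneSpinor V) = 0)
    (h2 : ∀ v, lbar cl J q (clifford v (oneSpinor V)) = 0) : q = 0 := by
  have hq : ∀ v, pairing q v = 0 := fun v => by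
    have h3 := lbar_mul_add_mul_lbar isCliffordAction_cl J q v
    have h4 := LinearMap.congr_fun h3 (oneSpinor V)
    rw [LinearMap.add_apply, Module.End.mul_apply, Module.End.mul_apply, h1, map_zero, add_zero,
      cl_apply, h2 v] at h4
    have h5 : (2 * pairing q v + Complex.I * (2 * pairing (J q) v) : ℂ) = 0 := by
      by_contra hne
      exact oneSpinor_ne_zero (eq_zero_of_smul_eq_smul hne
        (h4.symm.trans (zero_smul ℂ (oneSpinor V)).symm))
    have h6 := congrArg Complex.re h5
    simpa using h6
  obtain ⟨b, b', hb⟩ := exists_isDualFrame V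
  rw [hb.expand q]
  exact Finset.sum_eq_zero fun i _ => by rw [pairing_comm, hq, mul_zero, zero_smul]

end Neighbours

/-! ### Smooth sections of the grading -/

section SmoothGrading

variable {E : Type*} [NormedAddCommGroup E] [NormedSpace ℝ E]
  {M : Type*} [TopologicalSpace M] [ChartedSpace E M] [IsManifold 𝓘(ℝ, E) ∞ M]

/-- Smoothness is local. -/
theorem smoothSpinor_of_eventuallyEq {ρ : ∀ x : M, Spinor (T E x)}
    (h : ∀ x₀, ∃ ρ' : ∀ x : M, Spinor (T E x), SmoothSpinor ρ' ∧ ∀ᶠ x in nhds x₀, ρ x = ρ' x) :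
    SmoothSpinor ρ := by
  rw [smoothSpinor_iff]
  intro x₀ k
  obtain ⟨ρ', hρ', he⟩ := h x₀
  refine (smoothSpinor_iff.1 hρ' x₀ k).congr_of_eventuallyEq ?_
  have hc := continuousAt_extChartAt_symm (I := 𝓘(ℝ, E)) x₀
  rw [ContinuousAt, (extChartAt 𝓘(ℝ, E) x₀).left_inv (mem_extChartAt_source x₀)] at hc
  filter_upwards [hc.eventually he] with y hy
  rw [locSpinor, hy, locSpinor]

theorem smoothSpinor_oneSpinor : SmoothSpinor fun x : M => oneSpinor (T E x) := by
  rw [smoothSpinor_iff]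
  intro x₀ k
  refine (contDiffAt_const (c := oneSpinor E k)).congr_of_eventuallyEq
    (Filter.Eventually.of_forall fun y => ?_)
  cases k <;> rfl

/-- The exterior derivative anticommutes with the parity of the degree. -/
theorem extDC_parity {ρ : ∀ x : M, Spinor (T E x)} (hρ : SmoothSpinor ρ) (x : M) :
    extDC (fun y => parity (ρ y)) x = -parity (extDC ρ x) := by
  funext k
  cases k with
  | zero => exact (neg_eq_zero.2 (smul_zero (A := T E x [⋀^Fin 0]→L[ℝ] ℂ) ((-1 : ℂ) ^ 0))).symm
  | succ k =>
    refine (congrFun (extDC_smul hρ ((-1) ^ k) x) (k + 1)).trans ?_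
    change (-1 : ℂ) ^ k • extDC ρ x (k + 1) = -((-1 : ℂ) ^ (k + 1) • extDC ρ x (k + 1))
    rw [pow_succ, mul_neg_one]
    ext v
    simp

namespace GenAlmostComplex

variable (𝒥 : GenAlmostComplex E M)

theorem isGC (x : M) : IsGC (𝒥.J x) := isGC_of_continuousLinearMap (𝒥.sq x) (𝒥.orthogonal x)

/-- The section `a - i J a` of `L`. -/
def toL (A : ∀ x : M, TT E x) (x : M) : Cx (TT E x) := ⟨A x, -𝒥.J x (A x)⟩

/-- The section `a + i J a` of `L̄`. -/
def toLbar (A : ∀ x : M, TT E x) (x : M) : Cx (TT E x) := ⟨A x, 𝒥.J x (A x)⟩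

variable {𝒥} {A B : ∀ x : M, TT E x} {ρ : ∀ x : M, Spinor (T E x)}

theorem isSectionL_toL (hA : SmoothTT A) : 𝒥.IsSectionL (𝒥.toL A) :=
  ⟨hA, (𝒥.smooth A hA).neg, fun x => (mem_eigenL_iff (𝒥.isGC x) _).2 rfl⟩

theorem smoothCx_toLbar (hA : SmoothTT A) : SmoothCx (𝒥.toLbar A) := ⟨hA, 𝒥.smooth A hA⟩

theorem cliffordC_toL (x : M) (φ : Spinor (T E x)) :
    cliffordC (𝒥.toL A x) φ = lop cl (𝒥.J x) (A x) φ :=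
  cliffordC_of_mem_eigenL (𝒥.isGC x) ((mem_eigenL_iff (𝒥.isGC x) _).2 rfl) φ

theorem cliffordC_toLbar (x : M) (φ : Spinor (T E x)) :
    cliffordC (𝒥.toLbar A x) φ = lbar cl (𝒥.J x) (A x) φ :=
  cliffordC_of_mem_eigenLbar (𝒥.isGC x) ((mem_eigenLbar_iff (𝒥.isGC x) _).2 rfl) φ

theorem smooth_lop (hA : SmoothTT A) (hρ : SmoothSpinor ρ) :
    SmoothSpinor fun x => lop cl (𝒥.J x) (A x) (ρ x) := by
  have h := hρ.cliffordC (A := 𝒥.toL A) ⟨hA, (𝒥.smooth A hA).neg⟩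
  simpa only [cliffordC_toL] using h

theorem smooth_lbar (hA : SmoothTT A) (hρ : SmoothSpinor ρ) :
    SmoothSpinor fun x => lbar cl (𝒥.J x) (A x) (ρ x) := by
  have h := hρ.cliffordC (smoothCx_toLbar (𝒥 := 𝒥) hA)
  simpa only [cliffordC_toLbar] using h

/-- The Courant bracket of two sections of `L` as a derived bracket. -/
theorem lop_derived_bracket [FiniteDimensional ℝ E] (hA : SmoothTT A) (hB : SmoothTT B)
    (hρ : SmoothSpinor ρ) (x : M) :
    extDC (fun y => lop cl (𝒥.J y) (A y) (lop cl (𝒥.J y) (B y) (ρ y))) x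
      + lop cl (𝒥.J x) (A x) (extDC (fun y => lop cl (𝒥.J y) (B y) (ρ y)) x)
      - lop cl (𝒥.J x) (B x) (extDC (fun y => lop cl (𝒥.J y) (A y) (ρ y)) x)
      - lop cl (𝒥.J x) (B x) (lop cl (𝒥.J x) (A x) (extDC ρ x)) =
    cliffordC (courantC (𝒥.toL A) (𝒥.toL B) x) (ρ x) := by
  have h := derived_bracket_courantC (A := 𝒥.toL A) (B := 𝒥.toL B)
    ⟨hA, (𝒥.smooth A hA).neg⟩ ⟨hB, (𝒥.smooth B hB).neg⟩ (fun x => ?_) (fun x => ?_) hρ x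
  · simpa only [cliffordC_toL] using h
  · change _ = pairing (-𝒥.J x (A x)) (-𝒥.J x (B x))
    rw [pairing_neg_left, pairing_neg_right, neg_neg, 𝒥.orthogonal]
    rfl
  · change pairing (A x) (-𝒥.J x (B x)) = -pairing (-𝒥.J x (A x)) (B x)
    rw [pairing_neg_left, pairing_neg_right, (𝒥.isGC x).skew, neg_neg]

/-- The Courant bracket of two sections of `L̄` as a derived bracket. -/
theorem lbar_derived_bracket [FiniteDimensional ℝ E] (hA : SmoothTT A) (hB : SmoothTT B)
    (hρ : SmoothSpinor ρ) (x : M) :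
    extDC (fun y => lbar cl (𝒥.J y) (A y) (lbar cl (𝒥.J y) (B y) (ρ y))) x
      + lbar cl (𝒥.J x) (A x) (extDC (fun y => lbar cl (𝒥.J y) (B y) (ρ y)) x)
      - lbar cl (𝒥.J x) (B x) (extDC (fun y => lbar cl (𝒥.J y) (A y) (ρ y)) x)
      - lbar cl (𝒥.J x) (B x) (lbar cl (𝒥.J x) (A x) (extDC ρ x)) =
    cliffordC (courantC (𝒥.toLbar A) (𝒥.toLbar B) x) (ρ x) := by
  have h := derived_bracket_courantC (A := 𝒥.toLbar A) (B := 𝒥.toLbar B)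
    (smoothCx_toLbar hA) (smoothCx_toLbar hB) (fun x => (𝒥.orthogonal x _ _).symm) (fun x => ?_)
    hρ x
  · simpa only [cliffordC_toLbar] using h
  · change pairing (A x) (𝒥.J x (B x)) = -pairing (𝒥.J x (A x)) (B x)
    rw [(𝒥.isGC x).skew, neg_neg]

/-- If `L` is Courant involutive, then so is `L̄`. -/
theorem Integrable.courantC_toLbar (h𝒥 : 𝒥.Integrable) (hA : SmoothTT A) (hB : SmoothTT B)
    (x : M) : courantC (𝒥.toLbar A) (𝒥.toLbar B) x ∈ eigenLbar (𝒥.J x) := by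
  have h := h𝒥 _ _ (isSectionL_toL hA) (isSectionL_toL hB) x
  have hc : ∀ A, (fun x => (𝒥.toL A x).conj) = 𝒥.toLbar A := fun A => funext fun x =>
    Cx.ext rfl (neg_neg _)
  rw [← hc, ← hc, courantC_conj ⟨hA, (𝒥.smooth A hA).neg⟩ ⟨hB, (𝒥.smooth B hB).neg⟩]
  have hcc : ∀ z : Cx (TT E x), z.conj.conj = z := fun z => Cx.ext rfl (neg_neg _)
  change Cx.conj (Cx.conj (courantC (𝒥.toL A) (𝒥.toL B) x)) ∈ eigenL (𝒥.J x)
  rwa [hcc]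

end GenAlmostComplex

end SmoothGrading

/-! ### Smoothness of the projections and of the parity -/

section SmoothProjections

theorem eq_smul_of_smul_eq_neg {S : Type*} [AddCommGroup S] [Module ℂ S] {z w : ℂ} {a b : S}
    (h : z • a = -b) (hz : w = -z) : b = w • a := by
  rw [hz, neg_smul, h, neg_neg]

variable {E : Type*} [NormedAddCommGroup E] [NormedSpace ℝ E]
  {M : Type*} [TopologicalSpace M] [ChartedSpace E M]

instance t2Space_tangentSpace (x : M) : T2Space (T E x) := inferInstanceAs (T2Space E)

instance finiteDimensional_tangentSpace [FiniteDimensional ℝ E] (x : M) :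
    FiniteDimensional ℝ (T E x) := inferInstanceAs (FiniteDimensional ℝ E)

namespace GenAlmostComplex

variable [IsManifold 𝓘(ℝ, E) ∞ M]

variable {𝒥 : GenAlmostComplex E M} {ρ : ∀ x : M, Spinor (T E x)}

/-- Polynomials in the number operator of a smooth dual frame preserve smoothness. -/
theorem smooth_aeval_numOp {ι : Type*} [Fintype ι] {b b' : ι → ∀ x : M, TT E x}
    (hb : ∀ i, SmoothTT (b i)) (hb' : ∀ i, SmoothTT (b' i)) (hρ : SmoothSpinor ρ)
    (p : Polynomial ℂ) :
    SmoothSpinor fun x => Polynomial.aeval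
      (numOp cl (𝒥.J x) (fun i => b i x) (fun i => b' i x)) p (ρ x) := by
  have hN : ∀ n : ℕ, SmoothSpinor fun x =>
      (numOp cl (𝒥.J x) (fun i => b i x) (fun i => b' i x) ^ n) (ρ x) := fun n => by
    induction n with
    | zero => exact hρ
    | succ n ih =>
      have h := (SmoothSpinor.sum Finset.univ fun i =>
        smooth_lbar (𝒥 := 𝒥) (hb i) (smooth_lop (𝒥 := 𝒥) (hb' i) ih)).smul (1 / 4 : ℂ)
      convert h using 2 with x
      rw [pow_succ', Module.End.mul_apply]
      simp only [numOp, LinearMap.smul_apply, LinearMap.sum_apply, Module.End.mul_apply]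
  have h := SmoothSpinor.sum (Finset.range (p.natDegree + 1)) fun i => (hN i).smul (p.coeff i)
  convert h using 2 with x
  rw [Polynomial.aeval_eq_sum_range, LinearMap.sum_apply]
  rfl

variable [FiniteDimensional ℝ E]

theorem isSectionU_lop {A : ∀ x : M, TT E x} (hA : SmoothTT A) {k : ℤ}
    (hρ : 𝒥.IsSectionU k ρ) : 𝒥.IsSectionU (k - 1) fun x => lop cl (𝒥.J x) (A x) (ρ x) :=
  ⟨smooth_lop hA hρ.1, fun x => lop_mem_gradedU (𝒥.isGC x) _ (hρ.2 x)⟩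

theorem isSectionU_lbar {A : ∀ x : M, TT E x} (hA : SmoothTT A) {k : ℤ}
    (hρ : 𝒥.IsSectionU k ρ) : 𝒥.IsSectionU (k + 1) fun x => lbar cl (𝒥.J x) (A x) (ρ x) :=
  ⟨smooth_lbar hA hρ.1, fun x => lbar_mem_gradedU (𝒥.isGC x) _ (hρ.2 x)⟩

variable [T2Space M]

/-- The projections to `U_k` preserve smoothness, being polynomials in the number operator. -/
theorem smooth_projU (hρ : SmoothSpinor ρ) (k : ℤ) :
    SmoothSpinor fun x => projU (𝒥.J x) k (ρ x) := by
  refine smoothSpinor_of_eventuallyEq fun x₀ => ?_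
  obtain ⟨b, b', hb, hb', hf⟩ := exists_smooth_dualFrame (E := E) x₀
  refine ⟨_, smooth_aeval_numOp (𝒥 := 𝒥) hb hb' hρ (projPoly E k), hf.mono fun x hx => ?_⟩
  exact (aeval_numOp_projPoly (𝒥.isGC x) hx k (ρ x)).symm

theorem continuous_paritySign : Continuous fun x : M => paritySign (𝒥.J x) := by
  have h : SmoothSpinor fun x : M => gradedParity (𝒥.J x) (oneSpinor (T E x)) := by
    have h1 := SmoothSpinor.sum (Finset.Icc 0 (finrank ℝ E : ℤ)) fun k : ℤ =>
      (smooth_projU (𝒥 := 𝒥) (smoothSpinor_oneSpinor (E := E) (M := M)) k).smul ((-1) ^ k)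
    convert h1 using 2 with x
    simp only [gradedParity, LinearMap.sum_apply, LinearMap.smul_apply]
    rfl
  have h2 : ContMDiff 𝓘(ℝ, E) 𝓘(ℝ, ℂ) ∞ fun x : M => paritySign (𝒥.J x) := fun x₀ => by
    rw [contMDiffAt_iff_contDiffAt]
    have h3 := (ContinuousAlternatingMap.apply ℝ E ℂ (![] : Fin 0 → E)).contDiff.contDiffAt.comp _
      (smoothSpinor_iff.1 h x₀ 0)
    refine h3.congr_of_eventuallyEq (Filter.Eventually.of_forall fun y => ?_)
    refine congrArg (gradedParity _ _ 0) (funext fun i => i.elim0)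
  exact h2.continuous

/-- The parity sign is locally constant, being continuous with values `±1`. -/
theorem eventually_paritySign_eq (x₀ : M) :
    ∀ᶠ x in nhds x₀, paritySign (𝒥.J x) = paritySign (𝒥.J x₀) := by
  have h := (continuous_paritySign (𝒥 := 𝒥)).tendsto x₀
  have h1 := h.eventually (Metric.ball_mem_nhds _ one_pos)
  filter_upwards [h1] with x hx
  have hs := paritySign_mul_self (𝒥.isGC x)
  have hs0 := paritySign_mul_self (𝒥.isGC x₀)
  rcases mul_self_eq_one_iff.1 hs with hx1 | hx1 <;>
    rcases mul_self_eq_one_iff.1 hs0 with hx0 | hx0 <;> rw [hx1, hx0] at hx ⊢ <;>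
    norm_num [Complex.dist_eq] at hx

/-- `d` changes the parity. -/
theorem parity_extDC {k : ℤ} (hρ : 𝒥.IsSectionU k ρ) (x : M) :
    parity (extDC ρ x) = (paritySign (𝒥.J x) * (-1 : ℂ) ^ (k + 1)) • extDC ρ x := by
  have h1 := extDC_parity hρ.1 x
  rw [extDC_congr (ρ' := fun y => (paritySign (𝒥.J x) * (-1 : ℂ) ^ k) • ρ y)
    ((eventually_paritySign_eq (𝒥 := 𝒥) x).mono fun y hy => by
      rw [parity_of_mem_gradedU (𝒥.isGC y) (hρ.2 y), hy]), extDC_smul hρ.1] at h1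
  refine eq_smul_of_smul_eq_neg (S := Spinor (T E x)) h1 ?_
  rw [zpow_add_one₀ (by norm_num)]
  ring

/-- Every generalized vector is a value of a smooth global section. -/
theorem exists_smoothTT_apply_eq {x : M} (a : TT E x) :
    ∃ A : ∀ y : M, TT E y, SmoothTT A ∧ A x = a := by
  obtain ⟨b, b', hb, hb', hf⟩ := exists_smooth_dualFrame (E := E) x
  refine ⟨fun y => ∑ i, (2 * pairing (b' i x) a) • b i y,
    SmoothTT.sum _ fun i => (hb i).const_smul _, (hf.self_of_nhds.expand a).symm⟩

end GenAlmostComplex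

end SmoothProjections

/-! ### Integrability and the decomposition of `d` -/

section Integrability

variable {E : Type*} [NormedAddCommGroup E] [NormedSpace ℝ E] [FiniteDimensional ℝ E]
  {M : Type*} [TopologicalSpace M] [ChartedSpace E M] [IsManifold 𝓘(ℝ, E) ∞ M]

namespace GenAlmostComplex

variable {𝒥 : GenAlmostComplex E M} {ρ : ∀ x : M, Spinor (T E x)}

/-- `d = ∂ + ∂̄` on a section of `U_k` means that `d` maps it into `U_{k-1} + U_{k+1}`. -/
theorem extDC_eq_del_add_delbar_iff {k : ℤ} :
    extDC ρ = 𝒥.del k ρ + 𝒥.delbar k ρ ↔ ∀ x, extDC ρ x ∈ adjU (𝒥.J x) k := by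
  rw [funext_iff]
  exact forall_congr' fun x => (mem_adjU_iff (𝒥.isGC x)).symm

/-- For integrable `𝒥`, if `d` respects the grading on `C^∞(U_{k-1})` and `C^∞(U_{k-2})`, then it
does so on `L̄ · L̄ · C^∞(U_{k-2})`. -/
theorem extDC_lbar_lbar_mem (h𝒥 : 𝒥.Integrable) {k : ℤ}
    (h1 : ∀ ρ, 𝒥.IsSectionU (k - 1) ρ → ∀ x, extDC ρ x ∈ adjU (𝒥.J x) (k - 1))
    (h2 : ∀ ρ, 𝒥.IsSectionU (k - 2) ρ → ∀ x, extDC ρ x ∈ adjU (𝒥.J x) (k - 2))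
    (hρ : 𝒥.IsSectionU (k - 2) ρ) {A B : ∀ x : M, TT E x} (hA : SmoothTT A) (hB : SmoothTT B)
    (x : M) : extDC (fun y => lbar cl (𝒥.J y) (A y) (lbar cl (𝒥.J y) (B y) (ρ y))) x ∈
      adjU (𝒥.J x) k := by
  have h := lbar_derived_bracket (𝒥 := 𝒥) hA hB hρ.1 x
  have hz := h𝒥.courantC_toLbar hA hB x
  rw [cliffordC_of_mem_eigenLbar (𝒥.isGC x) hz, sub_eq_iff_eq_add, sub_eq_iff_eq_add,
    ← eq_sub_iff_add_eq] at h
  rw [h]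
  have hk : k - 2 + 1 = k - 1 := by ring
  have hk' : k - 1 + 1 = k := by ring
  refine sub_mem (add_mem (add_mem ?_ ?_) ?_) ?_
  · have h3 := lbar_mem_gradedU (𝒥.isGC x) (courantC (𝒥.toLbar A) (𝒥.toLbar B) x).re (hρ.2 x)
    exact Submodule.mem_sup_left (hk ▸ h3)
  · have h3 := lbar_mem_adjU (𝒥.isGC x) (A x) (h2 _ hρ x)
    rw [hk] at h3
    exact hk' ▸ lbar_mem_adjU (𝒥.isGC x) (B x) h3
  · exact hk' ▸ lbar_mem_adjU (𝒥.isGC x) (B x) (h1 _ (hk ▸ isSectionU_lbar hA hρ) x)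
  · exact hk' ▸ lbar_mem_adjU (𝒥.isGC x) (A x) (h1 _ (hk ▸ isSectionU_lbar hB hρ) x)

variable [T2Space M]

theorem isSectionU_delbar {k : ℤ} (hρ : 𝒥.IsSectionU k ρ) :
    𝒥.IsSectionU (k + 1) (𝒥.delbar k ρ) :=
  ⟨smooth_projU (SmoothSpinor.extDC hρ.1) _, fun _ => projU_mem _ _ _⟩

theorem isSectionU_del {k : ℤ} (hρ : 𝒥.IsSectionU k ρ) :
    𝒥.IsSectionU (k - 1) (𝒥.del k ρ) :=
  ⟨smooth_projU (SmoothSpinor.extDC hρ.1) _, fun _ => projU_mem _ _ _⟩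

/-- For integrable `𝒥`, if `d` respects the grading on `C^∞(U_{k-1})` and `C^∞(U_{k-2})`, then
`L · L · d` maps `C^∞(U_k)` to `U_{k-3} + U_{k-1}`. -/
theorem lop_lop_extDC_mem (h𝒥 : 𝒥.Integrable) {k : ℤ}
    (h1 : ∀ ρ, 𝒥.IsSectionU (k - 1) ρ → ∀ x, extDC ρ x ∈ adjU (𝒥.J x) (k - 1))
    (h2 : ∀ ρ, 𝒥.IsSectionU (k - 2) ρ → ∀ x, extDC ρ x ∈ adjU (𝒥.J x) (k - 2))
    (hρ : 𝒥.IsSectionU k ρ) (x : M) (a b : TT E x) :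
    lop cl (𝒥.J x) a (lop cl (𝒥.J x) b (extDC ρ x)) ∈ adjU (𝒥.J x) (k - 2) := by
  obtain ⟨B, hB, rfl⟩ := exists_smoothTT_apply_eq a
  obtain ⟨A, hA, rfl⟩ := exists_smoothTT_apply_eq b
  have h := lop_derived_bracket (𝒥 := 𝒥) hA hB hρ.1 x
  have hz := h𝒥 _ _ (isSectionL_toL hA) (isSectionL_toL hB) x
  rw [cliffordC_of_mem_eigenL (𝒥.isGC x) hz, sub_eq_iff_eq_add, ← sub_eq_iff_eq_add'] at h
  rw [← h]
  have hk : k - 1 - 1 = k - 2 := by ring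
  refine sub_mem (sub_mem (add_mem ?_ ?_) ?_) ?_
  · exact h2 _ (hk ▸ isSectionU_lop hA (isSectionU_lop hB hρ)) x
  · exact hk ▸ lop_mem_adjU (𝒥.isGC x) (A x) (h1 _ (isSectionU_lop hB hρ) x)
  · exact hk ▸ lop_mem_adjU (𝒥.isGC x) (B x) (h1 _ (isSectionU_lop hA hρ) x)
  · have h3 := lop_mem_gradedU (𝒥.isGC x) (courantC (𝒥.toL A) (𝒥.toL B) x).re (hρ.2 x)
    refine Submodule.mem_sup_right ?_
    convert h3 using 2
    ring

/-- Integrability implies `d C^∞(U_k) ⊆ C^∞(U_{k-1} ⊕ U_{k+1})`. For `k = 0` and `k = 1` this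
follows from the involutivity of `L` and a parity argument; for `k ≥ 2` the sections of `U_k` are
locally sums of sections of `L̄ · L̄ · U_{k-2}`, and the involutivity of `L̄` is used. -/
theorem Integrable.extDC_mem_adjU (h𝒥 : 𝒥.Integrable) (k : ℤ) :
    ∀ ρ, 𝒥.IsSectionU k ρ → ∀ x, extDC ρ x ∈ adjU (𝒥.J x) k := by
  have hneg : ∀ k : ℤ, k < 0 → ∀ ρ, 𝒥.IsSectionU k ρ → ∀ x, extDC ρ x ∈ adjU (𝒥.J x) k := by
    intro k hk ρ hρ x
    have h0 : ρ = fun _ => 0 := funext fun y => by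
      have h := hρ.2 y
      rw [U, gradedU_eq_bot (by rw [Finset.mem_Icc]; omega)] at h
      exact (Submodule.mem_bot ℂ).1 h
    rw [h0, extDC_zero]
    exact zero_mem _
  have key : ∀ n : ℕ, ∀ k : ℤ, k < n → ∀ ρ, 𝒥.IsSectionU k ρ → ∀ x,
      extDC ρ x ∈ adjU (𝒥.J x) k := by
    intro n
    induction n with
    | zero => exact fun k hk => hneg k (by simpa using hk)
    | succ n ih =>
      intro k hk ρ hρ x
      push_cast at hk
      have h1 := ih (k - 1) (by omega)
      have h2 := ih (k - 2) (by omega)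
      rcases lt_or_ge k 0 with hk0 | hk0
      · exact hneg k hk0 ρ hρ x
      by_cases hk1 : k = 0 ∨ k = 1
      · exact mem_adjU_of_lop_lop (𝒥.isGC x) hk1 (lop_lop_extDC_mem h𝒥 h1 h2 hρ x)
          (parity_extDC hρ x)
      -- For `k ≥ 2`, near `x` the section `16 k (k - 1) ρ` is a sum over a dual frame.
      obtain ⟨b, b', hb, hb', hf⟩ := exists_smooth_dualFrame (E := E) x
      have hk2 : k - 1 - 1 = k - 2 := by ring
      have hσ : ∀ i j, 𝒥.IsSectionU (k - 2) fun y =>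
          lop cl (𝒥.J y) (b' j y) (lop cl (𝒥.J y) (b' i y) (ρ y)) := fun i j =>
        hk2 ▸ isSectionU_lop (hb' j) (isSectionU_lop (hb' i) hρ)
      have hs : ∀ i j, SmoothSpinor fun y => lbar cl (𝒥.J y) (b i y) (lbar cl (𝒥.J y) (b j y)
          (lop cl (𝒥.J y) (b' j y) (lop cl (𝒥.J y) (b' i y) (ρ y)))) := fun i j =>
        smooth_lbar (hb i) (smooth_lbar (hb j) (hσ i j).1)
      have hd : extDC (fun y => ∑ i, ∑ j, lbar cl (𝒥.J y) (b i y) (lbar cl (𝒥.J y) (b j y)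
          (lop cl (𝒥.J y) (b' j y) (lop cl (𝒥.J y) (b' i y) (ρ y))))) x ∈ adjU (𝒥.J x) k := by
        rw [extDC_sum _ fun i => SmoothSpinor.sum _ (hs i)]
        refine sum_mem fun i _ => ?_
        rw [extDC_sum _ (hs i)]
        exact sum_mem fun j _ => extDC_lbar_lbar_mem h𝒥 h1 h2 (hσ i j) (hb i) (hb j) x
      rw [extDC_congr (ρ' := fun y => (16 * (k * (k - 1)) : ℂ) • ρ y)
        (hf.mono fun y hy => sum_lbar_lbar_lop_lop (𝒥.isGC y) hy (hρ.2 y)), extDC_smul hρ.1] at hd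
      refine (Submodule.smul_mem_iff _ ?_).1 hd
      have hk3 : (16 * (k * (k - 1)) : ℤ) ≠ 0 :=
        mul_ne_zero (by norm_num) (mul_ne_zero (by omega) (by omega))
      exact_mod_cast hk3
  exact key (k.toNat + 1) k (by push_cast; omega)

/-- The decomposition `d = ∂ + ∂̄` implies integrability: the `L̄`-component of the bracket of two
sections of `L` acts trivially on spinors, since it would raise the degree in the grading. -/
theorem integrable_of_extDC_mem_adjU
    (h : ∀ k ρ, 𝒥.IsSectionU k ρ → ∀ x, extDC ρ x ∈ adjU (𝒥.J x) k) : 𝒥.Integrable := by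
  have hL : ∀ A : ∀ x : M, Cx (TT E x), 𝒥.IsSectionL A → A = 𝒥.toL fun x => (A x).re :=
    fun A hA => funext fun x => Cx.ext rfl ((mem_eigenL_iff (𝒥.isGC x) _).1 (hA.2.2 x))
  intro A B hA hB x
  rw [hL A hA, hL B hB]
  obtain ⟨hA, -⟩ := hA
  obtain ⟨hB, -⟩ := hB
  set a := fun x => (A x).re
  set b := fun x => (B x).re
  set z := courantC (𝒥.toL a) (𝒥.toL b) x
  have hk : ∀ k : ℤ, k - 1 - 1 = k - 2 := fun k => by ring
  -- All terms of the derived bracket have degree at most `k - 1`.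
  have hz : ∀ k ρ, 𝒥.IsSectionU k ρ → cliffordC z (ρ x) ∈ adjU (𝒥.J x) (k - 2) := by
    intro k ρ hρ
    rw [← lop_derived_bracket (𝒥 := 𝒥) hA hB hρ.1 x]
    have hs := fun {A : ∀ x : M, TT E x} (hA : SmoothTT A) => isSectionU_lop hA hρ
    refine sub_mem (sub_mem (add_mem ?_ ?_) ?_) ?_
    · exact h _ _ (hk k ▸ isSectionU_lop hA (hs hB)) x
    · exact hk k ▸ lop_mem_adjU (𝒥.isGC x) (a x) (h _ _ (hs hB) x)
    · exact hk k ▸ lop_mem_adjU (𝒥.isGC x) (b x) (h _ _ (hs hA) x)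
    · exact hk k ▸ lop_mem_adjU (𝒥.isGC x) (b x) (lop_mem_adjU (𝒥.isGC x) (a x) (h _ _ hρ x))
  have hq : ∀ ρ : ∀ y : M, Spinor (T E y), SmoothSpinor ρ →
      lbar cl (𝒥.J x) (z.re - 𝒥.J x z.im) (ρ x) = 0 := by
    intro ρ hρ
    rw [← sum_projU (𝒥.isGC x) (ρ x), map_sum]
    refine Finset.sum_eq_zero fun k _ => ?_
    exact lbar_eq_zero_of_mem_adjU (𝒥.isGC x) (projU_mem _ _ _)
      (hz k (fun y => projU (𝒥.J y) k (ρ y)) ⟨smooth_projU hρ k, fun y => projU_mem _ _ _⟩)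
  -- `z.re - J z.im` is twice the real part of the `L̄`-component of `z`.
  have h0 : z.re - 𝒥.J x z.im = 0 := by
    refine eq_zero_of_lbar_oneSpinor
      (hq (fun y => oneSpinor (T E y)) smoothSpinor_oneSpinor) fun v => ?_
    obtain ⟨C, hC, rfl⟩ := exists_smoothTT_apply_eq v
    exact hq (fun y => clifford (C y) (oneSpinor (T E y))) (smoothSpinor_oneSpinor.clifford hC)
  rw [mem_eigenL_iff (𝒥.isGC x), sub_eq_zero.1 h0, 𝒥.sq, neg_neg]

end GenAlmostComplex

end Integrability

end

end GenCx

theorem mainTheorem5 {E : Type*} [NormedAddCommGroup E] [NormedSpace ℝ E] [FiniteDimensional ℝ E]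
    {M : Type*} [TopologicalSpace M] [T2Space M] [ChartedSpace E M] [IsManifold 𝓘(ℝ, E) ∞ M]
    (𝒥 : GenCx.GenAlmostComplex E M) :
    (∀ x : M, DirectSum.IsInternal (𝒥.U x)) ∧
    (∀ (k : ℤ) (ρ : ∀ x : M, GenCx.Spinor (GenCx.T E x)), 𝒥.IsSectionU k ρ →
      𝒥.IsSectionU (k + 1) (𝒥.delbar k ρ) ∧ 𝒥.IsSectionU (k - 1) (𝒥.del k ρ)) ∧
    (𝒥.Integrable ↔
      ∀ (k : ℤ) (ρ : ∀ x : M, GenCx.Spinor (GenCx.T E x)), 𝒥.IsSectionU k ρ →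
        GenCx.extDC ρ = 𝒥.del k ρ + 𝒥.delbar k ρ) := by
  refine ⟨fun x => GenCx.isInternal_gradedU (𝒥.isGC x), fun k ρ hρ =>
    ⟨GenCx.GenAlmostComplex.isSectionU_delbar hρ, GenCx.GenAlmostComplex.isSectionU_del hρ⟩,
    fun h k ρ hρ => ?_, fun h => ?_⟩
  · exact GenCx.GenAlmostComplex.extDC_eq_del_add_delbar_iff.2 (h.extDC_mem_adjU k ρ hρ)
  · exact GenCx.GenAlmostComplex.integrable_of_extDC_mem_adjU fun k ρ hρ =>
      GenCx.GenAlmostComplex.extDC_eq_del_add_delbar_iff.1 (h k ρ hρ)
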